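/- Let $\mathcal C$ be a finite naturally labelled causal set: elements $1,\dots,N$ with a strict partial order $\prec$ such that $x\prec y\Rightarrow x<y$. Let $\Delta^R$ be a real retarded propagator ($\Delta^R_{xy}=0$ unless $y\prec x$) and $\Delta=\Delta^R-(\Delta^R)^T$. Let $\phi_x$, $x\in\mathcal C$, be the free field with $[\phi_x,\phi_y]=i\Delta_{xy}$ in a Gaussian state $\langle\cdot\rangle$ with real one-point functions $m_x$ and truncated Wightman function $W_{xy}=\langle\phi_x\phi_y\rangle-m_xm_y$; concretely $W=AA^\dagger$, $W-\overline W=i\Delta$, $\phi_x=m_x+\sum_k(A_{xk}a_k+\overline{A_{xk}}a_k^\dagger)$, and $\langle\cdot\rangle$ is the expectation in the Fock vacuum. Let $$D_0(\xi,\bar\xi)=\langle\delta(\phi_1-\bar\xi_1)\cdots\delta(\phi_N-\bar\xi_N)\,\delta(\phi_N-\xi_N)\cdots\delta(\phi_1-\xi_1)\rangle$$ be the free decoherence functional, a tempered distribution on $\mathbb R^N\times\mathbb R^N$. Integrals $\int d^N\xi\,d^N\bar\xi\,D_0F$ are oscillatory integrals, i.e. the limit as $\varepsilon\to0^+$ of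 the pairing of $D_0$ with $F(\cdot)\,\chi(\varepsilon\,\cdot)$, required to exist and to be the same for every Schwartz function $\chi$ with $\chi(0)=1$. Let $P_x$ be real polynomials, $V_{int}(\xi)=\sum_xP_x(\xi_x)$, $H(x)=P_x(\phi_x)$. Let $C$ (resp. $\overline C$) order products by decreasing (resp. increasing) label from left to right, and put $\hat S=C[\prod_ze^{-iH(z)}]$, $V_x=C[\prod_{z\prec x}e^{-iH(z)}]$, $\phi^H_x=V_x^\dagger\phi_xV_x$; let $C[\phi^H_x\phi^H_y]$ be $\phi^H_x\phi^H_y$ if $y\prec x$ and $\phi^H_y\phi^H_x$ otherwise. Define $$\mathcal Z^{in-out}[J]=\frac{\int d^N\xi\,d^N\bar\xi\,D_0(\xi,\bar\xi)\,e^{-iV_{int}(\xi)}e^{-iJ\cdot\xi}}{\int d^N\xi\,d^N\bar\xi\,D_0(\xi,\bar\xi)\,e^{-iV_{int}(\xi)}},\qquad J\in\mathbb R^N .$$ Then for all $x,y\in\mathcal C$: 1. The integrals in the numerator (for every $J$) and in the denominator converge, and the denominator equals $\langle\hat S\rangle$. 2. If $\langle\hat S\rangle\neq0$, then $\partial\mathcal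 Z^{in-out}/\partial J_y$ exists at every $J$, its derivative with respect to $J_x$ exists at $J=0$, and $$i\frac{\partial}{\partial J_x}\,i\frac{\partial}{\partial J_y}\,\mathcal Z^{in-out}[J]\Big|_{J=0}=\frac{\langle\hat S\,C[\phi^H_x\phi^H_y]\rangle}{\langle\hat S\rangle}.$$ 3. Replace $P_z$ by $g_zP_z$ with coupling constants $g=(g_1,\dots,g_N)\in\mathbb R^N$. The in-in correlator $\langle C[\phi^H_x\phi^H_y]\rangle$ is a polynomial in $g$: its expansion terminates. 4. The in-out correlator $\langle\hat S\,C[\phi^H_x\phi^H_y]\rangle/\langle\hat S\rangle$ has an expansion in powers of the couplings (a formal power series in $g_1,\dots,g_N$, asymptotic to it to all orders at $g=0$). If $\deg P_x\ge2$ and the truncated free Feynman propagator $\langle C[\phi_x\phi_y]\rangle-m_xm_y$ is nonzero, this expansion does not terminate: infinitely many of its coefficients, already among those of the pure powers $g_x^n$, are nonzero. -/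

import Mathlib

open scoped SchwartzMap FourierTransform LineDeriv Polynomial ComplexConjugate

noncomputable section

namespace CausalSetQFT

/-! ### Causal sets and propagators -/

/-- A finite naturally labelled causal set with `N` elements: a strict partial order on the label
set `Fin N` (labels `0, …, N - 1`) such that `x ≺ y` implies `x < y`. Irreflexivity and antisymmetry
follow from the last condition, local finiteness from finiteness. -/
structure Causet (N : ℕ) where
  prec : Fin N → Fin N → Prop
  prec_trans : ∀ x y z, prec x y → prec y z → prec x z
  natural : ∀ x y, prec x y → x < y

/-- `ΔR` is a retarded propagator on `C`: it vanishes at `(x, y)` unless `y ≺ x`. -/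
def IsRetarded {N : ℕ} (C : Causet N) (ΔR : Matrix (Fin N) (Fin N) ℝ) : Prop :=
  ∀ x y, ¬ C.prec y x → ΔR x y = 0

/-- The Pauli-Jordan function `Δ = ΔR - ΔA`, where the advanced propagator is `ΔA x y = ΔR y x`. -/
def pauliJordan {N : ℕ} (ΔR : Matrix (Fin N) (Fin N) ℝ) : Matrix (Fin N) (Fin N) ℝ :=
  ΔR - ΔR.transpose

/-! ### Oscillator modes on Schwartz space

The Fock space of `r` bosonic modes is `L²(ℝ^r)`. All operators act on the common invariant
dense domain of Schwartz functions. -/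

/-- Configuration space of `r` modes. -/
abbrev Modes (r : ℕ) : Type := EuclideanSpace ℝ (Fin r)

/-- Linear operators on the Schwartz functions of `r` variables. -/
abbrev Op (r : ℕ) : Type := Module.End ℂ 𝓢(Modes r, ℂ)

/-- Multiplication by the coordinate `q k`. -/
def position {r : ℕ} (k : Fin r) : Op r :=
  (SchwartzMap.smulLeftCLM ℂ (fun q : Modes r => ((q k : ℝ) : ℂ))).toLinearMap

/-- The partial derivative with respect to the coordinate `q k`. -/
def partialDeriv {r : ℕ} (k : Fin r) : Op r :=
  (LineDeriv.lineDerivOpCLM ℂ 𝓢(Modes r, ℂ) (EuclideanSpace.single k (1 : ℝ))).toLinearMap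

/-- The annihilation operator `a_k = (q_k + ∂_k) / √2`. -/
def annihilation {r : ℕ} (k : Fin r) : Op r :=
  ((1 / √2 : ℝ) : ℂ) • (position k + partialDeriv k)

/-- The creation operator `a_k† = (q_k - ∂_k) / √2`. -/
def creation {r : ℕ} (k : Fin r) : Op r :=
  ((1 / √2 : ℝ) : ℂ) • (position k - partialDeriv k)

theorem position_apply {r : ℕ} (k : Fin r) (ψ : 𝓢(Modes r, ℂ)) (q : Modes r) :
    position k ψ q = ((q k : ℝ) : ℂ) * ψ q := by
  have h : (fun q : Modes r => ((q k : ℝ) : ℂ)).HasTemperateGrowth :=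
    (Complex.ofRealCLM ∘L (EuclideanSpace.proj k : Modes r →L[ℝ] ℝ)).hasTemperateGrowth
  simp [position, SchwartzMap.smulLeftCLM_apply_apply h]

theorem partialDeriv_apply {r : ℕ} (k : Fin r) (ψ : 𝓢(Modes r, ℂ)) (q : Modes r) :
    partialDeriv k ψ q = fderiv ℝ ψ q (EuclideanSpace.single k 1) := by
  simp [partialDeriv, SchwartzMap.lineDerivOp_apply_eq_fderiv]

theorem position_comm {r : ℕ} (j k : Fin r) :
    (position j : Op r) * position k - position k * position j = 0 := by
  ext ψ q
  simp [position_apply]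
  ring

theorem partialDeriv_comm {r : ℕ} (j k : Fin r) :
    (partialDeriv j : Op r) * partialDeriv k - partialDeriv k * partialDeriv j = 0 := by
  rw [sub_eq_zero]
  ext ψ q
  have h : ∀ i : Fin r, (partialDeriv i ψ : Modes r → ℂ) =
      fun q => fderiv ℝ ψ q (EuclideanSpace.single i 1) := fun i => by
    funext q; exact partialDeriv_apply i ψ q
  have hd : Differentiable ℝ (fderiv ℝ ψ) :=
    ((ψ.smooth 2).fderiv_right (m := 1) (by norm_num)).differentiable (by norm_num)
  have hs : IsSymmSndFDerivAt ℝ ψ q :=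
    (ψ.smooth 2).contDiffAt.isSymmSndFDerivAt (by simp)
  simp only [Module.End.mul_apply, partialDeriv_apply, h]
  rw [fderiv_clm_apply (hd q) (by fun_prop), fderiv_clm_apply (hd q) (by fun_prop)]
  simpa using hs _ _

theorem partialDeriv_position {r : ℕ} (j k : Fin r) :
    (partialDeriv j : Op r) * position k - position k * partialDeriv j =
      (if j = k then (1 : ℂ) else 0) • (1 : Op r) := by
  ext ψ q
  have h : (position k ψ : Modes r → ℂ) = (fun q => ((q k : ℝ) : ℂ)) * ⇑ψ := by
    funext q; exact position_apply k ψ q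
  have h1 : HasFDerivAt (fun q : Modes r => ((q k : ℝ) : ℂ))
      (Complex.ofRealCLM ∘L (EuclideanSpace.proj k : Modes r →L[ℝ] ℝ)) q :=
    (Complex.ofRealCLM ∘L (EuclideanSpace.proj k : Modes r →L[ℝ] ℝ)).hasFDerivAt
  have h2 := (h1.mul ψ.differentiableAt.hasFDerivAt).fderiv
  simp only [LinearMap.sub_apply, Module.End.mul_apply, sub_apply,
    partialDeriv_apply, position_apply, h, h2]
  by_cases hjk : j = k
  · subst hjk; simp
  · simp [hjk, Ne.symm hjk]

/-- The commutation relations of ladder operators follow from those of positions and derivatives. -/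
theorem ladder_commutator {R : Type*} [Ring R] [Algebra ℂ R] {r : ℕ} (Q D : Fin r → R)
    (hQ : ∀ j k, Q j * Q k - Q k * Q j = 0) (hD : ∀ j k, D j * D k - D k * D j = 0)
    (hDQ : ∀ j k, D j * Q k - Q k * D j = (if j = k then (1 : ℂ) else 0) • (1 : R))
    (m n : ℂ) (f g : Fin r → ℂ) (a b : Fin r → R)
    (ha : ∀ k, a k = ((1 / √2 : ℝ) : ℂ) • (Q k + D k))
    (hb : ∀ k, b k = ((1 / √2 : ℝ) : ℂ) • (Q k - D k)) :
    (m • (1 : R) + ∑ k, (f k • a k + conj (f k) • b k)) *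
        (n • (1 : R) + ∑ k, (g k • a k + conj (g k) • b k)) -
      (n • (1 : R) + ∑ k, (g k • a k + conj (g k) • b k)) *
        (m • (1 : R) + ∑ k, (f k • a k + conj (f k) • b k)) =
      (∑ k, (f k * conj (g k) - conj (f k) * g k)) • (1 : R) := by
  obtain ⟨c, hc⟩ : ∃ c : R →ₗ[ℂ] R →ₗ[ℂ] R, ∀ u v, c u v = u * v - v * u :=
    ⟨LinearMap.mul ℂ R - (LinearMap.mul ℂ R).flip, fun u v => by simp⟩
  have hs : ((1 / √2 : ℝ) : ℂ) * ((1 / √2 : ℝ) : ℂ) = 1 / 2 := by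
    rw [← Complex.ofReal_mul, div_mul_div_comm, Real.mul_self_sqrt (by norm_num)]; simp
  generalize ((1 / √2 : ℝ) : ℂ) = s at hs ha hb
  have hcQ : ∀ j k, c (Q j) (Q k) = 0 := fun j k => by rw [hc, hQ]
  have hcD : ∀ j k, c (D j) (D k) = 0 := fun j k => by rw [hc, hD]
  have hcDQ : ∀ j k, c (D j) (Q k) = (if j = k then (1 : ℂ) else 0) • (1 : R) := fun j k => by
    rw [hc, hDQ]
  have hcQD : ∀ j k, c (Q j) (D k) = -((if k = j then (1 : ℂ) else 0) • (1 : R)) := fun j k => by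
    rw [hc, ← hDQ, neg_sub]
  have h1l : ∀ z : R, c 1 z = 0 := fun z => by simp [hc]
  have h1r : ∀ z : R, c z 1 = 0 := fun z => by simp [hc]
  have key : ∀ j k, c (f j • a j + conj (f j) • b j) (g k • a k + conj (g k) • b k) =
      (if j = k then f j * conj (g j) - conj (f j) * g j else 0) • (1 : R) := fun j k => by
    rw [ha, ha, hb, hb]
    simp only [map_add, map_sub, map_smul, LinearMap.add_apply, LinearMap.sub_apply,
      LinearMap.smul_apply, hcQ, hcD, hcDQ, hcQD]
    by_cases h : j = k
    · subst h
      simp only [if_true, one_smul]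
      match_scalars
      linear_combination (2 * (f j * conj (g j)) - 2 * (conj (f j) * g j)) * hs
    · simp [h, Ne.symm h]
  rw [← hc]
  simp only [map_add c, LinearMap.add_apply, map_add (c _), map_smul, LinearMap.smul_apply, h1l,
    h1r, smul_zero, zero_add]
  simp only [map_sum, LinearMap.sum_apply, key]
  simp [← Finset.sum_smul, ite_smul]

theorem gaussian_smooth (r : ℕ) :
    ContDiff ℝ (⊤ : ℕ∞) (fun q : Modes r => Complex.exp (-((‖q‖ ^ 2 : ℝ) : ℂ) / 2)) := by
  have h : ContDiff ℝ (⊤ : ℕ∞) (fun q : Modes r => ((‖q‖ ^ 2 : ℝ) : ℂ)) :=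
    Complex.ofRealCLM.contDiff.comp (contDiff_norm_sq ℝ)
  exact (h.neg.div_const 2).cexp

theorem gaussian_decay (r : ℕ) (k n : ℕ) :
    ∃ B : ℝ, ∀ q : Modes r, ‖q‖ ^ k *
      ‖iteratedFDeriv ℝ n (fun q : Modes r => Complex.exp (-((‖q‖ ^ 2 : ℝ) : ℂ) / 2)) q‖ ≤ B := by
  obtain ⟨l, A, hA, hl⟩ :=
    (Function.hasTemperateGrowth_norm_sq (H := Modes r)).norm_iteratedFDeriv_le_uniform n
  have hg : ∀ i : ℕ, ∀ t : ℝ,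
      ‖iteratedFDeriv ℝ i (fun t : ℝ => Complex.exp ((-1 / 2 : ℝ) * t : ℝ)) t‖
        ≤ Real.exp ((-1 / 2) * t) := by
    intro i t
    have h0 : (fun t : ℝ => Complex.exp ((-1 / 2 : ℝ) * t : ℝ)) =
        Complex.ofRealLI ∘ fun t : ℝ => Real.exp ((-1 / 2) * t) := by
      funext t; simp
    have h4 : ContDiff ℝ (⊤ : ℕ∞) fun t : ℝ => Real.exp ((-1 / 2) * t) :=
      (contDiff_const.mul contDiff_id).exp
    rw [h0, LinearIsometry.norm_iteratedFDeriv_comp_left (n := (⊤ : ℕ∞)) _ h4.contDiffAt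
      (by exact_mod_cast le_top), norm_iteratedFDeriv_eq_norm_iteratedDeriv,
      iteratedDeriv_exp_const_mul, norm_mul, norm_pow, Real.norm_of_nonneg (Real.exp_pos _).le]
    refine mul_le_of_le_one_left (Real.exp_pos _).le (pow_le_one₀ (norm_nonneg _) ?_)
    norm_num
  have hb : ∃ B : ℝ, ∀ t : ℝ, 0 ≤ t →
      (1 + t) ^ (k + l * n) * Real.exp ((-1 / 2) * t ^ 2) ≤ B := by
    refine ⟨(k + l * n).factorial * Real.exp (3 / 2), fun t ht => ?_⟩
    have h5 := Real.pow_div_factorial_le_exp (1 + t) (by linarith) (k + l * n)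
    rw [div_le_iff₀ (by positivity)] at h5
    calc _ ≤ (Real.exp (1 + t) * (k + l * n).factorial) * Real.exp ((-1 / 2) * t ^ 2) := by gcongr
      _ = (k + l * n).factorial * Real.exp (1 + t + (-1 / 2) * t ^ 2) := by
        rw [Real.exp_add (1 + t)]; ring
      _ ≤ _ := by
        gcongr
        nlinarith [sq_nonneg (t - 1)]
  obtain ⟨B, hB⟩ := hb
  refine ⟨n.factorial * (A + 1) ^ n * B, fun q => ?_⟩
  have h1 : (fun q : Modes r => Complex.exp (-((‖q‖ ^ 2 : ℝ) : ℂ) / 2)) =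
      (fun t : ℝ => Complex.exp ((-1 / 2 : ℝ) * t : ℝ)) ∘ fun q : Modes r => ‖q‖ ^ 2 := by
    funext q; simp only [Function.comp]; congr 1; push_cast; ring
  have h2 := norm_iteratedFDeriv_comp_le (𝕜 := ℝ) (N := (⊤ : ℕ∞)) (n := n)
    (g := fun t : ℝ => Complex.exp ((-1 / 2 : ℝ) * t : ℝ)) (f := fun q : Modes r => ‖q‖ ^ 2)
    (C := Real.exp ((-1 / 2) * ‖q‖ ^ 2)) (D := (A + 1) * (1 + ‖q‖) ^ l)
    ((Complex.ofRealCLM.contDiff.comp (contDiff_const.mul contDiff_id)).cexp)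
    (contDiff_norm_sq ℝ) (by exact_mod_cast le_top) q (fun i _ => hg i _) (fun i hi hin => by
      have h3 : 1 ≤ (A + 1) * (1 + ‖q‖) ^ l := by
        have : (1 : ℝ) ≤ (1 + ‖q‖) ^ l := one_le_pow₀ (by linarith [norm_nonneg q])
        nlinarith
      calc _ ≤ A * (1 + ‖q‖) ^ l := hl i hin q
        _ ≤ (A + 1) * (1 + ‖q‖) ^ l := by gcongr; linarith
        _ ≤ _ := le_self_pow₀ h3 (by omega))
  rw [h1]
  calc _ ≤ (1 + ‖q‖) ^ k * (n.factorial * Real.exp ((-1 / 2) * ‖q‖ ^ 2) *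
          ((A + 1) * (1 + ‖q‖) ^ l) ^ n) := by
        gcongr
        linarith
    _ = n.factorial * (A + 1) ^ n *
          ((1 + ‖q‖) ^ (k + l * n) * Real.exp ((-1 / 2) * ‖q‖ ^ 2)) := by
        rw [mul_pow, pow_add, pow_mul]; ring
    _ ≤ _ := by
        gcongr
        exact hB _ (norm_nonneg q)

/-- The Fock vacuum `Ω(q) = π^(-r/4) exp(-|q|²/2)`: the unit vector annihilated by all `a_k`. -/
def vacuum (r : ℕ) : 𝓢(Modes r, ℂ) :=
  ((Real.pi ^ (-(r : ℝ) / 4) : ℝ) : ℂ) •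
    ({ toFun := fun q => Complex.exp (-((‖q‖ ^ 2 : ℝ) : ℂ) / 2)
       smooth' := gaussian_smooth r
       decay' := fun k n => gaussian_decay r k n } : 𝓢(Modes r, ℂ))

theorem annihilation_vacuum {r : ℕ} (k : Fin r) : annihilation k (vacuum r) = 0 := by
  have h0 : (vacuum r : Modes r → ℂ) = fun q => ((Real.pi ^ (-(r : ℝ) / 4) : ℝ) : ℂ) *
      Complex.exp (-((‖q‖ ^ 2 : ℝ) : ℂ) / 2) := rfl
  ext q
  have h1 : HasFDerivAt (fun q : Modes r => -((‖q‖ ^ 2 : ℝ) : ℂ) / 2)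
      (-(Complex.ofRealCLM ∘L innerSL ℝ q)) q := by
    have h3 := (Complex.ofRealCLM.hasFDerivAt (x := ‖q‖ ^ 2)).comp q
      (hasStrictFDerivAt_norm_sq q).hasFDerivAt
    refine (h3.const_mul (-1 / 2 : ℂ)).congr_fderiv ?_ |>.congr_of_eventuallyEq ?_
    · ext v
      simp
      ring
    · refine Filter.Eventually.of_forall fun q => ?_
      simp
      ring
  have h2 := (h1.cexp.const_mul ((Real.pi ^ (-(r : ℝ) / 4) : ℝ) : ℂ)).fderiv
  have h4 : position k (vacuum r) q + partialDeriv k (vacuum r) q = 0 := by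
    rw [position_apply, partialDeriv_apply, h0, h2]
    simp [EuclideanSpace.inner_single_right]
    ring
  simp only [annihilation, LinearMap.smul_apply, LinearMap.add_apply, smul_apply,
    add_apply, h4, smul_zero, zero_apply]

theorem vacuum_normalized (r : ℕ) : ∫ q : Modes r, conj (vacuum r q) * vacuum r q = 1 := by
  have h0 : ∀ q, conj (vacuum r q) * vacuum r q =
      ((Real.pi ^ (-(r : ℝ) / 2) * Real.exp (-1 * ‖q‖ ^ 2) : ℝ) : ℂ) := fun q => by
    have h1 : vacuum r q =
        ((Real.pi ^ (-(r : ℝ) / 4) * Real.exp (-‖q‖ ^ 2 / 2) : ℝ) : ℂ) := by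
      change ((Real.pi ^ (-(r : ℝ) / 4) : ℝ) : ℂ) * Complex.exp (-((‖q‖ ^ 2 : ℝ) : ℂ) / 2) = _
      push_cast; rfl
    rw [h1, Complex.conj_ofReal, ← Complex.ofReal_mul, mul_mul_mul_comm, ← Real.exp_add,
      ← Real.rpow_add Real.pi_pos]
    ring_nf
  simp_rw [h0]
  rw [integral_complex_ofReal, MeasureTheory.integral_const_mul,
    GaussianFourier.integral_rexp_neg_mul_sq_norm one_pos, div_one, ← Real.rpow_add Real.pi_pos]
  simp [neg_div]

/-- The vacuum expectation value `⟨Ω, T Ω⟩` in `L²`. -/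
def vev {r : ℕ} (T : Op r) : ℂ :=
  ∫ q : Modes r, conj (vacuum r q) * T (vacuum r) q

/-- `U` is the time evolution `s ↦ exp (-i s H)` generated by `H`: `U 0 = 1` and, for every Schwartz
vector `ψ`, the curve `s ↦ U s ψ` solves the Schrödinger equation in `L²`. For symmetric `H` there
is at most one such `U`. -/
def IsEvolution {r : ℕ} (H : Op r) (U : ℝ → Op r) : Prop :=
  U 0 = 1 ∧ ∀ (ψ : 𝓢(Modes r, ℂ)) (s : ℝ),
    HasDerivAt (fun s : ℝ => (U s ψ).toLp 2 MeasureTheory.volume)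
      ((-Complex.I • H (U s ψ)).toLp 2 MeasureTheory.volume) s

open Classical in
/-- The operator `exp (-i H)`, i.e. the time evolution generated by `H` at time `1`. -/
def expNegI {r : ℕ} (H : Op r) : Op r :=
  if h : ∃ U : ℝ → Op r, IsEvolution H U then h.choose 1 else 0

/-! ### Gaussian states and the free field -/

/-- A Gaussian state of the free field with Pauli-Jordan function `Δ`, in a Fock representation:
one-point functions `mean`, Wightman function `cov` (the truncated one,
`⟨φ x φ y⟩ - ⟨φ x⟩⟨φ y⟩`), and mode functions `amp` with `cov = amp ampᴴ`, so that
`φ x = mean x + ∑ k, (amp x k a_k + conj (amp x k) a_k†)` acting on the Fock vacuum has these one- and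
two-point functions. The Sorkin-Johnston vacuum is `mean = 0`, `cov = Pos (iΔ)`,
`amp x λ = √λ v^λ_x`. -/
structure GaussianState {N : ℕ} (Δ : Matrix (Fin N) (Fin N) ℝ) where
  mean : Fin N → ℝ
  cov : Matrix (Fin N) (Fin N) ℂ
  numModes : ℕ
  amp : Matrix (Fin N) (Fin numModes) ℂ
  amp_mul : amp * amp.conjTranspose = cov
  peierls : ∀ x y, cov x y - conj (cov x y) = Complex.I * (Δ x y : ℂ)

open scoped ComplexOrder MatrixOrder in
/-- Every positive semidefinite `W` with `W - conj W = iΔ` is the Wightman function of a Gaussian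
state, with arbitrary one-point functions. -/
theorem exists_gaussianState {N : ℕ} (Δ : Matrix (Fin N) (Fin N) ℝ) (m : Fin N → ℝ)
    (W : Matrix (Fin N) (Fin N) ℂ) (hW : W.PosSemidef)
    (hΔ : ∀ x y, W x y - conj (W x y) = Complex.I * (Δ x y : ℂ)) :
    ∃ ρ : GaussianState Δ, ρ.mean = m ∧ ρ.cov = W := by
  obtain ⟨B, hB⟩ := CStarAlgebra.nonneg_iff_eq_mul_star_self.mp hW.nonneg
  exact ⟨⟨m, W, N, B, hB.symm, hΔ⟩, rfl, rfl⟩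

section Field

variable {N : ℕ} {Δ : Matrix (Fin N) (Fin N) ℝ} (ρ : GaussianState Δ)

/-- The free (interaction picture) field operator `φ x`, through its mode expansion. -/
def field (x : Fin N) : Op ρ.numModes :=
  (ρ.mean x : ℂ) • (1 : Op ρ.numModes) +
    ∑ k, (ρ.amp x k • annihilation k + conj (ρ.amp x k) • creation k)

/-- The Peierls bracket `[φ x, φ y] = i Δ x y`. -/
theorem field_peierls (x y : Fin N) :
    field ρ x * field ρ y - field ρ y * field ρ x =
      (Complex.I * (Δ x y : ℂ)) • (1 : Op ρ.numModes) := by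
  have hW : ∑ k, (ρ.amp x k * conj (ρ.amp y k) - conj (ρ.amp x k) * ρ.amp y k) =
      Complex.I * (Δ x y : ℂ) := by
    rw [← ρ.peierls x y, ← ρ.amp_mul]
    simp [Matrix.mul_apply, Finset.sum_sub_distrib]
  rw [← hW]
  exact ladder_commutator position partialDeriv position_comm partialDeriv_comm
    partialDeriv_position _ _ _ _ _ _ (fun _ => rfl) (fun _ => rfl)

/-- The causally ordered product over `s`: labels decrease from left to right. -/
def causalProd {r : ℕ} (s : Finset (Fin N)) (T : Fin N → Op r) : Op r :=
  ((s.sort (fun a b => b ≤ a)).map T).prod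

/-- The anti-causally ordered product over `s`: labels increase from left to right. -/
def antiCausalProd {r : ℕ} (s : Finset (Fin N)) (T : Fin N → Op r) : Op r :=
  ((s.sort (fun a b => a ≤ b)).map T).prod

/-! ### The decoherence functional -/

/-- The space of pairs of histories `(ξ, ξ̄) ∈ ℝ^N × ℝ^N`; `ξ x` is the coordinate `Sum.inl x` and
`ξ̄ x` is the coordinate `Sum.inr x`. -/
abbrev Histories (N : ℕ) : Type := EuclideanSpace ℝ (Fin N ⊕ Fin N)

/-- The free decoherence functional
`D₀(ξ, ξ̄) = ⟨δ(φ_1 - ξ̄_1) ⋯ δ(φ_N - ξ̄_N) δ(φ_N - ξ_N) ⋯ δ(φ_1 - ξ_1)⟩`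
as a tempered distribution: its pairing with a Schwartz function `f` on the space of pairs of
histories. With `δ(φ - ξ) = ∫ exp (2πi ν (φ - ξ)) dν` for each factor, the integral over
`(ξ, ξ̄)` turns `f` into its Fourier transform at the frequencies `ν`. -/
def freeDecoherence (f : Histories N → ℂ) : ℂ :=
  ∫ ν : Histories N,
    vev (antiCausalProd Finset.univ
          (fun x => expNegI (((-(2 * Real.pi * ν (Sum.inr x)) : ℝ) : ℂ) • field ρ x)) *
        causalProd Finset.univ
          (fun x => expNegI (((-(2 * Real.pi * ν (Sum.inl x)) : ℝ) : ℂ) • field ρ x))) *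
      𝓕 f ν

/-- `∫ dξ dξ̄ D₀(ξ, ξ̄) F(ξ, ξ̄) = v` as an oscillatory integral: for every Schwartz cut-off `g`
with `g 0 = 1`, the pairings of `D₀` with `F(p) g(ε p)` converge to `v` as `ε → 0+`. -/
def HasDecoherenceIntegral (F : Histories N → ℂ) (v : ℂ) : Prop :=
  ∀ g : 𝓢(Histories N, ℂ), g 0 = 1 →
    Filter.Tendsto (fun ε : ℝ => freeDecoherence ρ (fun p => F p * g (ε • p)))
      (nhdsWithin 0 (Set.Ioi 0)) (nhds v)

open Classical in
/-- The value of `∫ dξ dξ̄ D₀(ξ, ξ̄) F(ξ, ξ̄)` (`0` if the integral does not converge). -/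
def decoherenceIntegral (F : Histories N → ℂ) : ℂ :=
  if h : ∃ v, HasDecoherenceIntegral ρ F v then h.choose else 0

/-- The interaction potential `V_int(ξ) = ∑ x, P_x(ξ_x)`. -/
def interactionPotential (P : Fin N → ℝ[X]) (p : Histories N) : ℝ :=
  ∑ x, (P x).eval (p (Sum.inl x))

/-- The integrand `exp (-i V_int(ξ))`. -/
def inOutWeight (P : Fin N → ℝ[X]) (p : Histories N) : ℂ :=
  Complex.exp (-Complex.I * (interactionPotential P p : ℂ))

/-- The source factor `exp (-i J·ξ)`. -/
def sourceFactor (J : Fin N → ℝ) (p : Histories N) : ℂ :=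
  Complex.exp (-Complex.I * ((∑ x, J x * p (Sum.inl x) : ℝ) : ℂ))

/-- The in-out generating functional. -/
def inOutZ (P : Fin N → ℝ[X]) (J : Fin N → ℝ) : ℂ :=
  decoherenceIntegral ρ (fun p => inOutWeight P p * sourceFactor J p) /
    decoherenceIntegral ρ (inOutWeight P)

/-- `i ∂/∂J_x` applied to a function of the sources. -/
def iPartial (x : Fin N) (Z : (Fin N → ℝ) → ℂ) (J : Fin N → ℝ) : ℂ :=
  Complex.I * lineDeriv ℝ Z J (Pi.single x 1)

/-! ### The interacting theory in the operator formalism -/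

/-- The interaction Hamiltonian `H(x) = P_x(φ x)` in the interaction picture. -/
def hamiltonian (P : Fin N → ℝ[X]) (x : Fin N) : Op ρ.numModes :=
  Polynomial.aeval (field ρ x) ((P x).map (algebraMap ℝ ℂ))

/-- The S-operator `C[∏ z, exp (-i H(z))]`. -/
def sOperator (P : Fin N → ℝ[X]) : Op ρ.numModes :=
  causalProd Finset.univ (fun z => expNegI (hamiltonian ρ P z))

open Classical in
/-- The evolution operator `V_x = C[∏ z ≺ x, exp (-i H(z))]`. -/
def evolution (C : Causet N) (P : Fin N → ℝ[X]) (x : Fin N) : Op ρ.numModes :=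
  causalProd (Finset.univ.filter (fun z => C.prec z x)) (fun z => expNegI (hamiltonian ρ P z))

open Classical in
/-- The adjoint `V_x†`: the factors are `exp (+i H(z))`, in the reversed order. -/
def evolutionAdj (C : Causet N) (P : Fin N → ℝ[X]) (x : Fin N) : Op ρ.numModes :=
  antiCausalProd (Finset.univ.filter (fun z => C.prec z x))
    (fun z => expNegI (-hamiltonian ρ P z))

/-- The Heisenberg field `φ^H x = V_x† φ x V_x`. -/
def heisenberg (C : Causet N) (P : Fin N → ℝ[X]) (x : Fin N) : Op ρ.numModes :=
  evolutionAdj ρ C P x * field ρ x * evolution ρ C P x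

open Classical in
/-- `C[φ^H x φ^H y]`. -/
def causalHeisenberg (C : Causet N) (P : Fin N → ℝ[X]) (x y : Fin N) : Op ρ.numModes :=
  if C.prec y x then heisenberg ρ C P x * heisenberg ρ C P y
  else heisenberg ρ C P y * heisenberg ρ C P x

/-- The in-in causally ordered two-point correlator `⟨C[φ^H x φ^H y]⟩`. -/
def inIn (C : Causet N) (P : Fin N → ℝ[X]) (x y : Fin N) : ℂ :=
  vev (causalHeisenberg ρ C P x y)

/-- The in-out causally ordered two-point correlator `⟨Ŝ C[φ^H x φ^H y]⟩ / ⟨Ŝ⟩`. -/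
def inOut (C : Causet N) (P : Fin N → ℝ[X]) (x y : Fin N) : ℂ :=
  vev (sOperator ρ P * causalHeisenberg ρ C P x y) / vev (sOperator ρ P)

open Classical in
/-- The Feynman propagator `⟨C[φ x φ y]⟩` of the free theory. -/
def feynman (C : Causet N) (x y : Fin N) : ℂ :=
  vev (if C.prec y x then field ρ x * field ρ y else field ρ y * field ρ x)

/-- The local interaction polynomials `g_x P_x` with a coupling constant `g_x` at each element. -/
def couple (g : Fin N → ℝ) (P : Fin N → ℝ[X]) (x : Fin N) : ℝ[X] :=
  Polynomial.C (g x) * P x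

end Field

/-- `S` is the expansion of `R` as a power series in the coupling constants: the (unique) formal
power series that is asymptotic to `R` at zero coupling, to all orders. -/
def IsExpansion {N : ℕ} (R : (Fin N → ℝ) → ℂ) (S : MvPowerSeries (Fin N) ℂ) : Prop :=
  ∀ n : ℕ, (fun g : Fin N → ℝ =>
      R g - MvPolynomial.eval (fun x => (g x : ℂ)) (MvPowerSeries.truncTotal n S))
    =O[nhds 0] fun g : Fin N → ℝ => ‖g‖ ^ n

end CausalSetQFT

end

/-! Everything rests on an explicit spectral representation of a single field. Each `φ_x` has the
form `c + ⟨a, q⟩ + i∂_b`; a quadratic chirp removes `⟨a, q⟩` and a Fourier transform turns `i∂_b`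
into a multiplication operator, both preserving Schwartz space and the `L²` inner product
(`exists_diagonalization`). Hence `f(φ_x)` is defined on Schwartz vectors for every `f` of temperate
growth. Uniqueness of the Schrödinger evolution (`evolution_intertwines`) identifies `exp(-iP(φ_x))`
with multiplication by a phase, and commutators with affine operators act as derivations
(`commutator_fn`).

Convergence. In Fourier space `D₀` is a vacuum expectation value of exponentials of fields,
continuous in the frequency and bounded by 1. Multiplying the test function by `f(ξ_x)` convolves in
the frequency of `ξ_x`, and shifting that frequency inserts `exp(2πiτφ_x)` at the place of `x`; so
the product inserts `f(φ_x)` (`integral_charFun_coord_mul`). By approximation this holds for the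
phases `exp(-iP_x)`, and all of them together produce `Ŝ`. Removing the cut-off evaluates the result
at frequency zero, where the backward branch is the identity: the limit is `⟨Ŝ⟩`.

Derivatives. A source replaces `P_x` by `P_x + J_x X`, so each derivative inserts a field at its
place in the ordered product. Moved to the right end, it is conjugated by the factors of lower
label. Those outside the causal past of `x` cancel because they commute with `φ_x` and can be moved
past the others (`heisenberg_eq`), which leaves `φ^H_x`. Label order and causal order differ only
for unrelated elements, whose Heisenberg fields commute.

In-in. Conjugation by `exp(-igP(φ_z))` shifts `φ_w` by the polynomial `gΔ_{wz}P'(φ_z)`. No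
exponential survives, so the Heisenberg fields are polynomials in fields and couplings.

In-out. `Ŝ` remains. Its matrix elements have Taylor expansions to all orders because each
exponential, moved to the bra, acts on a fixed Schwartz vector while the rest is isometric; the
quotient expands because `⟨Ŝ⟩ = 1` at zero coupling. For non-termination only `g_x = t` is switched
on. Wick's theorem turns the quotient into `E[e^{-itP}h]/E[e^{-itP}]`, where `E` is the expectation
over the law of `φ_x` and `h` is a quadratic polynomial whose leading coefficient is the truncated
Feynman propagator divided by the variance. If the series were a polynomial, comparing coefficients
would bound `E[P^k h]` by a constant times `E|P|^k`: these moments are log-convex and grow at least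
factorially when `deg P ≥ 2`, so the lower moments in the convolution are dominated by the top one.
But for even `k` the weight `|P|^k` moves to infinity with `k`, so `E[|P|^k z²]/E|P|^k` is unbounded
(`not_forall_moment_le`), a contradiction. -/

noncomputable section
namespace CausalSetQFT
open MeasureTheory

/-! ### Functions of temperate growth -/

theorem hasTemperateGrowth_cexp_mul_I :
    (fun t : ℝ => Complex.exp (t * Complex.I)).HasTemperateGrowth := by
  have hd : ∀ n : ℕ, iteratedDeriv n (fun t : ℝ => Complex.exp (t * Complex.I)) =
      fun t : ℝ => Complex.I ^ n * Complex.exp (t * Complex.I) := by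
    intro n
    induction n with
    | zero => simp
    | succ n ih =>
      rw [iteratedDeriv_succ, ih]
      funext t
      have h : HasDerivAt (fun t : ℝ => Complex.exp (t * Complex.I))
          (Complex.exp (t * Complex.I) * (1 * Complex.I)) t :=
        ((Complex.ofRealCLM.hasDerivAt (x := t)).mul_const Complex.I).cexp
      rw [(h.const_mul (Complex.I ^ n)).deriv]
      ring
  refine ⟨(Complex.ofRealCLM.contDiff.mul contDiff_const).cexp, fun n => ⟨0, 1, fun t => ?_⟩⟩
  rw [norm_iteratedFDeriv_eq_norm_iteratedDeriv, hd]
  simp [Complex.norm_exp_ofReal_mul_I]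

theorem hasTemperateGrowth_cexp_I {E : Type*} [NormedAddCommGroup E] [NormedSpace ℝ E]
    {f : E → ℝ} (hf : f.HasTemperateGrowth) :
    (fun q => Complex.exp (f q * Complex.I)).HasTemperateGrowth :=
  hasTemperateGrowth_cexp_mul_I.comp hf

theorem hasTemperateGrowth_ofReal {E : Type*} [NormedAddCommGroup E] [NormedSpace ℝ E]
    {f : E → ℝ} (hf : f.HasTemperateGrowth) : (fun q => (f q : ℂ)).HasTemperateGrowth :=
  Function.HasTemperateGrowth.comp (by fun_prop : Complex.ofReal.HasTemperateGrowth) hf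

theorem hasTemperateGrowth_conj {E : Type*} [NormedAddCommGroup E] [NormedSpace ℝ E]
    {f : E → ℂ} (hf : f.HasTemperateGrowth) : (fun q => conj (f q)).HasTemperateGrowth :=
  (Complex.conjCLE.toContinuousLinearMap.hasTemperateGrowth).comp hf

theorem hasTemperateGrowth_eval (P : ℝ[X]) : (fun t : ℝ => P.eval t).HasTemperateGrowth := by
  induction P using Polynomial.induction_on' with
  | add p q hp hq => simpa using hp.fun_add hq
  | monomial n a => simp only [Polynomial.eval_monomial]; fun_prop

theorem hasTemperateGrowth_inner {r : ℕ} (v : Modes r) :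
    (fun q : Modes r => inner ℝ q v).HasTemperateGrowth :=
  ((innerSL ℝ).flip v).hasTemperateGrowth

/-! ### Affine operators -/

/-- Multiplication by the linear function `⟨·, v⟩`. -/
def mulInner {r : ℕ} (v : Modes r) : Op r :=
  (SchwartzMap.smulLeftCLM ℂ (fun q : Modes r => ((inner ℝ q v : ℝ) : ℂ))).toLinearMap

/-- The derivative in the direction `v`. -/
def dirDeriv {r : ℕ} (v : Modes r) : Op r :=
  (LineDeriv.lineDerivOpCLM ℂ 𝓢(Modes r, ℂ) v).toLinearMap

theorem mulInner_apply {r : ℕ} (v : Modes r) (ψ : 𝓢(Modes r, ℂ)) (q : Modes r) :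
    mulInner v ψ q = ((inner ℝ q v : ℝ) : ℂ) * ψ q := by
  simp [mulInner,
    SchwartzMap.smulLeftCLM_apply_apply (hasTemperateGrowth_ofReal (hasTemperateGrowth_inner v))]

theorem dirDeriv_apply {r : ℕ} (v : Modes r) (ψ : 𝓢(Modes r, ℂ)) (q : Modes r) :
    dirDeriv v ψ q = fderiv ℝ ψ q v := by
  simp [dirDeriv, SchwartzMap.lineDerivOp_apply_eq_fderiv]

theorem fourier_dirDeriv {r : ℕ} (v : Modes r) (ψ : 𝓢(Modes r, ℂ)) :
    𝓕 (dirDeriv v ψ) = (2 * Real.pi * Complex.I) • mulInner v (𝓕 ψ) := by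
  have h := SchwartzMap.fourier_lineDerivOp_eq ψ v
  ext q
  rw [show dirDeriv v ψ = ∂_{v} ψ from rfl, h]
  simp [mulInner_apply, SchwartzMap.smulLeftCLM_apply_apply (hasTemperateGrowth_inner v)]

theorem fourier_mulInner {r : ℕ} (v : Modes r) (ψ : 𝓢(Modes r, ℂ)) :
    𝓕 (mulInner v ψ) = (Complex.I / (2 * Real.pi)) • dirDeriv v (𝓕 ψ) := by
  have h := SchwartzMap.lineDerivOp_fourier_eq ψ v
  rw [show dirDeriv v (𝓕 ψ) = ∂_{v} (𝓕 ψ) from rfl, h, ← FourierTransform.fourier_smul]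
  congr 1
  ext q
  have : (Real.pi : ℂ) ≠ 0 := by exact_mod_cast Real.pi_ne_zero
  simp only [mulInner_apply, smul_apply,
    SchwartzMap.smulLeftCLM_apply_apply (hasTemperateGrowth_inner v), smul_eq_mul,
    Complex.real_smul]
  field_simp
  rw [Complex.I_sq]
  ring

/-- The operators `c + ⟨a, q⟩ + ∂_b` with complex coefficients. -/
def affineOps (r : ℕ) : Submodule ℂ (Op r) :=
  Submodule.span ℂ ({1} ∪ Set.range mulInner ∪ Set.range dirDeriv)

theorem one_mem_affineOps (r : ℕ) : (1 : Op r) ∈ affineOps r :=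
  Submodule.subset_span (Or.inl (Or.inl rfl))

theorem mulInner_mem_affineOps {r : ℕ} (v : Modes r) : mulInner v ∈ affineOps r :=
  Submodule.subset_span (Or.inl (Or.inr ⟨v, rfl⟩))

theorem dirDeriv_mem_affineOps {r : ℕ} (v : Modes r) : dirDeriv v ∈ affineOps r :=
  Submodule.subset_span (Or.inr ⟨v, rfl⟩)

/-- A linear automorphism of Schwartz space that is isometric in `L²` and maps affine operators to
affine operators. -/
structure LinearCanonical (r : ℕ) where
  equiv : 𝓢(Modes r, ℂ) ≃ₗ[ℂ] 𝓢(Modes r, ℂ)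
  inner_map : ∀ ψ χ, inner ℂ ((equiv ψ).toLp 2 volume) ((equiv χ).toLp 2 volume) =
    inner ℂ (ψ.toLp 2 volume) (χ.toLp 2 volume)
  map_affine : ∀ X ∈ affineOps r, ∃ Y ∈ affineOps r, ∀ ψ, equiv (X ψ) = Y (equiv ψ)

theorem exists_affine_of_generators {r : ℕ} (T : 𝓢(Modes r, ℂ) ≃ₗ[ℂ] 𝓢(Modes r, ℂ))
    (h1 : ∀ v, ∃ Y ∈ affineOps r, ∀ ψ, T (mulInner v ψ) = Y (T ψ))
    (h2 : ∀ v, ∃ Y ∈ affineOps r, ∀ ψ, T (dirDeriv v ψ) = Y (T ψ)) :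
    ∀ X ∈ affineOps r, ∃ Y ∈ affineOps r, ∀ ψ, T (X ψ) = Y (T ψ) := by
  intro X hX
  induction hX using Submodule.span_induction with
  | mem X hX =>
    rcases hX with (rfl | ⟨v, rfl⟩) | ⟨v, rfl⟩
    · exact ⟨1, one_mem_affineOps r, fun ψ => rfl⟩
    · exact h1 v
    · exact h2 v
  | zero => exact ⟨0, zero_mem _, fun ψ => by simp⟩
  | add X X' _ _ h h' =>
    obtain ⟨Y, hY, h⟩ := h
    obtain ⟨Y', hY', h'⟩ := h'
    exact ⟨Y + Y', add_mem hY hY', fun ψ => by simp [h, h']⟩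
  | smul c X _ h =>
    obtain ⟨Y, hY, h⟩ := h
    exact ⟨c • Y, Submodule.smul_mem _ c hY, fun ψ => by simp [h]⟩

/-- The identity. -/
def LinearCanonical.refl (r : ℕ) : LinearCanonical r where
  equiv := LinearEquiv.refl ℂ _
  inner_map _ _ := rfl
  map_affine X hX := ⟨X, hX, fun _ => rfl⟩

/-- Composition. -/
def LinearCanonical.trans {r : ℕ} (S T : LinearCanonical r) : LinearCanonical r where
  equiv := S.equiv.trans T.equiv
  inner_map ψ χ := by simp [-SchwartzMap.inner_toL2_toL2_eq, S.inner_map, T.inner_map]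
  map_affine X hX := by
    obtain ⟨Y, hY, h⟩ := S.map_affine X hX
    obtain ⟨Z, hZ, h'⟩ := T.map_affine Y hY
    exact ⟨Z, hZ, fun ψ => by simp [h, h']⟩

/-- The Fourier transform. -/
def LinearCanonical.fourier (r : ℕ) : LinearCanonical r where
  equiv := FourierTransform.fourierEquiv ℂ _
  inner_map ψ χ := SchwartzMap.inner_fourier_toL2_eq ψ χ
  map_affine := exists_affine_of_generators _
    (fun v => ⟨_, Submodule.smul_mem _ _ (dirDeriv_mem_affineOps v),
      fun ψ => fourier_mulInner v ψ⟩)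
    (fun v => ⟨_, Submodule.smul_mem _ _ (mulInner_mem_affineOps v),
      fun ψ => fourier_dirDeriv v ψ⟩)

/-- Multiplication by `exp (-i θ)`, where `θ` has affine derivatives. -/
def LinearCanonical.chirp {r : ℕ} (θ : Modes r → ℝ) (hθ : θ.HasTemperateGrowth)
    (B : Modes r → Modes r) (hB : ∀ q v, fderiv ℝ θ q v = inner ℝ q (B v)) :
    LinearCanonical r where
  equiv :=
    { toFun := SchwartzMap.smulLeftCLM ℂ (fun q => Complex.exp ((-θ q : ℝ) * Complex.I))
      invFun := SchwartzMap.smulLeftCLM ℂ (fun q => Complex.exp (θ q * Complex.I))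
      map_add' := fun _ _ => map_add _ _ _
      map_smul' := fun _ _ => map_smul _ _ _
      left_inv := fun ψ => by
        ext q
        rw [SchwartzMap.smulLeftCLM_apply_apply (hasTemperateGrowth_cexp_I hθ),
          SchwartzMap.smulLeftCLM_apply_apply (hasTemperateGrowth_cexp_I hθ.fun_neg), smul_smul,
          ← Complex.exp_add]
        simp
      right_inv := fun ψ => by
        ext q
        rw [SchwartzMap.smulLeftCLM_apply_apply (hasTemperateGrowth_cexp_I hθ.fun_neg),
          SchwartzMap.smulLeftCLM_apply_apply (hasTemperateGrowth_cexp_I hθ), smul_smul,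
          ← Complex.exp_add]
        simp }
  inner_map ψ χ := by
    rw [SchwartzMap.inner_toL2_toL2_eq _ _ volume, SchwartzMap.inner_toL2_toL2_eq _ _ volume]
    refine integral_congr_ae (Filter.Eventually.of_forall fun q => ?_)
    simp only [LinearEquiv.coe_mk, LinearMap.coe_mk, AddHom.coe_mk]
    rw [SchwartzMap.smulLeftCLM_apply_apply (hasTemperateGrowth_cexp_I hθ.fun_neg),
      SchwartzMap.smulLeftCLM_apply_apply (hasTemperateGrowth_cexp_I hθ.fun_neg), inner_smul_left,
      inner_smul_right, ← mul_assoc, Complex.conj_mul', Complex.norm_exp_ofReal_mul_I]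
    simp
  map_affine := by
    have hθd : ContDiff ℝ 1 θ := hθ.1.of_le (by exact_mod_cast le_top)
    refine exists_affine_of_generators _
      (fun v => ⟨_, mulInner_mem_affineOps v, fun ψ => ?_⟩)
      -- `e^{-iθ}∂_v = (∂_v + i∂_vθ)e^{-iθ}`, and `∂_vθ` is linear because `θ` is quadratic.
      (fun v => ⟨dirDeriv v + Complex.I • mulInner (B v), add_mem (dirDeriv_mem_affineOps v)
        (Submodule.smul_mem _ _ (mulInner_mem_affineOps _)), fun ψ => ?_⟩)
    · ext q
      simp only [LinearEquiv.coe_mk, LinearMap.coe_mk, AddHom.coe_mk]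
      rw [SchwartzMap.smulLeftCLM_apply_apply (hasTemperateGrowth_cexp_I hθ.fun_neg),
        mulInner_apply, mulInner_apply,
        SchwartzMap.smulLeftCLM_apply_apply (hasTemperateGrowth_cexp_I hθ.fun_neg)]
      simp only [smul_eq_mul]
      ring
    · have hc : ((SchwartzMap.smulLeftCLM ℂ (fun q => Complex.exp ((-θ q : ℝ) * Complex.I))) ψ :
          Modes r → ℂ) = (fun q => Complex.exp ((-θ q : ℝ) * Complex.I)) * ⇑ψ := by
        funext q
        exact SchwartzMap.smulLeftCLM_apply_apply (hasTemperateGrowth_cexp_I hθ.fun_neg) ψ q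
      ext q
      have h1 : HasFDerivAt (fun q => (((-θ q : ℝ) : ℂ) * Complex.I))
          ((Complex.ofRealCLM ∘L (-fderiv ℝ θ q)).smulRight Complex.I) q := by
        have h0 := (Complex.ofRealCLM.hasFDerivAt (x := -θ q)).comp q
          (hθd.differentiable (by norm_num) q).hasFDerivAt.neg
        refine (h0.mul_const Complex.I).congr_fderiv ?_
        ext v
        simp [mul_comm]
      have h2 := (h1.cexp.mul ψ.differentiableAt.hasFDerivAt).fderiv
      simp only [LinearEquiv.coe_mk, LinearMap.coe_mk, AddHom.coe_mk, LinearMap.add_apply,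
        LinearMap.smul_apply, add_apply, smul_apply, mulInner_apply, dirDeriv_apply]
      rw [SchwartzMap.smulLeftCLM_apply_apply (hasTemperateGrowth_cexp_I hθ.fun_neg),
        SchwartzMap.smulLeftCLM_apply_apply (hasTemperateGrowth_cexp_I hθ.fun_neg), hc, h2,
        dirDeriv_apply]
      simp [hB]
      ring

/-- A linear canonical transformation that turns `A` into multiplication by an affine function. -/
structure Diagonalization {r : ℕ} (A : Op r) extends LinearCanonical r where
  shift : ℝ
  dir : Modes r
  map_apply : ∀ ψ q, equiv (A ψ) q = ((shift + inner ℝ q dir : ℝ) : ℂ) * equiv ψ q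

/-- Conjugation by `e^{-iθ}` subtracts `∂_bθ` from `⟨a, q⟩ + i∂_b`, so the position term disappears
when `∂_bθ = ⟨·, a⟩`, that is `B b = a`. The product `⟨q, a⟩⟨q, b⟩/|b|²` achieves this up to a
multiple of `⟨q, b⟩`, which the second term cancels. -/
theorem exists_quadratic {r : ℕ} (a b : Modes r) (hb : b ≠ 0) :
    ∃ θ : Modes r → ℝ, θ.HasTemperateGrowth ∧ ∃ B : Modes r → Modes r,
      (∀ q v, fderiv ℝ θ q v = inner ℝ q (B v)) ∧ B b = a := by
  have hb' : inner ℝ b b ≠ 0 := inner_self_ne_zero.mpr hb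
  set n : ℝ := inner ℝ b b with hn
  set s : ℝ := inner ℝ a b with hs
  have ha' : (fun q : Modes r => inner ℝ q a).HasTemperateGrowth := hasTemperateGrowth_inner a
  have hb'' : (fun q : Modes r => inner ℝ q b).HasTemperateGrowth := hasTemperateGrowth_inner b
  refine ⟨fun q => n⁻¹ * (inner ℝ q a * inner ℝ q b) -
    (s / (2 * n ^ 2)) * (inner ℝ q b * inner ℝ q b), by fun_prop,
    fun v => (n⁻¹ * inner ℝ v b) • a + (n⁻¹ * inner ℝ v a) • b -
      (s / n ^ 2 * inner ℝ v b) • b, fun q v => ?_, ?_⟩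
  · have h : ∀ c : Modes r, HasFDerivAt (fun q : Modes r => (inner ℝ q c : ℝ))
        ((innerSL ℝ).flip c) q := fun c => ((innerSL ℝ).flip c).hasFDerivAt
    have h1 := ((((h a).mul (h b)).const_mul n⁻¹).sub
      (((h b).mul (h b)).const_mul (s / (2 * n ^ 2)))).fderiv
    have h2 : ∀ c : Modes r, (innerSL ℝ).flip c v = (inner ℝ v c : ℝ) := fun c => rfl
    refine (congrArg (fun L : Modes r →L[ℝ] ℝ => L v) h1).trans ?_
    simp only [sub_apply, smul_apply, add_apply, h2, inner_sub_right,
      inner_add_right, inner_smul_right, smul_eq_mul]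
    field_simp
    ring
  · have h1 : inner ℝ b a = s := real_inner_comm _ _
    simp only [← hn, h1]
    rw [inv_mul_cancel₀ hb', one_smul, add_sub_assoc, ← sub_smul]
    have : n⁻¹ * s - s / n ^ 2 * n = 0 := by field_simp; ring
    rw [this]; simp

/-- For `b = 0` the operator is already a multiplication. Otherwise the chirp removes `⟨a, q⟩` and
the Fourier transform sends `i∂_b` to multiplication by `-2π⟨b, q⟩`. -/
theorem exists_diagonalization {r : ℕ} (c : ℝ) (a b : Modes r) :
    Nonempty (Diagonalization ((c : ℂ) • 1 + mulInner a + Complex.I • dirDeriv b : Op r)) := by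
  by_cases hb : b = 0
  · subst hb
    refine ⟨{ LinearCanonical.refl r with shift := c, dir := a, map_apply := fun ψ q => ?_ }⟩
    simp only [LinearCanonical.refl, LinearEquiv.refl_apply, LinearMap.add_apply, add_apply,
      LinearMap.smul_apply, smul_apply, mulInner_apply, dirDeriv_apply, Module.End.one_apply]
    simp
    ring
  · obtain ⟨θ, hθ, B, hB, hab⟩ := exists_quadratic a b hb
    refine ⟨{ (LinearCanonical.chirp θ hθ B hB).trans (LinearCanonical.fourier r) with
      shift := c, dir := (-(2 * Real.pi)) • b, map_apply := fun ψ q => ?_ }⟩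
    set T := LinearCanonical.chirp θ hθ B hB
    have h : T.equiv (((c : ℂ) • 1 + mulInner a + Complex.I • dirDeriv b : Op r) ψ) =
        (c : ℂ) • T.equiv ψ + Complex.I • dirDeriv b (T.equiv ψ) := by
      ext q
      have h1 : HasFDerivAt (fun q => (((-θ q : ℝ) : ℂ) * Complex.I))
          ((Complex.ofRealCLM ∘L (-fderiv ℝ θ q)).smulRight Complex.I) q := by
        have h0 := (Complex.ofRealCLM.hasFDerivAt (x := -θ q)).comp q
          ((hθ.1.differentiable (by simp) q).hasFDerivAt.neg)
        refine (h0.mul_const Complex.I).congr_fderiv ?_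
        ext v
        simp [mul_comm]
      have hT : ∀ (ψ : 𝓢(Modes r, ℂ)) (q : Modes r), T.equiv ψ q =
          Complex.exp ((-θ q : ℝ) * Complex.I) * ψ q := fun ψ q =>
        SchwartzMap.smulLeftCLM_apply_apply (hasTemperateGrowth_cexp_I hθ.fun_neg) ψ q
      have hc : (T.equiv ψ : Modes r → ℂ) =
          (fun q => Complex.exp ((-θ q : ℝ) * Complex.I)) * ⇑ψ := funext (hT ψ)
      have h2 := (h1.cexp.mul ψ.differentiableAt.hasFDerivAt).fderiv
      simp only [LinearMap.add_apply, LinearMap.smul_apply, add_apply, smul_apply,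
        Module.End.one_apply, hT, dirDeriv_apply, hc, h2, mulInner_apply]
      simp [hB, hab]
      linear_combination ((inner ℝ q a : ℝ) : ℂ) * Complex.exp (-((θ q : ℂ) * Complex.I)) * ψ q *
        Complex.I_sq
    change 𝓕 (T.equiv _) q = _ * 𝓕 (T.equiv ψ) q
    rw [h, FourierTransform.fourier_add, FourierTransform.fourier_smul,
      FourierTransform.fourier_smul, fourier_dirDeriv]
    simp only [add_apply, smul_apply, mulInner_apply, inner_smul_right, smul_eq_mul]
    push_cast
    linear_combination 2 * Real.pi * ((inner ℝ q b : ℝ) : ℂ) * 𝓕 (T.equiv ψ) q * Complex.I_sq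

section Field

variable {N : ℕ} {Δ : Matrix (Fin N) (Fin N) ℝ} (ρ : GaussianState Δ)

/-- `A(q + ∂) + Ā(q - ∂) = 2 Re A q + 2i Im A ∂`, and the ladder operators carry a factor `1/√2`. -/
theorem field_eq_affine (x : Fin N) :
    field ρ x = (ρ.mean x : ℂ) • 1 +
      mulInner (WithLp.toLp 2 fun k => √2 * (ρ.amp x k).re) +
      Complex.I • dirDeriv (WithLp.toLp 2 fun k => √2 * (ρ.amp x k).im) := by
  ext ψ q
  have hs : ((1 / √2 : ℝ) : ℂ) * 2 = ((√2 : ℝ) : ℂ) := by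
    rw [← Complex.ofReal_ofNat, ← Complex.ofReal_mul]
    congr 1
    rw [div_mul_eq_mul_div, one_mul, Real.div_sqrt]
  have hsum : ∀ (w : Modes ρ.numModes), dirDeriv w ψ q =
      ∑ k, (w k : ℂ) * fderiv ℝ ψ q (EuclideanSpace.single k 1) := fun w => by
    rw [dirDeriv_apply]
    conv_lhs => rw [← (EuclideanSpace.basisFun (Fin ρ.numModes) ℝ).sum_repr w]
    simp
  simp only [field, annihilation, creation, LinearMap.add_apply, LinearMap.sub_apply,
    LinearMap.smul_apply, LinearMap.sum_apply, add_apply, smul_apply, sub_apply, sum_apply,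
    mulInner_apply, position_apply, partialDeriv_apply, hsum,
    Module.End.one_apply, add_assoc]
  congr 1
  simp only [PiLp.inner_apply, smul_eq_mul, Complex.ofReal_sum, Finset.mul_sum, Finset.sum_mul,
    ← Finset.sum_add_distrib]
  refine Finset.sum_congr rfl fun k _ => ?_
  have h2 : conj (ρ.amp x k) = (ρ.amp x k).re - (ρ.amp x k).im * Complex.I := by
    rw [Complex.ext_iff]; simp
  rw [h2]
  conv_lhs => rw [show ρ.amp x k * _ = ((ρ.amp x k).re + (ρ.amp x k).im * Complex.I) * _ from
    by rw [Complex.re_add_im]]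
  simp only [RCLike.inner_apply, Complex.ofReal_mul, ← hs, conj_trivial]
  ring

theorem field_mem_affineOps (x : Fin N) : field ρ x ∈ affineOps ρ.numModes := by
  rw [field_eq_affine]
  exact add_mem (add_mem (Submodule.smul_mem _ _ (one_mem_affineOps _))
    (mulInner_mem_affineOps _)) (Submodule.smul_mem _ _ (dirDeriv_mem_affineOps _))

/-- The spectral representation of a field operator. -/
def fieldDiag (x : Fin N) : Diagonalization (field ρ x) :=
  Classical.choice (field_eq_affine ρ x ▸ exists_diagonalization _ _ _)

end Field

end CausalSetQFT
end
noncomputable section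
namespace CausalSetQFT
open MeasureTheory

/-! ### Schwartz functions as `L²` vectors -/

/-- The inclusion of Schwartz space into `L²`. -/
def l2 {r : ℕ} : 𝓢(Modes r, ℂ) →L[ℂ] Lp ℂ 2 (volume : Measure (Modes r)) :=
  SchwartzMap.toLpCLM ℂ ℂ 2 volume

theorem l2_eq {r : ℕ} (ψ : 𝓢(Modes r, ℂ)) : ψ.toLp 2 volume = l2 ψ := rfl

theorem inner_l2 {r : ℕ} (ψ χ : 𝓢(Modes r, ℂ)) :
    inner ℂ (l2 ψ) (l2 χ) = ∫ q, conj (ψ q) * χ q := by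
  rw [← l2_eq, ← l2_eq, SchwartzMap.inner_toL2_toL2_eq _ _ volume]
  simp [mul_comm]

theorem l2_injective {r : ℕ} : Function.Injective (l2 (r := r)) :=
  SchwartzMap.injective_toLp 2 volume

theorem norm_l2_le {r : ℕ} {ψ χ : 𝓢(Modes r, ℂ)} (h : ∀ q, ‖ψ q‖ ≤ ‖χ q‖) :
    ‖l2 ψ‖ ≤ ‖l2 χ‖ := by
  refine Lp.norm_le_norm_of_ae_le ?_
  filter_upwards [ψ.coeFn_toLp 2 volume, χ.coeFn_toLp 2 volume] with q h1 h2
  rw [← l2_eq, ← l2_eq, h1, h2]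
  exact h q

theorem vev_eq_inner {r : ℕ} (T : Op r) :
    vev T = inner ℂ (l2 (vacuum r)) (l2 (T (vacuum r))) := by
  rw [inner_l2]; rfl

theorem norm_l2_vacuum (r : ℕ) : ‖l2 (vacuum r)‖ = 1 := by
  have h := vacuum_normalized r
  rw [← inner_l2, inner_self_eq_norm_sq_to_K] at h
  have h' : ‖l2 (vacuum r)‖ ^ 2 = 1 := by
    have h2 : ((‖l2 (vacuum r)‖ ^ 2 : ℝ) : ℂ) = ((1 : ℝ) : ℂ) := by
      push_cast
      exact h
    exact_mod_cast h2
  exact (pow_eq_one_iff_of_nonneg (norm_nonneg _) two_ne_zero).mp h'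

/-- The vacuum expectation value as a linear functional. -/
def vevₗ (r : ℕ) : Op r →ₗ[ℂ] ℂ where
  toFun := vev
  map_add' S T := by simp [vev_eq_inner, inner_add_right]
  map_smul' c T := by simp [vev_eq_inner, inner_smul_right]

theorem vevₗ_apply {r : ℕ} (T : Op r) : vevₗ r T = vev T := rfl

theorem vev_one (r : ℕ) : vev (1 : Op r) = 1 := vacuum_normalized r

/-! ### Functional calculus -/

namespace Diagonalization

variable {r : ℕ} {A : Op r} (D : Diagonalization A)

/-- The affine function that represents `A`. -/
def spec (q : Modes r) : ℝ := D.shift + inner ℝ q D.dir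

theorem spec_hasTemperateGrowth : D.spec.HasTemperateGrowth :=
  (Function.HasTemperateGrowth.const _).add (hasTemperateGrowth_inner _)

/-- The operator `f(A)`. -/
def fn (f : ℝ → ℂ) : Op r :=
  D.equiv.symm.toLinearMap ∘ₗ
    (SchwartzMap.smulLeftCLM ℂ (fun q => f (D.spec q))).toLinearMap ∘ₗ D.equiv.toLinearMap

variable {f h : ℝ → ℂ}

theorem equiv_fn_apply (hf : f.HasTemperateGrowth) (ψ : 𝓢(Modes r, ℂ)) (q : Modes r) :
    D.equiv (D.fn f ψ) q = f (D.spec q) * D.equiv ψ q := by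
  have hfs : (fun q => f (D.spec q)).HasTemperateGrowth := hf.comp D.spec_hasTemperateGrowth
  simp [fn, SchwartzMap.smulLeftCLM_apply_apply hfs]

theorem op_ext {S T : Op r} (H : ∀ ψ q, D.equiv (S ψ) q = D.equiv (T ψ) q) : S = T :=
  LinearMap.ext fun ψ => D.equiv.injective (SchwartzMap.ext (H ψ))

theorem fn_mul (hf : f.HasTemperateGrowth) (hh : h.HasTemperateGrowth) :
    D.fn (fun t => f t * h t) = D.fn f * D.fn h :=
  D.op_ext fun ψ q => by
    rw [D.equiv_fn_apply (hf.fun_mul hh), Module.End.mul_apply, D.equiv_fn_apply hf,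
      D.equiv_fn_apply hh, mul_assoc]

theorem fn_add (hf : f.HasTemperateGrowth) (hh : h.HasTemperateGrowth) :
    D.fn (fun t => f t + h t) = D.fn f + D.fn h :=
  D.op_ext fun ψ q => by
    rw [D.equiv_fn_apply (hf.fun_add hh), LinearMap.add_apply, map_add, add_apply,
      D.equiv_fn_apply hf, D.equiv_fn_apply hh, add_mul]

theorem fn_sub (hf : f.HasTemperateGrowth) (hh : h.HasTemperateGrowth) :
    D.fn (fun t => f t - h t) = D.fn f - D.fn h :=
  D.op_ext fun ψ q => by
    rw [D.equiv_fn_apply (hf.fun_sub hh), LinearMap.sub_apply, map_sub, sub_apply,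
      D.equiv_fn_apply hf, D.equiv_fn_apply hh, sub_mul]

theorem fn_const_mul (c : ℂ) (hf : f.HasTemperateGrowth) :
    D.fn (fun t => c * f t) = c • D.fn f :=
  D.op_ext fun ψ q => by
    rw [D.equiv_fn_apply ((Function.HasTemperateGrowth.const c).fun_mul hf),
      LinearMap.smul_apply, map_smul, smul_apply, D.equiv_fn_apply hf, smul_eq_mul, mul_assoc]

theorem fn_const (c : ℂ) : D.fn (fun _ => c) = c • 1 :=
  D.op_ext fun ψ q => by
    rw [D.equiv_fn_apply (Function.HasTemperateGrowth.const c)]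
    simp

theorem fn_id : D.fn (fun t => (t : ℂ)) = A :=
  D.op_ext fun ψ q => by
    rw [D.equiv_fn_apply (by fun_prop), D.map_apply]
    rfl

theorem _root_.CausalSetQFT.hasTemperateGrowth_complex_eval (p : ℂ[X]) :
    (fun t : ℝ => p.eval (t : ℂ)).HasTemperateGrowth := by
  have h0 : (fun t : ℝ => (t : ℂ)).HasTemperateGrowth := by fun_prop
  induction p using Polynomial.induction_on' with
  | add p q hp hq => simpa using hp.fun_add hq
  | monomial n a =>
    simp only [Polynomial.eval_monomial]
    exact (Function.HasTemperateGrowth.const a).fun_mul (h0.fun_pow n)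

theorem fn_eval (p : ℂ[X]) : D.fn (fun t => p.eval (t : ℂ)) = Polynomial.aeval A p := by
  induction p using Polynomial.induction_on with
  | C a => simpa [Algebra.algebraMap_eq_smul_one] using D.fn_const a
  | add p q hp hq =>
    simp only [Polynomial.eval_add, map_add]
    rw [D.fn_add (hasTemperateGrowth_complex_eval p) (hasTemperateGrowth_complex_eval q), hp, hq]
  | monomial n a ih =>
    have h1 : (fun t : ℝ => (Polynomial.C a * Polynomial.X ^ (n + 1)).eval (t : ℂ)) =
        fun t : ℝ => (Polynomial.C a * Polynomial.X ^ n).eval (t : ℂ) * (t : ℂ) := by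
      funext t; simp; ring
    rw [h1, D.fn_mul (hasTemperateGrowth_complex_eval _) (by fun_prop), ih, D.fn_id, pow_succ,
      ← mul_assoc, map_mul _ _ Polynomial.X, Polynomial.aeval_X]

theorem inner_equiv (ψ χ : 𝓢(Modes r, ℂ)) :
    inner ℂ (l2 (D.equiv ψ)) (l2 (D.equiv χ)) = inner ℂ (l2 ψ) (l2 χ) :=
  D.inner_map ψ χ

theorem norm_equiv (ψ : 𝓢(Modes r, ℂ)) : ‖l2 (D.equiv ψ)‖ = ‖l2 ψ‖ := by
  rw [@norm_eq_sqrt_re_inner ℂ, @norm_eq_sqrt_re_inner ℂ, D.inner_equiv]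

theorem inner_fn (hf : f.HasTemperateGrowth) (ψ χ : 𝓢(Modes r, ℂ)) :
    inner ℂ (l2 ψ) (l2 (D.fn f χ)) =
      ∫ q, f (D.spec q) * (conj (D.equiv ψ q) * D.equiv χ q) := by
  rw [← D.inner_equiv, inner_l2]
  refine integral_congr_ae (Filter.Eventually.of_forall fun q => ?_)
  simp only [D.equiv_fn_apply hf]
  ring

theorem inner_fn_left (hf : f.HasTemperateGrowth) (ψ χ : 𝓢(Modes r, ℂ)) :
    inner ℂ (l2 (D.fn f ψ)) (l2 χ) = inner ℂ (l2 ψ) (l2 (D.fn (fun t => conj (f t)) χ)) := by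
  rw [D.inner_fn (hasTemperateGrowth_conj hf), ← D.inner_equiv, inner_l2]
  refine integral_congr_ae (Filter.Eventually.of_forall fun q => ?_)
  simp only [D.equiv_fn_apply hf, map_mul]
  ring

/-- In the diagonal representation this is pointwise domination. The dominating `h` may be
unbounded: this is how Taylor remainders and cut-off errors are controlled on a fixed Schwartz
vector. -/
theorem norm_fn_le (hf : f.HasTemperateGrowth) (hh : h.HasTemperateGrowth)
    (H : ∀ t, ‖f t‖ ≤ ‖h t‖) (ψ : 𝓢(Modes r, ℂ)) :
    ‖l2 (D.fn f ψ)‖ ≤ ‖l2 (D.fn h ψ)‖ := by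
  rw [← D.norm_equiv, ← D.norm_equiv (D.fn h ψ)]
  refine norm_l2_le fun q => ?_
  rw [D.equiv_fn_apply hf, D.equiv_fn_apply hh, norm_mul, norm_mul]
  gcongr
  exact H _

theorem fn_one : D.fn (fun _ => 1) = 1 := by simpa using D.fn_const 1

theorem norm_fn_eq (hf : f.HasTemperateGrowth) (H : ∀ t, ‖f t‖ = 1) (ψ : 𝓢(Modes r, ℂ)) :
    ‖l2 (D.fn f ψ)‖ = ‖l2 ψ‖ := by
  have h1 : (1 : Op r) ψ = ψ := rfl
  refine le_antisymm ?_ ?_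
  · have := D.norm_fn_le hf (Function.HasTemperateGrowth.const (1 : ℂ))
      (fun t => by simp [H t]) ψ
    rwa [D.fn_one, h1] at this
  · have := D.norm_fn_le (Function.HasTemperateGrowth.const (1 : ℂ)) hf
      (fun t => by simp [H t]) ψ
    rwa [D.fn_one, h1] at this

/-- In the diagonal representation `X` is again affine, and only its derivative part fails to
commute with multiplication by `f ∘ spec`; the chain rule gives `⟨v, dir⟩ f'`. The constant does not
depend on `f`, so it can later be read off from `f = id`. -/
theorem commutator_fn {X : Op r} (hX : X ∈ affineOps r) :
    ∃ c : ℂ, ∀ f f' : ℝ → ℂ, f.HasTemperateGrowth → f'.HasTemperateGrowth →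
      (∀ t, HasDerivAt f (f' t) t) → X * D.fn f - D.fn f * X = c • D.fn f' := by
  obtain ⟨Y, hY, hXY⟩ := D.map_affine X hX
  suffices h : ∃ c : ℂ, ∀ f f' : ℝ → ℂ, f.HasTemperateGrowth → f'.HasTemperateGrowth →
      (∀ t, HasDerivAt f (f' t) t) → ∀ ψ χ : 𝓢(Modes r, ℂ), (∀ q, χ q = f (D.spec q) * ψ q) →
        ∀ q, Y χ q - f (D.spec q) * Y ψ q = c * (f' (D.spec q) * ψ q) by
    obtain ⟨c, hc⟩ := h
    refine ⟨c, fun f f' hf hf' hd => D.op_ext fun ψ q => ?_⟩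
    rw [LinearMap.sub_apply, map_sub, sub_apply, Module.End.mul_apply, Module.End.mul_apply, hXY,
      D.equiv_fn_apply hf, hXY, LinearMap.smul_apply, map_smul, smul_apply,
      D.equiv_fn_apply hf', smul_eq_mul]
    exact hc f f' hf hf' hd _ _ (D.equiv_fn_apply hf ψ) q
  clear hXY
  induction hY using Submodule.span_induction with
  | mem Y hY =>
    rcases hY with (rfl | ⟨v, rfl⟩) | ⟨v, rfl⟩
    · refine ⟨0, fun f f' _ _ _ ψ χ h q => ?_⟩
      simp [h]
    · refine ⟨0, fun f f' _ _ _ ψ χ h q => ?_⟩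
      simp only [mulInner_apply, h]
      ring
    · refine ⟨(inner ℝ v D.dir : ℝ), fun f f' _ _ hd ψ χ h q => ?_⟩
      have h1 : HasFDerivAt D.spec ((innerSL ℝ).flip D.dir) q :=
        ((innerSL ℝ).flip D.dir).hasFDerivAt.const_add D.shift
      have h2 := ((hd (D.spec q)).hasFDerivAt.comp q h1).mul ψ.differentiableAt.hasFDerivAt
      rw [dirDeriv_apply, dirDeriv_apply, show (χ : Modes r → ℂ) = (f ∘ D.spec) * ⇑ψ from funext h,
        h2.fderiv]
      have h3 : (innerSL ℝ).flip D.dir v = (inner ℝ v D.dir : ℝ) := rfl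
      simp only [Function.comp_apply, add_apply, smul_apply, ContinuousLinearMap.comp_apply, h3,
        ContinuousLinearMap.toSpanSingleton_apply, smul_eq_mul, Complex.real_smul]
      ring
  | zero => exact ⟨0, fun f f' _ _ _ ψ χ _ q => by simp⟩
  | add Y Y' _ _ h h' =>
    obtain ⟨c, h⟩ := h
    obtain ⟨c', h'⟩ := h'
    refine ⟨c + c', fun f f' hf hf' hd ψ χ hχ q => ?_⟩
    have h1 := h f f' hf hf' hd ψ χ hχ q
    have h2 := h' f f' hf hf' hd ψ χ hχ q
    simp only [LinearMap.add_apply, add_apply]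
    linear_combination h1 + h2
  | smul a Y _ h =>
    obtain ⟨c, h⟩ := h
    refine ⟨a * c, fun f f' hf hf' hd ψ χ hχ q => ?_⟩
    have h1 := h f f' hf hf' hd ψ χ hχ q
    simp only [LinearMap.smul_apply, smul_apply, smul_eq_mul]
    linear_combination a * h1

end Diagonalization

/-! ### Polynomial phases -/

/-- The function `exp (-i P)`. -/
def phase (P : ℝ[X]) (t : ℝ) : ℂ := Complex.exp ((-P.eval t : ℝ) * Complex.I)

theorem phase_hasTemperateGrowth (P : ℝ[X]) : (phase P).HasTemperateGrowth :=
  hasTemperateGrowth_cexp_I (hasTemperateGrowth_eval P).fun_neg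

theorem norm_phase (P : ℝ[X]) (t : ℝ) : ‖phase P t‖ = 1 := Complex.norm_exp_ofReal_mul_I _

theorem phase_add (P Q : ℝ[X]) : phase (P + Q) = fun t => phase P t * phase Q t := by
  funext t
  simp only [phase, ← Complex.exp_add, Polynomial.eval_add]
  push_cast
  ring_nf

theorem phase_zero : phase 0 = fun _ => 1 := by
  funext t; simp [phase]

theorem conj_phase (P : ℝ[X]) (t : ℝ) : conj (phase P t) = phase (-P) t := by
  simp [phase, ← Complex.exp_conj]

theorem phase_hasDerivAt (P : ℝ[X]) (t : ℝ) :
    HasDerivAt (phase P) (-Complex.I * ((P.derivative.eval t : ℝ) : ℂ) * phase P t) t := by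
  have h := (((P.hasDerivAt t).neg.ofReal_comp).mul_const Complex.I).cexp
  refine h.congr_deriv ?_
  simp only [phase, Pi.neg_apply]
  push_cast
  ring

theorem ofReal_eval (P : ℝ[X]) (t : ℝ) :
    ((P.eval t : ℝ) : ℂ) = (P.map (algebraMap ℝ ℂ)).eval (t : ℂ) := by
  rw [Polynomial.eval_map_algebraMap, ← Complex.coe_algebraMap,
    Polynomial.aeval_algebraMap_apply]
  simp

/-- The estimate has to hold for all real `a`, since it is applied on an unbounded spectrum. For
`|a| ≤ 1` it is the usual remainder; for `|a| ≥ 1` the exponential and each of the `n` terms are at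
most `|a|^n`. -/
theorem exists_norm_exp_sub_taylor_le (n : ℕ) :
    ∃ K : ℝ, ∀ a : ℝ, ‖Complex.exp (a * Complex.I) -
      ∑ k ∈ Finset.range n, (a * Complex.I) ^ k / (k.factorial : ℂ)‖ ≤ K * |a| ^ n := by
  rcases Nat.eq_zero_or_pos n with rfl | hn
  · exact ⟨1, fun a => by simp [Complex.norm_exp_ofReal_mul_I]⟩
  refine ⟨max (n.succ * (n.factorial * n : ℝ)⁻¹) (1 + n), fun a => ?_⟩
  have hna : ‖(a : ℂ) * Complex.I‖ = |a| := by simp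
  rcases le_total |a| 1 with ha | ha
  · have h := Complex.exp_bound (x := a * Complex.I) (by rwa [hna]) hn
    rw [hna, mul_comm (|a| ^ n)] at h
    refine h.trans ?_
    gcongr
    exact le_max_left _ _
  · refine (norm_sub_le _ _).trans ?_
    rw [Complex.norm_exp_ofReal_mul_I]
    have h1 : (1 : ℝ) ≤ |a| ^ n := one_le_pow₀ ha
    have h2 : ‖∑ k ∈ Finset.range n, ((a : ℂ) * Complex.I) ^ k / (k.factorial : ℂ)‖
        ≤ n * |a| ^ n := by
      refine (norm_sum_le _ _).trans ?_
      refine (Finset.sum_le_card_nsmul _ _ (|a| ^ n) fun k hk => ?_).trans (by simp)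
      rw [norm_div, norm_pow, hna, Complex.norm_natCast]
      refine (div_le_self (by positivity) (by exact_mod_cast k.factorial_pos)).trans ?_
      exact pow_le_pow_right₀ ha (Finset.mem_range.mp hk).le
    calc _ ≤ |a| ^ n + n * |a| ^ n := add_le_add h1 h2
      _ = (1 + n) * |a| ^ n := by ring
      _ ≤ _ := by gcongr; exact le_max_right _ _

namespace Diagonalization

variable {r : ℕ} {A : Op r} (D : Diagonalization A)

theorem fn_ofReal_eval (P : ℝ[X]) :
    D.fn (fun t => ((P.eval t : ℝ) : ℂ)) = Polynomial.aeval A (P.map (algebraMap ℝ ℂ)) := by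
  rw [← D.fn_eval]
  congr 1
  funext t
  exact ofReal_eval P t

theorem fn_phase_add (P Q : ℝ[X]) :
    D.fn (phase (P + Q)) = D.fn (phase P) * D.fn (phase Q) := by
  rw [phase_add, D.fn_mul (phase_hasTemperateGrowth P) (phase_hasTemperateGrowth Q)]

theorem fn_phase_zero : D.fn (phase 0) = 1 := by rw [phase_zero, D.fn_one]

theorem fn_phase_mul_neg (P : ℝ[X]) : D.fn (phase P) * D.fn (phase (-P)) = 1 := by
  rw [← D.fn_phase_add, add_neg_cancel, D.fn_phase_zero]

theorem fn_phase_neg_mul (P : ℝ[X]) : D.fn (phase (-P)) * D.fn (phase P) = 1 := by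
  rw [← D.fn_phase_add, neg_add_cancel, D.fn_phase_zero]

theorem norm_fn_phase (P : ℝ[X]) (ψ : 𝓢(Modes r, ℂ)) :
    ‖l2 (D.fn (phase P) ψ)‖ = ‖l2 ψ‖ :=
  D.norm_fn_eq (phase_hasTemperateGrowth P) (norm_phase P) ψ

theorem inner_fn_phase_left (P : ℝ[X]) (ψ χ : 𝓢(Modes r, ℂ)) :
    inner ℂ (l2 (D.fn (phase P) ψ)) (l2 χ) =
      inner ℂ (l2 ψ) (l2 (D.fn (phase (-P)) χ)) := by
  rw [D.inner_fn_left (phase_hasTemperateGrowth P)]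
  simp only [conj_phase]

theorem symmetric {A : Op r} (D : Diagonalization A) (ψ χ : 𝓢(Modes r, ℂ)) (P : ℝ[X]) :
    inner ℂ (l2 (Polynomial.aeval A (P.map (algebraMap ℝ ℂ)) ψ)) (l2 χ) =
      inner ℂ (l2 ψ) (l2 (Polynomial.aeval A (P.map (algebraMap ℝ ℂ)) χ)) := by
  rw [← D.fn_ofReal_eval,
    D.inner_fn_left (hasTemperateGrowth_ofReal (hasTemperateGrowth_eval P))]
  simp only [Complex.conj_ofReal]

/-- Taylor expansion of `exp (-i s P(A))` in `s`. -/
theorem exists_norm_fn_phase_sub_taylor_le (n : ℕ) (P : ℝ[X]) (ψ : 𝓢(Modes r, ℂ)) :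
    ∃ K : ℝ, ∀ s : ℝ, ‖l2 (D.fn (phase (Polynomial.C s * P)) ψ) -
      ∑ k ∈ Finset.range n, ((s : ℂ) ^ k * ((-Complex.I) ^ k / (k.factorial : ℂ))) •
        l2 ((Polynomial.aeval A (P.map (algebraMap ℝ ℂ)) ^ k) ψ)‖ ≤ K * |s| ^ n := by
  obtain ⟨K, hK⟩ := exists_norm_exp_sub_taylor_le n
  have hP := hasTemperateGrowth_ofReal (hasTemperateGrowth_eval P)
  -- The scalar remainder `K|sP|^n` becomes `K|s|^n ‖P(A)^n ψ‖`.
  refine ⟨K * ‖l2 (D.fn (fun t => ((P.eval t : ℝ) : ℂ) ^ n) ψ)‖, fun s => ?_⟩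
  have hK0 : 0 ≤ K := by
    have h1 := (norm_nonneg _).trans (hK 1)
    simpa using h1
  have hpow : ∀ k : ℕ, D.fn (fun t => ((P.eval t : ℝ) : ℂ) ^ k) =
      Polynomial.aeval A (P.map (algebraMap ℝ ℂ)) ^ k := fun k => by
    induction k with
    | zero => simpa using D.fn_one
    | succ k ih =>
      simp only [pow_succ]
      rw [D.fn_mul (hP.fun_pow k) hP, ih, D.fn_ofReal_eval]
  have hsum : ∀ m : ℕ, (fun t => ∑ k ∈ Finset.range m, ((s : ℂ) ^ k * ((-Complex.I) ^ k /
      (k.factorial : ℂ))) * ((P.eval t : ℝ) : ℂ) ^ k).HasTemperateGrowth ∧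
      D.fn (fun t => ∑ k ∈ Finset.range m, ((s : ℂ) ^ k * ((-Complex.I) ^ k /
      (k.factorial : ℂ))) * ((P.eval t : ℝ) : ℂ) ^ k) = ∑ k ∈ Finset.range m,
      ((s : ℂ) ^ k * ((-Complex.I) ^ k / (k.factorial : ℂ))) •
        Polynomial.aeval A (P.map (algebraMap ℝ ℂ)) ^ k := fun m => by
    induction m with
    | zero => exact ⟨by simp, by simpa using D.fn_const 0⟩
    | succ m ih =>
      have h1 := (Function.HasTemperateGrowth.const ((s : ℂ) ^ m * ((-Complex.I) ^ m /
        (m.factorial : ℂ))) (E := ℝ)).fun_mul (hP.fun_pow m)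
      simp only [Finset.sum_range_succ]
      refine ⟨ih.1.fun_add h1, ?_⟩
      rw [D.fn_add ih.1 h1, ih.2, D.fn_const_mul _ (hP.fun_pow m), hpow]
  have hph := phase_hasTemperateGrowth (Polynomial.C s * P)
  have h1 : l2 (D.fn (phase (Polynomial.C s * P)) ψ) -
      ∑ k ∈ Finset.range n, ((s : ℂ) ^ k * ((-Complex.I) ^ k / (k.factorial : ℂ))) •
        l2 ((Polynomial.aeval A (P.map (algebraMap ℝ ℂ)) ^ k) ψ) =
      l2 (D.fn (fun t => phase (Polynomial.C s * P) t - ∑ k ∈ Finset.range n,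
        ((s : ℂ) ^ k * ((-Complex.I) ^ k / (k.factorial : ℂ))) * ((P.eval t : ℝ) : ℂ) ^ k) ψ) := by
    rw [D.fn_sub hph (hsum n).1, (hsum n).2, LinearMap.sub_apply, map_sub, LinearMap.sum_apply,
      map_sum]
    simp
  rw [h1]
  have h2 := D.norm_fn_le (hph.fun_sub (hsum n).1)
    ((Function.HasTemperateGrowth.const ((K * |s| ^ n : ℝ) : ℂ) (E := ℝ)).fun_mul (hP.fun_pow n))
    (fun t => ?_) ψ
  · refine h2.trans (le_of_eq ?_)
    rw [D.fn_const_mul _ (hP.fun_pow n), LinearMap.smul_apply, map_smul, norm_smul,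
      Complex.norm_real, Real.norm_of_nonneg (by positivity)]
    ring
  · have h3 := hK (-(s * P.eval t))
    rw [norm_mul, Complex.norm_real, norm_pow, Complex.norm_real,
      Real.norm_of_nonneg (by positivity)]
    refine le_trans (le_of_eq ?_) (h3.trans (le_of_eq ?_))
    · congr 2
      · simp [phase]
      · refine Finset.sum_congr rfl fun k _ => ?_
        push_cast
        rw [show -((s : ℂ) * (P.eval t : ℝ)) * Complex.I = (s : ℂ) * (-Complex.I) * (P.eval t : ℝ)
          by ring, mul_pow, mul_pow]
        ring
    · rw [abs_neg, abs_mul, mul_pow, Real.norm_eq_abs]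
      ring

end Diagonalization

/-! ### Time evolution -/

/-- `Y` is defined only on Schwartz vectors, but the first-order remainder of `u` is itself a
Schwartz vector, so the bound on `Y` applies to it. -/
theorem hasDerivAt_l2_map {r : ℕ} {Y : Op r} {K : ℝ} (hY : ∀ ψ, ‖l2 (Y ψ)‖ ≤ K * ‖l2 ψ‖)
    {u : ℝ → 𝓢(Modes r, ℂ)} {u' : 𝓢(Modes r, ℂ)} {s : ℝ}
    (hu : HasDerivAt (fun s => l2 (u s)) (l2 u') s) :
    HasDerivAt (fun s => l2 (Y (u s))) (l2 (Y u')) s := by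
  rw [hasDerivAt_iff_isLittleO] at hu ⊢
  refine Asymptotics.IsBigO.trans_isLittleO (Asymptotics.IsBigO.of_bound K ?_) hu
  refine Filter.Eventually.of_forall fun s' => ?_
  have h1 : ∀ v w z : 𝓢(Modes r, ℂ), ∀ c : ℝ, l2 v - l2 w - c • l2 z =
      l2 (v - w - (c : ℂ) • z) := fun v w z c => by simp
  rw [h1, h1]
  simpa using hY (u s' - u s - ((s' - s : ℝ) : ℂ) • u')

/-- The difference `Y U_s ψ - U'_s Y ψ` solves the same Schrödinger equation and vanishes at `s =
0`; symmetry of `H` conserves its norm. With `Y = 1` this is uniqueness of the evolution; with `U =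
U'` it passes commutation from `H` to its exponential. -/
theorem evolution_intertwines {r : ℕ} {H : Op r} {U U' : ℝ → Op r}
    (hsymm : ∀ ψ χ, inner ℂ (l2 (H ψ)) (l2 χ) = inner ℂ (l2 ψ) (l2 (H χ)))
    (hU : IsEvolution H U) (hU' : IsEvolution H U') {Y : Op r} {K : ℝ}
    (hY : ∀ ψ, ‖l2 (Y ψ)‖ ≤ K * ‖l2 ψ‖) (hYH : Commute Y H) (s : ℝ) :
    Y * U s = U' s * Y := by
  refine LinearMap.ext fun ψ => ?_
  let u : ℝ → 𝓢(Modes r, ℂ) := fun s => Y (U s ψ) - U' s (Y ψ)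
  have hd : ∀ s, HasDerivAt (fun s => l2 (u s)) (l2 (-Complex.I • H (u s))) s := fun s => by
    have h1 := hasDerivAt_l2_map hY (hU.2 ψ s)
    have h2 := h1.sub (hU'.2 (Y ψ) s)
    refine (h2.congr_deriv ?_)
    have h3 : Y (H (U s ψ)) = H (Y (U s ψ)) := LinearMap.congr_fun hYH (U s ψ)
    simp only [l2_eq, u, map_sub, map_smul, h3, smul_sub]
  have hc : ∀ s, HasDerivAt (fun s => inner ℂ (l2 (u s)) (l2 (u s))) 0 s := fun s => by
    refine ((hd s).inner ℂ (hd s)).congr_deriv ?_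
    simp only [map_smul, inner_smul_left, inner_smul_right, hsymm]
    simp
  have h0 : u 0 = 0 := by simp [u, hU.1, hU'.1]
  have hz : inner ℂ (l2 (u s)) (l2 (u s)) = 0 := by
    have := is_const_of_deriv_eq_zero (fun s => (hc s).differentiableAt) (fun s => (hc s).deriv) s 0
    simpa [h0] using this
  have hu : l2 (u s) = 0 := inner_self_eq_zero.mp hz
  have hu' : u s = 0 := l2_injective (by rw [hu, map_zero])
  exact sub_eq_zero.mp hu'

namespace Diagonalization

variable {r : ℕ} {A : Op r} (D : Diagonalization A)

/-- By the group law, the derivative at `s` follows from the second-order Taylor estimate at `0`,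
applied to the vector at time `s`. -/
theorem isEvolution (P : ℝ[X]) :
    IsEvolution (Polynomial.aeval A (P.map (algebraMap ℝ ℂ)))
      (fun s => D.fn (phase (Polynomial.C s * P))) := by
  refine ⟨by simpa using D.fn_phase_zero, fun ψ s => ?_⟩
  set H := Polynomial.aeval A (P.map (algebraMap ℝ ℂ))
  obtain ⟨K, hK⟩ := D.exists_norm_fn_phase_sub_taylor_le 2 P
    (D.fn (phase (Polynomial.C s * P)) ψ)
  rw [hasDerivAt_iff_isLittleO_nhds_zero]
  have hb : (fun h : ℝ => (D.fn (phase (Polynomial.C (s + h) * P)) ψ).toLp 2 volume -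
      (D.fn (phase (Polynomial.C s * P)) ψ).toLp 2 volume -
      h • (-Complex.I • H (D.fn (phase (Polynomial.C s * P)) ψ)).toLp 2 volume)
      =O[nhds 0] fun h : ℝ => h ^ 2 := by
    refine Asymptotics.IsBigO.of_bound K (Filter.Eventually.of_forall fun h => ?_)
    have h1 := hK h
    rw [norm_pow, Real.norm_eq_abs]
    refine le_trans (le_of_eq ?_) h1
    congr 1
    rw [show Polynomial.C (s + h) * P = Polynomial.C h * P + Polynomial.C s * P by
      rw [Polynomial.C_add]; ring, D.fn_phase_add]
    simp only [l2_eq, Finset.sum_range_succ, Finset.sum_range_zero, Module.End.mul_apply, pow_zero,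
      pow_one, map_smul, Module.End.one_apply]
    rw [RCLike.real_smul_eq_coe_smul (K := ℂ) h]
    rw [← show H = Polynomial.aeval A (P.map (algebraMap ℝ ℂ)) from rfl]
    simp [smul_smul]
    abel
  exact hb.trans_isLittleO (Asymptotics.isLittleO_pow_id (by norm_num))

/-- `expNegI` picks an arbitrary evolution; by uniqueness it is the one from the functional
calculus. -/
theorem expNegI_eq (P : ℝ[X]) :
    expNegI (Polynomial.aeval A (P.map (algebraMap ℝ ℂ))) = D.fn (phase P) := by
  have hex : ∃ U : ℝ → Op r, IsEvolution (Polynomial.aeval A (P.map (algebraMap ℝ ℂ))) U :=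
    ⟨_, D.isEvolution P⟩
  have h := evolution_intertwines (fun ψ χ => D.symmetric ψ χ P) hex.choose_spec
    (D.isEvolution P) (Y := 1) (K := 1) (fun ψ => by simp) (Commute.one_left _) 1
  rw [expNegI, dif_pos hex]
  simpa using h

theorem commute_fn_phase {Y : Op r} {K : ℝ} (hY : ∀ ψ, ‖l2 (Y ψ)‖ ≤ K * ‖l2 ψ‖)
    (hYA : Commute Y A) (P : ℝ[X]) : Commute Y (D.fn (phase P)) := by
  have hYH : Commute Y (Polynomial.aeval A (P.map (algebraMap ℝ ℂ))) := by
    induction P.map (algebraMap ℝ ℂ) using Polynomial.induction_on' with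
    | add p q hp hq => simpa using hp.add_right hq
    | monomial n a =>
      rw [Polynomial.aeval_monomial]
      exact Commute.mul_right (Algebra.commutes a Y).symm (hYA.pow_right n)
  have h := evolution_intertwines (fun ψ χ => D.symmetric ψ χ P) (D.isEvolution P)
    (D.isEvolution P) hY hYH 1
  rwa [Polynomial.C_1, one_mul] at h

end Diagonalization

end CausalSetQFT
end
noncomputable section
namespace CausalSetQFT
open MeasureTheory

/-! ### Causally ordered products -/

section CausalProd

variable {N r : ℕ}

theorem causalProd_empty (T : Fin N → Op r) : causalProd ∅ T = 1 := by simp [causalProd]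

theorem antiCausalProd_empty (T : Fin N → Op r) : antiCausalProd ∅ T = 1 := by
  simp [antiCausalProd]

/-- Ordered products are treated throughout by induction on the largest label, which is the leftmost
factor of a causal product and the rightmost of an anti-causal one. -/
theorem causalProd_insert_max {s : Finset (Fin N)} {m : Fin N} (h : ∀ a ∈ s, a < m)
    (T : Fin N → Op r) : causalProd (insert m s) T = T m * causalProd s T := by
  rw [causalProd, Finset.sort_insert (fun a b => b ≤ a) (fun b hb => (h b hb).le)
    (fun hm => lt_irrefl m (h m hm))]
  simp [causalProd]

theorem antiCausalProd_insert_max {s : Finset (Fin N)} {m : Fin N} (h : ∀ a ∈ s, a < m)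
    (T : Fin N → Op r) : antiCausalProd (insert m s) T = antiCausalProd s T * T m := by
  have hm : m ∉ s := fun hm => lt_irrefl m (h m hm)
  have hs : (insert m s).sort (fun a b => a ≤ b) = s.sort (fun a b => a ≤ b) ++ [m] := by
    refine List.Perm.eq_of_pairwise' (r := (· ≤ ·)) (Finset.pairwise_sort _ _) ?_ ?_
    · rw [List.pairwise_append]
      refine ⟨Finset.pairwise_sort _ _, List.pairwise_singleton _ _, fun a ha b hb => ?_⟩
      rw [List.mem_singleton] at hb
      subst hb
      exact (h a ((Finset.mem_sort _).mp ha)).le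
    · refine (List.perm_ext_iff_of_nodup (Finset.sort_nodup _ _) ?_).mpr fun a => ?_
      · rw [List.nodup_append]
        refine ⟨Finset.sort_nodup _ _, List.nodup_singleton _, fun a ha b hb => ?_⟩
        rw [List.mem_singleton] at hb
        subst hb
        rintro rfl
        exact hm ((Finset.mem_sort _).mp ha)
      · simp [or_comm]
  rw [antiCausalProd, hs]
  simp [antiCausalProd]

theorem causalProd_congr {s : Finset (Fin N)} {T T' : Fin N → Op r} (h : ∀ z ∈ s, T z = T' z) :
    causalProd s T = causalProd s T' := by
  rw [causalProd, causalProd]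
  congr 1
  exact List.map_congr_left fun z hz => h z ((Finset.mem_sort _).mp hz)

theorem commute_causalProd {s : Finset (Fin N)} {T : Fin N → Op r} {X : Op r}
    (h : ∀ z ∈ s, Commute X (T z)) : Commute X (causalProd s T) := by
  induction s using Finset.induction_on_max with
  | empty => rw [causalProd_empty]; exact Commute.one_right X
  | insert m s hm ih =>
    rw [causalProd_insert_max hm]
    exact (h m (Finset.mem_insert_self _ _)).mul_right
      (ih fun z hz => h z (Finset.mem_insert_of_mem hz))

/-- Bringing the factors over `s` to the left interchanges only pairs in which the factor from `s`
has the smaller label. -/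
theorem causalProd_union {s t : Finset (Fin N)} {T : Fin N → Op r} (hst : Disjoint s t)
    (h : ∀ a ∈ s, ∀ b ∈ t, a < b → Commute (T a) (T b)) :
    causalProd (s ∪ t) T = causalProd s T * causalProd t T := by
  obtain ⟨u, hu⟩ : ∃ u, u = s ∪ t := ⟨_, rfl⟩
  rw [← hu]
  induction u using Finset.induction_on_max generalizing s t with
  | empty =>
    obtain ⟨rfl, rfl⟩ := Finset.union_eq_empty.mp hu.symm
    simp [causalProd_empty]
  | insert m u hm ih =>
    have hmu : m ∉ u := fun h => lt_irrefl m (hm m h)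
    rw [causalProd_insert_max hm]
    have hmst : m ∈ s ∪ t := hu ▸ Finset.mem_insert_self m u
    have hu' : u = (s ∪ t).erase m := by rw [← hu, Finset.erase_insert hmu]
    rcases Finset.mem_union.mp hmst with hms | hmt
    · have hmt : m ∉ t := Finset.disjoint_left.mp hst hms
      have he : u = s.erase m ∪ t := by
        rw [hu', Finset.erase_union_distrib, Finset.erase_eq_of_notMem hmt]
      rw [ih (hst.mono_left (Finset.erase_subset _ _))
        (fun a ha b hb => h a (Finset.mem_of_mem_erase ha) b hb) he, ← mul_assoc,
        ← causalProd_insert_max (fun a ha => hm a (he ▸ Finset.mem_union_left _ ha)),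
        Finset.insert_erase hms]
    · have hms : m ∉ s := Finset.disjoint_right.mp hst hmt
      have he : u = s ∪ t.erase m := by
        rw [hu', Finset.erase_union_distrib, Finset.erase_eq_of_notMem hms]
      have hc : Commute (T m) (causalProd s T) := commute_causalProd fun a ha =>
        (h a ha m hmt (hm a (he ▸ Finset.mem_union_left _ ha))).symm
      rw [ih (hst.mono_right (Finset.erase_subset _ _))
        (fun a ha b hb => h a ha b (Finset.mem_of_mem_erase hb)) he, ← mul_assoc, hc.eq, mul_assoc,
        ← causalProd_insert_max (fun a ha => hm a (he ▸ Finset.mem_union_right _ ha)),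
        Finset.insert_erase hmt]

theorem causalProd_split {s : Finset (Fin N)} {x : Fin N} (hs : Finset.Iic x ⊆ s)
    (T : Fin N → Op r) : causalProd s T =
      causalProd (s \ Finset.Iic x) T * T x * causalProd (Finset.Iio x) T := by
  have h1 : Finset.Iic x = insert x (Finset.Iio x) := by
    ext z; simp [le_iff_eq_or_lt]
  conv_lhs => rw [← Finset.sdiff_union_of_subset hs]
  rw [causalProd_union Finset.sdiff_disjoint, mul_assoc, ← causalProd_insert_max, ← h1]
  · intro a ha; exact Finset.mem_Iio.mp ha
  · intro a ha b hb hab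
    simp only [Finset.mem_sdiff, Finset.mem_Iic, not_le] at ha hb
    exact absurd hab (not_lt.mpr (hb.trans ha.2.le))

/-- Two families of mutually inverse operators. -/
def InverseFamilies (T T' : Fin N → Op r) : Prop := ∀ z, T' z * T z = 1 ∧ T z * T' z = 1

theorem InverseFamilies.left {T T' : Fin N → Op r} (h : InverseFamilies T T')
    (s : Finset (Fin N)) : antiCausalProd s T' * causalProd s T = 1 := by
  induction s using Finset.induction_on_max with
  | empty => simp [causalProd_empty, antiCausalProd_empty]
  | insert m s hm ih =>
    rw [causalProd_insert_max hm, antiCausalProd_insert_max hm, mul_assoc, ← mul_assoc (T' m),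
      (h m).1, one_mul, ih]

theorem InverseFamilies.right {T T' : Fin N → Op r} (h : InverseFamilies T T')
    (s : Finset (Fin N)) : causalProd s T * antiCausalProd s T' = 1 := by
  induction s using Finset.induction_on_max with
  | empty => simp [causalProd_empty, antiCausalProd_empty]
  | insert m s hm ih =>
    rw [causalProd_insert_max hm, antiCausalProd_insert_max hm, mul_assoc, ← mul_assoc _ _ (T' m),
      ih, one_mul, (h m).2]

/-- If `U` is the product over the labels below `x`, then `T_x X U = T_x U (U⁻¹ X U)`: an insertion
at the place of `x` is a conjugated operator at the right end. -/
theorem causalProd_update_mul {s : Finset (Fin N)} {x : Fin N} (hs : Finset.Iic x ⊆ s)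
    {T T' : Fin N → Op r} (h : InverseFamilies T T') (X : Op r) :
    causalProd s (Function.update T x (T x * X)) = causalProd s T *
      (antiCausalProd (Finset.Iio x) T' * X * causalProd (Finset.Iio x) T) := by
  rw [causalProd_split hs, causalProd_split hs T, Function.update_self,
    causalProd_congr (s := s \ Finset.Iic x) (T' := T), causalProd_congr (s := Finset.Iio x)
      (T' := T)]
  · simp only [mul_assoc]
    rw [← mul_assoc (causalProd (Finset.Iio x) T), h.right, one_mul]
  · intro z hz
    rw [Function.update_of_ne (Finset.mem_Iio.mp hz).ne]
  · intro z hz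
    simp only [Finset.mem_sdiff, Finset.mem_Iic, not_le] at hz
    rw [Function.update_of_ne hz.2.ne']

end CausalProd

/-! ### Operators with an adjoint on Schwartz space -/

/-- `A` has a formal adjoint that preserves Schwartz space. -/
def HasAdjoint {r : ℕ} (A : Op r) : Prop :=
  ∃ A' : Op r, ∀ ψ χ, inner ℂ (l2 ψ) (l2 (A χ)) = inner ℂ (l2 (A' ψ)) (l2 χ)

theorem HasAdjoint.one {r : ℕ} : HasAdjoint (1 : Op r) := ⟨1, fun _ _ => rfl⟩

theorem HasAdjoint.mul {r : ℕ} {A B : Op r} (hA : HasAdjoint A) (hB : HasAdjoint B) :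
    HasAdjoint (A * B) := by
  obtain ⟨A', hA⟩ := hA
  obtain ⟨B', hB⟩ := hB
  exact ⟨B' * A', fun ψ χ => by simp [hA, hB]⟩

theorem Diagonalization.hasAdjoint_fn {r : ℕ} {A : Op r} (D : Diagonalization A) {f : ℝ → ℂ}
    (hf : f.HasTemperateGrowth) : HasAdjoint (D.fn f) :=
  ⟨D.fn fun t => conj (f t), fun ψ χ => by
    rw [D.inner_fn_left (hasTemperateGrowth_conj hf)]; simp⟩

theorem Diagonalization.hasAdjoint {r : ℕ} {A : Op r} (D : Diagonalization A) : HasAdjoint A := by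
  have h := D.hasAdjoint_fn (f := fun t => (t : ℂ)) (by fun_prop)
  rwa [D.fn_id] at h

theorem hasAdjoint_causalProd {N r : ℕ} {T : Fin N → Op r} (s : Finset (Fin N))
    (h : ∀ z ∈ s, HasAdjoint (T z)) : HasAdjoint (causalProd s T) := by
  induction s using Finset.induction_on_max with
  | empty => rw [causalProd_empty]; exact HasAdjoint.one
  | insert m s hm ih =>
    rw [causalProd_insert_max hm]
    exact (h m (Finset.mem_insert_self _ _)).mul
      (ih fun z hz => h z (Finset.mem_insert_of_mem hz))

/-- The evolution is differentiable only in `L²`, and `A` may be unbounded; passing `A` to the bra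
reduces the claim to an inner product with a fixed vector. -/
theorem Diagonalization.hasDerivAt_vev {r : ℕ} {H : Op r} (D : Diagonalization H) {A B : Op r}
    (hA : HasAdjoint A) (t : ℝ) :
    HasDerivAt (fun t : ℝ => vev (A * D.fn (phase (Polynomial.C t * Polynomial.X)) * B))
      (-Complex.I * vev (A * (H * D.fn (phase (Polynomial.C t * Polynomial.X))) * B)) t := by
  obtain ⟨A', hA⟩ := hA
  have h1 := (D.isEvolution Polynomial.X).2 (B (vacuum r)) t
  have h2 := (hasDerivAt_const t (l2 (A' (vacuum r)))).inner ℂ h1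
  have h3 : ∀ t, inner ℂ (l2 (A' (vacuum r)))
      ((D.fn (phase (Polynomial.C t * Polynomial.X)) (B (vacuum r))).toLp 2 volume) =
      vev (A * D.fn (phase (Polynomial.C t * Polynomial.X)) * B) := fun t => by
    rw [vev_eq_inner, Module.End.mul_apply, Module.End.mul_apply, hA]
    rfl
  simp only [h3] at h2
  refine h2.congr_deriv ?_
  simp only [inner_zero_left, add_zero, l2_eq, map_smul, inner_smul_right, Polynomial.map_X,
    Polynomial.aeval_X, vev_eq_inner, Module.End.mul_apply, hA]

/-! ### Phases of field operators and their commutators -/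

section Field

variable {N : ℕ} {Δ : Matrix (Fin N) (Fin N) ℝ} (ρ : GaussianState Δ)

/-- The operator `exp (-i P(φ x))`. -/
def fieldPhase (P : ℝ[X]) (x : Fin N) : Op ρ.numModes := (fieldDiag ρ x).fn (phase P)

theorem expNegI_hamiltonian (P : Fin N → ℝ[X]) (x : Fin N) :
    expNegI (hamiltonian ρ P x) = fieldPhase ρ (P x) x :=
  (fieldDiag ρ x).expNegI_eq (P x)

theorem expNegI_neg_hamiltonian (P : Fin N → ℝ[X]) (x : Fin N) :
    expNegI (-hamiltonian ρ P x) = fieldPhase ρ (-P x) x := by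
  rw [← expNegI_hamiltonian ρ (fun x => -P x)]
  simp [hamiltonian]

theorem expNegI_smul_field (c : ℝ) (x : Fin N) :
    expNegI ((c : ℂ) • field ρ x) =
      fieldPhase ρ (Polynomial.C c * Polynomial.X) x := by
  rw [fieldPhase, ← (fieldDiag ρ x).expNegI_eq]
  congr 1
  simp [Algebra.smul_def]

theorem fieldPhase_add (P Q : ℝ[X]) (x : Fin N) :
    fieldPhase ρ (P + Q) x = fieldPhase ρ P x * fieldPhase ρ Q x :=
  (fieldDiag ρ x).fn_phase_add P Q

theorem fieldPhase_zero (x : Fin N) : fieldPhase ρ 0 x = 1 := (fieldDiag ρ x).fn_phase_zero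

theorem norm_fieldPhase (P : ℝ[X]) (x : Fin N) (ψ : 𝓢(Modes ρ.numModes, ℂ)) :
    ‖l2 (fieldPhase ρ P x ψ)‖ = ‖l2 ψ‖ := (fieldDiag ρ x).norm_fn_phase P ψ

theorem hasAdjoint_fieldPhase (P : ℝ[X]) (x : Fin N) : HasAdjoint (fieldPhase ρ P x) :=
  (fieldDiag ρ x).hasAdjoint_fn (phase_hasTemperateGrowth P)

theorem inverseFamilies_fieldPhase (P : Fin N → ℝ[X]) :
    InverseFamilies (fun z => fieldPhase ρ (P z) z) (fun z => fieldPhase ρ (-P z) z) :=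
  fun z => ⟨(fieldDiag ρ z).fn_phase_neg_mul (P z), (fieldDiag ρ z).fn_phase_mul_neg (P z)⟩

theorem commute_field {x y : Fin N} (h : Δ x y = 0) : Commute (field ρ x) (field ρ y) := by
  have := field_peierls ρ x y
  rw [h] at this
  exact sub_eq_zero.mp (by simpa using this)

/-- The constant in `commutator_fn` is found from `f = id`, where it is the Peierls bracket. -/
theorem commutator_field_fn (x z : Fin N) {f f' : ℝ → ℂ} (hf : f.HasTemperateGrowth)
    (hf' : f'.HasTemperateGrowth) (hd : ∀ t, HasDerivAt f (f' t) t) :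
    field ρ x * (fieldDiag ρ z).fn f - (fieldDiag ρ z).fn f * field ρ x =
      (Complex.I * (Δ x z : ℂ)) • (fieldDiag ρ z).fn f' := by
  obtain ⟨c, hc⟩ := (fieldDiag ρ z).commutator_fn (field_mem_affineOps ρ x)
  have h1 := hc (fun t => (t : ℂ)) (fun _ => 1) (by fun_prop) (by fun_prop)
    (fun t => (hasDerivAt_id t).ofReal_comp)
  rw [(fieldDiag ρ z).fn_id, (fieldDiag ρ z).fn_one, field_peierls] at h1
  rw [hc f f' hf hf' hd, ← mul_one ((fieldDiag ρ z).fn f'), ← mul_smul_comm, ← mul_smul_comm, h1]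

theorem commute_field_fieldPhase {x z : Fin N} (h : Δ x z = 0) (P : ℝ[X]) :
    Commute (field ρ x) (fieldPhase ρ P z) := by
  have h1 := commutator_field_fn ρ x z (phase_hasTemperateGrowth P)
    (((Function.HasTemperateGrowth.const (-Complex.I)).fun_mul (hasTemperateGrowth_ofReal
      (hasTemperateGrowth_eval P.derivative))).fun_mul (phase_hasTemperateGrowth P))
    (phase_hasDerivAt P)
  rw [h] at h1
  exact sub_eq_zero.mp (by simpa [fieldPhase] using h1)

/-- The uniqueness argument needs one bounded operator: the phase at `z` commutes with `φ_x`, and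
being isometric it then commutes with the evolution generated by `Q(φ_x)`. -/
theorem commute_fieldPhase {x z : Fin N} (h : Δ x z = 0) (P Q : ℝ[X]) :
    Commute (fieldPhase ρ Q x) (fieldPhase ρ P z) :=
  ((fieldDiag ρ x).commute_fn_phase (K := 1) (fun ψ => by rw [norm_fieldPhase, one_mul])
    (commute_field_fieldPhase ρ h P).symm Q).symm

theorem sOperator_eq (P : Fin N → ℝ[X]) :
    sOperator ρ P = causalProd Finset.univ fun z => fieldPhase ρ (P z) z := by
  simp only [sOperator, expNegI_hamiltonian]

open Classical in
theorem heisenberg_def (C : Causet N) (P : Fin N → ℝ[X]) (x : Fin N) :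
    heisenberg ρ C P x =
      antiCausalProd (Finset.univ.filter fun z => C.prec z x) (fun z => fieldPhase ρ (-P z) z) *
        field ρ x *
        causalProd (Finset.univ.filter fun z => C.prec z x) (fun z => fieldPhase ρ (P z) z) := by
  simp only [heisenberg, evolution, evolutionAdj, expNegI_hamiltonian, expNegI_neg_hamiltonian]

end Field

theorem pauliJordan_eq_zero {N : ℕ} {C : Causet N} {ΔR : Matrix (Fin N) (Fin N) ℝ}
    (hR : IsRetarded C ΔR) {x y : Fin N} (hxy : ¬ C.prec x y) (hyx : ¬ C.prec y x) :
    pauliJordan ΔR x y = 0 := by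
  simp [pauliJordan, hR x y hyx, hR y x hxy]

/-! ### Heisenberg fields and causal order -/

section Causal

variable {N : ℕ} {C : Causet N} {ΔR : Matrix (Fin N) (Fin N) ℝ}
  (ρ : GaussianState (pauliJordan ΔR)) (P : Fin N → ℝ[X])

/-- Factors outside the causal past of `x` that are unrelated to `x` drop out of `φ^H x`. -/
theorem heisenberg_eq (hR : IsRetarded C ΔR) {x : Fin N} {s : Finset (Fin N)}
    (h1 : ∀ z, C.prec z x → z ∈ s) (h2 : ∀ z ∈ s, ¬ C.prec x z) :
    antiCausalProd s (fun z => fieldPhase ρ (-P z) z) * field ρ x *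
      causalProd s (fun z => fieldPhase ρ (P z) z) = heisenberg ρ C P x := by
  classical
  set p := Finset.univ.filter fun z => C.prec z x with hp
  have hps : p ⊆ s := fun z hz => h1 z (by simpa [hp] using hz)
  have hmem : ∀ z, z ∈ p ↔ C.prec z x := fun z => by simp [hp]
  have hT := inverseFamilies_fieldPhase ρ P
  set T := fun z => fieldPhase ρ (P z) z
  set T' := fun z => fieldPhase ρ (-P z) z
  -- The past `p` is closed downwards: an `a` outside `p` with a label below some `b ∈ p` is
  -- unrelated to `b`, since `a ≺ b` would put `a` in the past of `x`. So the factors over `p` can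
  -- be moved to the right end.
  have e1 : causalProd s T = causalProd (s \ p) T * causalProd p T := by
    rw [← causalProd_union Finset.sdiff_disjoint, Finset.sdiff_union_of_subset hps]
    intro a ha b hb hab
    rw [Finset.mem_sdiff, hmem] at ha
    rw [hmem] at hb
    refine commute_fieldPhase ρ (pauliJordan_eq_zero hR (fun h => ha.2 (C.prec_trans _ _ _ h hb))
      fun h => (C.natural _ _ h).asymm hab) _ _
  -- The anti-causal products are the inverses of the causal ones, so they factorize in the opposite
  -- order.
  have e2 : antiCausalProd s T' = antiCausalProd p T' * antiCausalProd (s \ p) T' := by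
    have h3 := hT.left s
    have h4 : causalProd s T * (antiCausalProd p T' * antiCausalProd (s \ p) T') = 1 := by
      rw [e1, mul_assoc, ← mul_assoc (causalProd p T), hT.right, one_mul, hT.right]
    exact left_inv_eq_right_inv h3 h4
  -- The elements of `s` outside the past are unrelated to `x`, so their factors cancel across
  -- `φ_x`.
  have e3 : Commute (field ρ x) (causalProd (s \ p) T) := by
    refine commute_causalProd fun z hz => ?_
    rw [Finset.mem_sdiff, hmem] at hz
    exact commute_field_fieldPhase ρ (pauliJordan_eq_zero hR (h2 z hz.1) hz.2) _
  rw [heisenberg_def, e1, e2, mul_assoc, mul_assoc, ← mul_assoc (field ρ x), e3.eq,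
    ← mul_assoc (antiCausalProd (s \ p) T'), ← mul_assoc (antiCausalProd (s \ p) T'), hT.left,
    one_mul, ← mul_assoc]

theorem heisenberg_eq_Iio (hR : IsRetarded C ΔR) (x : Fin N) :
    antiCausalProd (Finset.Iio x) (fun z => fieldPhase ρ (-P z) z) * field ρ x *
      causalProd (Finset.Iio x) (fun z => fieldPhase ρ (P z) z) = heisenberg ρ C P x :=
  heisenberg_eq ρ P hR (fun _ hz => Finset.mem_Iio.mpr (C.natural _ _ hz))
    (fun _ hz h => (C.natural _ _ h).asymm (Finset.mem_Iio.mp hz))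

/-- With the union of the two pasts as common set, both Heisenberg fields are conjugates of
commuting free fields by the same operator. -/
theorem commute_heisenberg (hR : IsRetarded C ΔR) {x y : Fin N} (hxy : ¬ C.prec x y)
    (hyx : ¬ C.prec y x) : Commute (heisenberg ρ C P x) (heisenberg ρ C P y) := by
  classical
  set s := Finset.univ.filter fun z => C.prec z x ∨ C.prec z y with hs
  have hmem : ∀ z, z ∈ s ↔ C.prec z x ∨ C.prec z y := fun z => by simp [hs]
  have hirr : ∀ z, ¬ C.prec z z := fun z h => (C.natural _ _ h).false
  have ex := heisenberg_eq ρ P hR (x := x) (s := s) (fun z hz => (hmem z).mpr (Or.inl hz))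
    (fun z hz h => ((hmem z).mp hz).elim (fun h' => hirr _ (C.prec_trans _ _ _ h h'))
      fun h' => hxy (C.prec_trans _ _ _ h h'))
  have ey := heisenberg_eq ρ P hR (x := y) (s := s) (fun z hz => (hmem z).mpr (Or.inr hz))
    (fun z hz h => ((hmem z).mp hz).elim (fun h' => hyx (C.prec_trans _ _ _ h h'))
      fun h' => hirr _ (C.prec_trans _ _ _ h h'))
  have hT := inverseFamilies_fieldPhase ρ P
  set T := fun z => fieldPhase ρ (P z) z
  set T' := fun z => fieldPhase ρ (-P z) z
  have hc := commute_field ρ (pauliJordan_eq_zero hR hxy hyx)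
  have hconj : ∀ X Y : Op ρ.numModes, antiCausalProd s T' * X * causalProd s T *
      (antiCausalProd s T' * Y * causalProd s T) =
      antiCausalProd s T' * (X * Y) * causalProd s T := fun X Y => by
    simp only [mul_assoc]
    rw [← mul_assoc (causalProd s T), hT.right, one_mul]
  rw [Commute, SemiconjBy, ← ex, ← ey, hconj, hconj, hc.eq]

/-- Inserting fields into the S-operator at their places in the causal order. -/
theorem sOperator_mul_causalHeisenberg_of_ne (hR : IsRetarded C ΔR) {x y : Fin N} (hxy : x ≠ y) :
    sOperator ρ P * causalHeisenberg ρ C P x y =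
      causalProd Finset.univ (Function.update (Function.update (fun z => fieldPhase ρ (P z) z) y
        (fieldPhase ρ (P y) y * field ρ y)) x (fieldPhase ρ (P x) x * field ρ x)) := by
  have hT := inverseFamilies_fieldPhase ρ P
  -- The insertion at `b` is first carried to the right end of the product below `a`; the
  -- conjugation that carries `φ_a` past this product then acts only on `φ_a`.
  have key : ∀ a b : Fin N, b < a →
      causalProd Finset.univ (Function.update (Function.update (fun z => fieldPhase ρ (P z) z) b
        (fieldPhase ρ (P b) b * field ρ b)) a (fieldPhase ρ (P a) a * field ρ a)) =
      sOperator ρ P * (heisenberg ρ C P a * heisenberg ρ C P b) := by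
    intro a b hba
    have ea := heisenberg_eq_Iio ρ P hR a
    have eb := heisenberg_eq_Iio ρ P hR b
    rw [sOperator_eq]
    set T := fun z => fieldPhase ρ (P z) z with hTdef
    set T' := fun z => fieldPhase ρ (-P z) z
    set M := Function.update T b (fieldPhase ρ (P b) b * field ρ b) with hM
    have h1 : causalProd (Finset.Iio a) M =
        causalProd (Finset.Iio a) T * heisenberg ρ C P b := by
      rw [← eb]
      exact causalProd_update_mul (fun z hz =>
        Finset.mem_Iio.mpr ((Finset.mem_Iic.mp hz).trans_lt hba)) hT _
    rw [causalProd_split (Finset.subset_univ _), causalProd_split (Finset.subset_univ _) T,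
      Function.update_self, causalProd_congr (s := Finset.univ \ Finset.Iic a) (T' := T),
      causalProd_congr (s := Finset.Iio a) (T' := M), h1, ← ea]
    · simp only [mul_assoc]
      rw [← mul_assoc _ (antiCausalProd (Finset.Iio a) T'), hT.right, one_mul]
    · intro z hz
      rw [Function.update_of_ne (Finset.mem_Iio.mp hz).ne]
    · intro z hz
      simp only [Finset.mem_sdiff, Finset.mem_Iic, not_le] at hz
      rw [Function.update_of_ne hz.2.ne', hM, Function.update_of_ne (hba.trans hz.2).ne']
  rcases lt_or_gt_of_ne hxy with h | h
  · rw [Function.update_comm hxy.symm, key y x h, causalHeisenberg,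
      if_neg fun h' => (C.natural _ _ h').asymm h]
  · rw [key x y h, causalHeisenberg]
    split_ifs with h'
    · rfl
    -- Here `y` has the smaller label without preceding `x`: label order and the convention for
    -- `C[·]` differ, but the fields commute.
    · rw [(commute_heisenberg ρ P hR (fun h'' => (C.natural _ _ h'').asymm h) h').eq]

theorem sOperator_mul_causalHeisenberg_self (hR : IsRetarded C ΔR) (x : Fin N) :
    sOperator ρ P * causalHeisenberg ρ C P x x =
      causalProd Finset.univ (Function.update (fun z => fieldPhase ρ (P z) z) x
        (fieldPhase ρ (P x) x * (field ρ x * field ρ x))) := by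
  have hT := inverseFamilies_fieldPhase ρ P
  have ex := heisenberg_eq_Iio ρ P hR x
  have h1 := causalProd_update_mul (Finset.subset_univ (Finset.Iic x)) hT (field ρ x * field ρ x)
  rw [sOperator_eq, h1, causalHeisenberg, if_neg fun h => (C.natural _ _ h).false, ← ex]
  simp only [mul_assoc]
  rw [← mul_assoc (causalProd (Finset.Iio x) _) (antiCausalProd (Finset.Iio x) _), hT.right,
    one_mul]

end Causal

/-! ### Source derivatives -/

section Sources

variable {N : ℕ} {Δ : Matrix (Fin N) (Fin N) ℝ} (ρ : GaussianState Δ) (P : Fin N → ℝ[X])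

/-- The interaction polynomials with a linear source term. -/
def withSource (J : Fin N → ℝ) (x : Fin N) : ℝ[X] :=
  P x + Polynomial.C (J x) * Polynomial.X

theorem withSource_zero : withSource P 0 = P := by
  funext x; simp [withSource]

theorem fieldPhase_withSource_update (J : Fin N → ℝ) (y : Fin N) (t : ℝ) :
    (fun z => fieldPhase ρ (withSource P (J + t • Pi.single y 1) z) z) =
      Function.update (fun z => fieldPhase ρ (withSource P J z) z) y
        (fieldPhase ρ (withSource P J y) y *
          fieldPhase ρ (Polynomial.C t * Polynomial.X) y) := by
  funext z
  by_cases h : z = y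
  · subst h
    rw [Function.update_self, ← fieldPhase_add]
    simp [withSource, add_mul, add_assoc]
  · rw [Function.update_of_ne h]
    simp [withSource, h]

theorem causalProd_update {r : ℕ} (M : Fin N → Op r) (x : Fin N) (A : Op r) :
    causalProd Finset.univ (Function.update M x A) =
      causalProd (Finset.univ \ Finset.Iic x) M * A * causalProd (Finset.Iio x) M := by
  rw [causalProd_split (Finset.subset_univ _), Function.update_self,
    causalProd_congr (s := Finset.univ \ Finset.Iic x) (T' := M),
    causalProd_congr (s := Finset.Iio x) (T' := M)]
  · intro z hz
    rw [Function.update_of_ne (Finset.mem_Iio.mp hz).ne]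
  · intro z hz
    simp only [Finset.mem_sdiff, Finset.mem_Iic, not_le] at hz
    rw [Function.update_of_ne hz.2.ne']

/-- The slot `B` holds a field already inserted at `x`, as needed for the second derivative at
coincident points. -/
theorem hasDerivAt_vev_update {M : Fin N → Op ρ.numModes} (hM : ∀ z, HasAdjoint (M z))
    {A : Op ρ.numModes} (hA : HasAdjoint A) (B : Op ρ.numModes) (x : Fin N) :
    HasDerivAt (fun t : ℝ => vev (causalProd Finset.univ (Function.update M x
        (A * fieldPhase ρ (Polynomial.C t * Polynomial.X) x * B))))
      (-Complex.I * vev (causalProd Finset.univ (Function.update M x (A * field ρ x * B)))) 0 := by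
  have h := (fieldDiag ρ x).hasDerivAt_vev
    (B := B * causalProd (Finset.Iio x) M)
    ((hasAdjoint_causalProd (Finset.univ \ Finset.Iic x) fun z _ => hM z).mul hA) 0
  rw [Polynomial.C_0, zero_mul, Diagonalization.fn_phase_zero, mul_one] at h
  simp only [causalProd_update]
  refine (h.congr_deriv ?_).congr_of_eventuallyEq (Filter.Eventually.of_forall fun t => ?_)
  · simp only [mul_assoc]
  · simp only [mul_assoc, fieldPhase]

theorem hasLineDerivAt_vev_sOperator (J : Fin N → ℝ) (y : Fin N) :
    HasLineDerivAt ℝ (fun J => vev (sOperator ρ (withSource P J)))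
      (-Complex.I * vev (causalProd Finset.univ (Function.update
        (fun z => fieldPhase ρ (withSource P J z) z) y
        (fieldPhase ρ (withSource P J y) y * field ρ y)))) J (Pi.single y 1) := by
  have h := hasDerivAt_vev_update ρ (M := fun z => fieldPhase ρ (withSource P J z) z)
    (fun z => hasAdjoint_fieldPhase ρ _ z) (hasAdjoint_fieldPhase ρ (withSource P J y) y) 1 y
  simp only [mul_one] at h
  simpa only [HasLineDerivAt, sOperator_eq, fieldPhase_withSource_update] using h

theorem hasLineDerivAt_vev_insertion (x y : Fin N) :
    HasLineDerivAt ℝ (fun J => vev (causalProd Finset.univ (Function.update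
        (fun z => fieldPhase ρ (withSource P J z) z) y
        (fieldPhase ρ (withSource P J y) y * field ρ y))))
      (-Complex.I * vev (if x = y then
        causalProd Finset.univ (Function.update (fun z => fieldPhase ρ (P z) z) x
          (fieldPhase ρ (P x) x * (field ρ x * field ρ x)))
        else causalProd Finset.univ (Function.update (Function.update
          (fun z => fieldPhase ρ (P z) z) y (fieldPhase ρ (P y) y * field ρ y)) x
          (fieldPhase ρ (P x) x * field ρ x)))) 0 (Pi.single x 1) := by
  rw [HasLineDerivAt]
  have hf : HasAdjoint (field ρ y) := (fieldDiag ρ y).hasAdjoint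
  have hfun : ∀ t : ℝ, (fun z => fieldPhase ρ (withSource P (0 + t • Pi.single x 1) z) z) = _ :=
    fun t => fieldPhase_withSource_update ρ P 0 x t
  simp only [withSource_zero] at hfun
  split_ifs with hxy
  · subst hxy
    have h := hasDerivAt_vev_update ρ (M := fun z => fieldPhase ρ (P z) z)
      (fun z => hasAdjoint_fieldPhase ρ _ z) (hasAdjoint_fieldPhase ρ (P x) x) (field ρ x) x
    refine (h.congr_deriv ?_).congr_of_eventuallyEq (Filter.Eventually.of_forall fun t => ?_)
    · simp only [mul_assoc]
    · have h2 := congrFun (hfun t) x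
      simp only [Function.update_self] at h2
      simp only [hfun t, h2, Function.update_idem]
  · have h := hasDerivAt_vev_update ρ (M := Function.update
      (fun z => fieldPhase ρ (P z) z) y (fieldPhase ρ (P y) y * field ρ y))
      (fun z => ?_) (hasAdjoint_fieldPhase ρ (P x) x) 1 x
    · simp only [mul_one] at h
      refine h.congr_of_eventuallyEq (Filter.Eventually.of_forall fun t => ?_)
      have h2 := congrFun (hfun t) y
      rw [Function.update_of_ne (Ne.symm hxy)] at h2
      simp only [hfun t, h2]
      rw [Function.update_comm hxy]
    · by_cases hz : z = y
      · subst hz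
        rw [Function.update_self]
        exact (hasAdjoint_fieldPhase ρ _ _).mul hf
      · rw [Function.update_of_ne hz]
        exact hasAdjoint_fieldPhase ρ _ _

end Sources

end CausalSetQFT
end
noncomputable section
namespace CausalSetQFT
open MeasureTheory

/-! ### Polynomial dependence on the couplings -/

section InIn

variable {N r : ℕ}

/-- Operators that depend polynomially on the couplings. -/
def polynomialOps (N r : ℕ) : Submodule ℂ ((Fin N → ℝ) → Op r) :=
  Submodule.span ℂ (Set.range fun p : MvPolynomial (Fin N) ℂ × Op r =>
    fun g => MvPolynomial.eval (fun x => (g x : ℂ)) p.1 • p.2)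

theorem smul_mem_polynomialOps (p : MvPolynomial (Fin N) ℂ) (T : Op r) :
    (fun g : Fin N → ℝ => MvPolynomial.eval (fun x => (g x : ℂ)) p • T) ∈ polynomialOps N r :=
  Submodule.subset_span ⟨(p, T), rfl⟩

theorem const_mem_polynomialOps (T : Op r) : (fun _ => T) ∈ polynomialOps N r := by
  simpa using smul_mem_polynomialOps (1 : MvPolynomial (Fin N) ℂ) T

theorem mul_mem_polynomialOps {F G : (Fin N → ℝ) → Op r} (hF : F ∈ polynomialOps N r)
    (hG : G ∈ polynomialOps N r) : F * G ∈ polynomialOps N r := by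
  have h := Submodule.mul_mem_mul hF hG
  rw [polynomialOps, Submodule.span_mul_span] at h
  refine Submodule.span_mono ?_ h
  rintro _ ⟨_, ⟨p, rfl⟩, _, ⟨q, rfl⟩, rfl⟩
  refine ⟨(p.1 * q.1, p.2 * q.2), ?_⟩
  funext g
  simp [smul_smul, mul_comm]

/-- The algebra of polynomials in the fields and in the couplings. -/
def fieldAlgebra {Δ : Matrix (Fin N) (Fin N) ℝ} (ρ : GaussianState Δ) :
    Subalgebra ℂ ((Fin N → ℝ) → Op ρ.numModes) :=
  Algebra.adjoin ℂ ((Set.range fun z => fun _ => field ρ z) ∪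
    Set.range fun z => fun g => (g z : ℂ) • 1)

variable {Δ : Matrix (Fin N) (Fin N) ℝ} (ρ : GaussianState Δ)

theorem field_mem_fieldAlgebra (z : Fin N) : (fun _ => field ρ z) ∈ fieldAlgebra ρ :=
  Algebra.subset_adjoin (Or.inl ⟨z, rfl⟩)

theorem coupling_mem_fieldAlgebra (z : Fin N) :
    (fun g : Fin N → ℝ => (g z : ℂ) • (1 : Op ρ.numModes)) ∈ fieldAlgebra ρ :=
  Algebra.subset_adjoin (Or.inr ⟨z, rfl⟩)

theorem fieldAlgebra_le {F : (Fin N → ℝ) → Op ρ.numModes} (hF : F ∈ fieldAlgebra ρ) :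
    F ∈ polynomialOps N ρ.numModes := by
  induction hF using Algebra.adjoin_induction with
  | mem F hF =>
    rcases hF with ⟨z, rfl⟩ | ⟨z, rfl⟩
    · exact const_mem_polynomialOps _
    · simpa using smul_mem_polynomialOps (MvPolynomial.X z : MvPolynomial (Fin N) ℂ)
        (1 : Op ρ.numModes)
  | algebraMap c => exact const_mem_polynomialOps (algebraMap ℂ (Op ρ.numModes) c)
  | add F G _ _ hF hG => exact add_mem hF hG
  | mul F G _ _ hF hG => exact mul_mem_polynomialOps hF hG

theorem exists_polynomial_vev {F : (Fin N → ℝ) → Op r} (hF : F ∈ polynomialOps N r) :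
    ∃ S : MvPolynomial (Fin N) ℂ, ∀ g : Fin N → ℝ,
      vev (F g) = MvPolynomial.eval (fun z => (g z : ℂ)) S := by
  induction hF using Submodule.span_induction with
  | mem F hF =>
    obtain ⟨⟨p, T⟩, rfl⟩ := hF
    exact ⟨MvPolynomial.C (vev T) * p, fun g => by
      simp [← vevₗ_apply, mul_comm]⟩
  | zero => exact ⟨0, fun g => by simp [← vevₗ_apply]⟩
  | add F G _ _ hF hG =>
    obtain ⟨S, hS⟩ := hF
    obtain ⟨S', hS'⟩ := hG
    exact ⟨S + S', fun g => by simp [← vevₗ_apply] at hS hS' ⊢; simp [hS, hS']⟩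
  | smul c F _ hF =>
    obtain ⟨S, hS⟩ := hF
    exact ⟨MvPolynomial.C c * S, fun g => by simp [← vevₗ_apply] at hS ⊢; simp [hS]⟩

/-- Time evolution shifts the field by a c-number multiple of `P'(φ z)`. -/
theorem fieldPhase_neg_mul_field_mul (P : ℝ[X]) (c : ℝ) (w z : Fin N) :
    fieldPhase ρ (-(Polynomial.C c * P)) z * field ρ w *
        fieldPhase ρ (Polynomial.C c * P) z =
      field ρ w + ((Δ w z : ℂ) * (c : ℂ)) •
        Polynomial.aeval (field ρ z) (P.derivative.map (algebraMap ℝ ℂ)) := by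
  have hP' := hasTemperateGrowth_ofReal (hasTemperateGrowth_eval (Polynomial.C c * P).derivative)
  have hph := phase_hasTemperateGrowth (Polynomial.C c * P)
  have h1 := commutator_field_fn ρ w z hph
    (((Function.HasTemperateGrowth.const (-Complex.I)).fun_mul hP').fun_mul hph)
    (phase_hasDerivAt (Polynomial.C c * P))
  rw [Diagonalization.fn_mul _ ((Function.HasTemperateGrowth.const (-Complex.I)).fun_mul hP') hph,
    Diagonalization.fn_const_mul _ _ hP', Diagonalization.fn_ofReal_eval] at h1
  set E := (fieldDiag ρ z).fn (phase (Polynomial.C c * P)) with hE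
  have hcomm : Commute E (Polynomial.aeval (field ρ z)
      ((Polynomial.C c * P).derivative.map (algebraMap ℝ ℂ))) := by
    rw [← Diagonalization.fn_ofReal_eval (fieldDiag ρ z), Commute, SemiconjBy, hE,
      ← Diagonalization.fn_mul _ hph hP', ← Diagonalization.fn_mul _ hP' hph]
    congr 1
    funext t
    ring
  have h2 : field ρ w * E = E * (field ρ w + (Complex.I * (Δ w z : ℂ)) •
      (-Complex.I • Polynomial.aeval (field ρ z)
        ((Polynomial.C c * P).derivative.map (algebraMap ℝ ℂ)))) := by
    rw [mul_add, mul_smul_comm, mul_smul_comm, hcomm.eq, ← smul_mul_assoc, ← h1]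
    abel
  have h3 : fieldPhase ρ (-(Polynomial.C c * P)) z * E = 1 :=
    (fieldDiag ρ z).fn_phase_neg_mul _
  rw [mul_assoc, show fieldPhase ρ (Polynomial.C c * P) z = E from rfl, h2, ← mul_assoc, h3,
    one_mul, smul_smul]
  congr 1
  rw [show Complex.I * (Δ w z : ℂ) * -Complex.I = (Δ w z : ℂ) by
    linear_combination -(Δ w z : ℂ) * Complex.I_sq]
  simp [Polynomial.derivative_mul, Algebra.smul_def, mul_assoc]

/-- Conjugation respects sums and products, so generators suffice: a field is shifted by a
polynomial in `φ_z` times the coupling, and couplings are central. -/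
theorem conj_mem_fieldAlgebra (P : ℝ[X]) (z : Fin N) {F : (Fin N → ℝ) → Op ρ.numModes}
    (hF : F ∈ fieldAlgebra ρ) :
    (fun g : Fin N → ℝ => fieldPhase ρ (-(Polynomial.C (g z) * P)) z * F g *
      fieldPhase ρ (Polynomial.C (g z) * P) z) ∈ fieldAlgebra ρ := by
  have hl : ∀ Q : ℝ[X], fieldPhase ρ (-Q) z * fieldPhase ρ Q z = 1 :=
    (fieldDiag ρ z).fn_phase_neg_mul
  have hr : ∀ Q : ℝ[X], fieldPhase ρ Q z * fieldPhase ρ (-Q) z = 1 :=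
    (fieldDiag ρ z).fn_phase_mul_neg
  induction hF using Algebra.adjoin_induction with
  | mem F hF =>
    rcases hF with ⟨w, rfl⟩ | ⟨w, rfl⟩
    · simp only [fieldPhase_neg_mul_field_mul]
      have h1 : (fun _ : Fin N → ℝ => Polynomial.aeval (field ρ z)
          (P.derivative.map (algebraMap ℝ ℂ))) ∈ fieldAlgebra ρ := by
        have h2 : (fun _ : Fin N → ℝ => Polynomial.aeval (field ρ z)
            (P.derivative.map (algebraMap ℝ ℂ))) = Polynomial.aeval
            (fun _ : Fin N → ℝ => field ρ z) (P.derivative.map (algebraMap ℝ ℂ)) := by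
          funext g
          exact Polynomial.aeval_algHom_apply (Pi.evalAlgHom ℂ (fun _ : Fin N → ℝ =>
            Op ρ.numModes) g) (fun _ => field ρ z) (P.derivative.map (algebraMap ℝ ℂ))
        rw [h2]
        exact Algebra.adjoin_le (Set.singleton_subset_iff.mpr (field_mem_fieldAlgebra ρ z))
          (Polynomial.aeval_mem_adjoin_singleton ℂ _)
      have h3 := add_mem (field_mem_fieldAlgebra ρ w) (Subalgebra.smul_mem _
        (mul_mem (coupling_mem_fieldAlgebra ρ z) h1) (Δ w z : ℂ))
      refine (congrArg (· ∈ fieldAlgebra ρ) (funext fun g => ?_)).mp h3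
      simp [mul_smul]
    · refine (congrArg (· ∈ fieldAlgebra ρ) (funext fun g => ?_)).mp
        (coupling_mem_fieldAlgebra ρ w)
      simp [hl]
  | algebraMap c =>
    refine (congrArg (· ∈ fieldAlgebra ρ) (funext fun g => ?_)).mp
      ((fieldAlgebra ρ).algebraMap_mem c)
    simp [Algebra.algebraMap_eq_smul_one, hl]
  | add F G _ _ hF hG =>
    refine (congrArg (· ∈ fieldAlgebra ρ) (funext fun g => ?_)).mp (add_mem hF hG)
    simp [mul_add, add_mul]
  | mul F G _ _ hF hG =>
    refine (congrArg (· ∈ fieldAlgebra ρ) (funext fun g => ?_)).mp (mul_mem hF hG)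
    simp only [Pi.mul_apply, mul_assoc]
    rw [← mul_assoc (fieldPhase ρ (Polynomial.C (g z) * P) z), hr, one_mul]

theorem conj_causalProd_mem_fieldAlgebra (P : Fin N → ℝ[X]) (s : Finset (Fin N))
    {F : (Fin N → ℝ) → Op ρ.numModes} (hF : F ∈ fieldAlgebra ρ) :
    (fun g : Fin N → ℝ => antiCausalProd s (fun z => fieldPhase ρ (-couple g P z) z) * F g *
      causalProd s (fun z => fieldPhase ρ (couple g P z) z)) ∈ fieldAlgebra ρ := by
  induction s using Finset.induction_on_max generalizing F with
  | empty => simpa [causalProd_empty, antiCausalProd_empty] using hF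
  | insert m s hm ih =>
    refine (congrArg (· ∈ fieldAlgebra ρ) (funext fun g => ?_)).mp
      (ih (conj_mem_fieldAlgebra ρ (P m) m hF))
    rw [causalProd_insert_max hm, antiCausalProd_insert_max hm]
    simp only [mul_assoc, couple]

theorem causalHeisenberg_mem_fieldAlgebra (C : Causet N) (P : Fin N → ℝ[X]) (x y : Fin N) :
    (fun g => causalHeisenberg ρ C (couple g P) x y) ∈ fieldAlgebra ρ := by
  have h : ∀ x, (fun g => heisenberg ρ C (couple g P) x) ∈ fieldAlgebra ρ := fun x => by
    simp only [heisenberg_def]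
    exact conj_causalProd_mem_fieldAlgebra ρ P _ (field_mem_fieldAlgebra ρ x)
  simp only [causalHeisenberg]
  split_ifs
  · exact mul_mem (h x) (h y)
  · exact mul_mem (h y) (h x)

theorem exists_polynomial_inIn (C : Causet N) (P : Fin N → ℝ[X]) (x y : Fin N) :
    ∃ S : MvPolynomial (Fin N) ℂ, ∀ g : Fin N → ℝ,
      inIn ρ C (couple g P) x y = MvPolynomial.eval (fun z => (g z : ℂ)) S :=
  exists_polynomial_vev (fieldAlgebra_le ρ (causalHeisenberg_mem_fieldAlgebra ρ C P x y))

end InIn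

end CausalSetQFT
end
noncomputable section
namespace CausalSetQFT
open MeasureTheory

/-! ### Fourier representation of the functional calculus -/

theorem schwartz_eq_integral_fourier (f : 𝓢(ℝ, ℂ)) (s : ℝ) :
    f s = ∫ τ : ℝ, 𝓕 f τ * Complex.exp ((2 * Real.pi * (τ * s) : ℝ) * Complex.I) := by
  have h : (𝓕⁻ (𝓕 f) : 𝓢(ℝ, ℂ)) s = f s := by rw [FourierTransform.fourierInv_fourier_eq]
  rw [← h, SchwartzMap.fourierInv_coe, Real.fourierInv_eq']
  refine integral_congr_ae (Filter.Eventually.of_forall fun τ => ?_)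
  simp only [RCLike.inner_apply, conj_trivial, smul_eq_mul]
  rw [mul_comm, mul_comm s τ]

theorem phase_linear (c t : ℝ) :
    phase (Polynomial.C (-c) * Polynomial.X) t = Complex.exp ((c * t : ℝ) * Complex.I) := by
  simp [phase]

/-- This is `f(H) = ∫ f̂(τ) exp(2πiτH) dτ` in the weak sense: Fourier inversion under the spectral
integral, then Fubini, which applies because `f̂` and the spectral density `G` are integrable. -/
theorem Diagonalization.inner_fn_schwartz {r : ℕ} {H : Op r} (D : Diagonalization H)
    (f : 𝓢(ℝ, ℂ)) (ψ χ : 𝓢(Modes r, ℂ)) :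
    inner ℂ (l2 ψ) (l2 (D.fn f χ)) = ∫ τ : ℝ, 𝓕 f τ * inner ℂ (l2 ψ)
      (l2 (D.fn (phase (Polynomial.C (-(2 * Real.pi * τ)) * Polynomial.X)) χ)) := by
  set G : Modes r → ℂ := fun q => conj (D.equiv ψ q) * D.equiv χ q with hG
  have hGi : Integrable G := by
    have hχ := (D.equiv χ).integrable (μ := volume)
    refine (hχ.bdd_mul (c := SchwartzMap.seminorm ℝ 0 0 (D.equiv ψ))
      (f := fun q => conj (D.equiv ψ q)) ?_ ?_)
    · exact (Complex.continuous_conj.comp (D.equiv ψ).continuous).aestronglyMeasurable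
    · refine Filter.Eventually.of_forall fun q => ?_
      rw [RCLike.norm_conj]
      exact SchwartzMap.norm_le_seminorm ℝ _ q
  have hspec : Continuous D.spec := D.spec_hasTemperateGrowth.1.continuous
  have h1 : ∀ τ : ℝ, 𝓕 f τ * inner ℂ (l2 ψ)
      (l2 (D.fn (phase (Polynomial.C (-(2 * Real.pi * τ)) * Polynomial.X)) χ)) =
      ∫ q, 𝓕 f τ * Complex.exp ((2 * Real.pi * (τ * D.spec q) : ℝ) * Complex.I) * G q := by
    intro τ
    rw [D.inner_fn (phase_hasTemperateGrowth _), ← integral_const_mul]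
    refine integral_congr_ae (Filter.Eventually.of_forall fun q => ?_)
    simp only [phase_linear, hG, mul_assoc]
  simp_rw [h1]
  rw [D.inner_fn f.hasTemperateGrowth, integral_integral_swap]
  · refine integral_congr_ae (Filter.Eventually.of_forall fun q => ?_)
    simp only
    rw [integral_mul_const, ← schwartz_eq_integral_fourier]
  · have h2 : Integrable (fun z : ℝ × Modes r => 𝓕 f z.1 * G z.2) (volume.prod volume) :=
      ((𝓕 f).integrable (μ := volume)).mul_prod hGi
    have h3 : AEStronglyMeasurable (fun z : ℝ × Modes r =>
        Complex.exp ((2 * Real.pi * (z.1 * D.spec z.2) : ℝ) * Complex.I))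
        (volume.prod volume) := by
      refine Continuous.aestronglyMeasurable ?_
      fun_prop
    refine (h2.bdd_mul (c := 1) h3 (Filter.Eventually.of_forall fun z => ?_)).congr
      (Filter.Eventually.of_forall fun z => ?_)
    · rw [Complex.norm_exp_ofReal_mul_I]
    · simp only [Function.uncurry]
      ring

theorem Diagonalization.vev_fn_schwartz {r : ℕ} {H : Op r} (D : Diagonalization H)
    (f : 𝓢(ℝ, ℂ)) {A B : Op r} (hA : HasAdjoint A) :
    vev (A * D.fn f * B) = ∫ τ : ℝ, 𝓕 f τ *
      vev (A * D.fn (phase (Polynomial.C (-(2 * Real.pi * τ)) * Polynomial.X)) * B) := by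
  obtain ⟨A', hA⟩ := hA
  have h : ∀ T : Op r, vev (A * T * B) =
      inner ℂ (l2 (A' (vacuum r))) (l2 (T (B (vacuum r)))) := fun T => by
    rw [vev_eq_inner, Module.End.mul_apply, Module.End.mul_apply, hA]
  simp only [h]
  exact D.inner_fn_schwartz f _ _

/-! ### The decoherence functional -/

section Decoherence

variable {N : ℕ} {Δ : Matrix (Fin N) (Fin N) ℝ} (ρ : GaussianState Δ)

/-- The coordinate direction of `ξ x` in the space of histories. -/
def historyDir (x : Fin N) : Histories N := EuclideanSpace.single (Sum.inl x) 1

/-- The factors of the forward branch at frequency `ν`. -/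
def forwardFactor (Q : Fin N → ℝ[X]) (ν : Histories N) (z : Fin N) : Op ρ.numModes :=
  fieldPhase ρ (Q z + Polynomial.C (-(2 * Real.pi * ν (Sum.inl z))) * Polynomial.X) z

/-- The backward branch at frequency `ν`. -/
def backwardOp (ν : Histories N) : Op ρ.numModes :=
  antiCausalProd Finset.univ fun z =>
    fieldPhase ρ (Polynomial.C (-(2 * Real.pi * ν (Sum.inr z))) * Polynomial.X) z

/-- The characteristic function of the decoherence functional, with the factors `exp (-i Q_x(φ x))`
inserted in the forward branch. -/
def charFun (Q : Fin N → ℝ[X]) (ν : Histories N) : ℂ :=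
  vev (backwardOp ρ ν * causalProd Finset.univ (forwardFactor ρ Q ν))

/-- The same with an additional factor `f(φ x)`. -/
def charFunInsert (Q : Fin N → ℝ[X]) (x : Fin N) (f : ℝ → ℂ) (ν : Histories N) : ℂ :=
  vev (backwardOp ρ ν * causalProd Finset.univ (Function.update (forwardFactor ρ Q ν) x
    ((fieldDiag ρ x).fn f * forwardFactor ρ Q ν x)))

theorem freeDecoherence_eq (f : Histories N → ℂ) :
    freeDecoherence ρ f = ∫ ν, charFun ρ 0 ν * 𝓕 f ν := by
  simp only [freeDecoherence, expNegI_smul_field, charFun, backwardOp]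
  unfold forwardFactor
  simp only [Pi.zero_apply, zero_add]

theorem charFun_zero (Q : Fin N → ℝ[X]) : charFun ρ Q 0 = vev (sOperator ρ Q) := by
  have h1 : ∀ s : Finset (Fin N),
      antiCausalProd s (fun z => fieldPhase ρ 0 z) = (1 : Op ρ.numModes) := fun s => by
    induction s using Finset.induction_on_max with
    | empty => exact antiCausalProd_empty _
    | insert m s hm ih => rw [antiCausalProd_insert_max hm, ih, fieldPhase_zero, one_mul]
  rw [charFun, sOperator_eq, backwardOp]
  unfold forwardFactor
  simp [h1]

theorem charFunInsert_phase (Q : Fin N → ℝ[X]) (x : Fin N) (R : ℝ[X]) (ν : Histories N) :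
    charFunInsert ρ Q x (phase R) ν = charFun ρ (Function.update Q x (R + Q x)) ν := by
  rw [charFunInsert, charFun]
  congr 3
  funext z
  by_cases h : z = x
  · subst h
    rw [Function.update_self, forwardFactor, forwardFactor, Function.update_self, add_assoc,
      fieldPhase_add ρ R]
    rfl
  · rw [Function.update_of_ne h, forwardFactor, forwardFactor, Function.update_of_ne h]

/-- The exponentials of one field combine, so a shift of the frequency dual to `ξ_x` is an extra
factor `exp(2πiτφ_x)` at the place of `x`. -/
theorem charFun_add_smul (Q : Fin N → ℝ[X]) (x : Fin N) (τ : ℝ) (ν : Histories N) :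
    charFun ρ Q (ν + τ • historyDir x) =
      charFunInsert ρ Q x (phase (Polynomial.C (-(2 * Real.pi * τ)) * Polynomial.X)) ν := by
  rw [charFunInsert, charFun]
  have h1 : backwardOp ρ (ν + τ • historyDir x) = backwardOp ρ ν := by
    simp [backwardOp, historyDir]
  rw [h1]
  congr 3
  funext z
  by_cases h : z = x
  · subst h
    rw [Function.update_self, forwardFactor, forwardFactor, ← fieldPhase, ← fieldPhase_add]
    congr 1
    simp only [historyDir, PiLp.add_apply, PiLp.smul_apply, PiLp.single_apply,
      if_true, smul_eq_mul, mul_one]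
    rw [add_left_comm, ← add_mul, ← Polynomial.C_add]
    congr 3
    ring
  · rw [Function.update_of_ne h, forwardFactor, forwardFactor]
    congr 4
    simp [historyDir, h]

/-- Inserting `f(φ_x)` is a superposition of inserted exponentials, hence of frequency shifts. -/
theorem charFunInsert_schwartz (Q : Fin N → ℝ[X]) (x : Fin N) (f : 𝓢(ℝ, ℂ)) (ν : Histories N) :
    charFunInsert ρ Q x f ν = ∫ τ : ℝ, 𝓕 f τ * charFun ρ Q (ν + τ • historyDir x) := by
  have h1 : HasAdjoint (backwardOp ρ ν * causalProd (Finset.univ \ Finset.Iic x)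
      (forwardFactor ρ Q ν)) := by
    refine HasAdjoint.mul ?_ (hasAdjoint_causalProd _ fun z _ => hasAdjoint_fieldPhase ρ _ z)
    have h2 : ∀ (s : Finset (Fin N)) (P : Fin N → ℝ[X]),
        HasAdjoint (antiCausalProd s fun z => fieldPhase ρ (P z) z) := fun s P => by
      induction s using Finset.induction_on_max with
      | empty => rw [antiCausalProd_empty]; exact HasAdjoint.one
      | insert m s hm ih =>
        rw [antiCausalProd_insert_max hm]; exact ih.mul (hasAdjoint_fieldPhase ρ _ m)
    exact h2 _ _
  have h3 := (fieldDiag ρ x).vev_fn_schwartz f h1 (B := forwardFactor ρ Q ν x *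
    causalProd (Finset.Iio x) (forwardFactor ρ Q ν))
  simp only [charFun_add_smul]
  simp only [charFunInsert, causalProd_update]
  simp only [mul_assoc] at h3 ⊢
  exact h3

/-! Bounds and continuity -/

theorem norm_l2_causalProd {r : ℕ} {T : Fin N → Op r} (hT : ∀ z ψ, ‖l2 (T z ψ)‖ = ‖l2 ψ‖)
    (s : Finset (Fin N)) (ψ : 𝓢(Modes r, ℂ)) : ‖l2 (causalProd s T ψ)‖ = ‖l2 ψ‖ := by
  induction s using Finset.induction_on_max with
  | empty => simp [causalProd_empty]
  | insert m s hm ih => rw [causalProd_insert_max hm, Module.End.mul_apply, hT, ih]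

theorem norm_l2_antiCausalProd {r : ℕ} {T : Fin N → Op r} (hT : ∀ z ψ, ‖l2 (T z ψ)‖ = ‖l2 ψ‖)
    (s : Finset (Fin N)) (ψ : 𝓢(Modes r, ℂ)) : ‖l2 (antiCausalProd s T ψ)‖ = ‖l2 ψ‖ := by
  induction s using Finset.induction_on_max generalizing ψ with
  | empty => simp [antiCausalProd_empty]
  | insert m s hm ih => rw [antiCausalProd_insert_max hm, Module.End.mul_apply, ih, hT]

theorem norm_l2_forwardFactor (Q : Fin N → ℝ[X]) (ν : Histories N) (z : Fin N)
    (ψ : 𝓢(Modes ρ.numModes, ℂ)) : ‖l2 (forwardFactor ρ Q ν z ψ)‖ = ‖l2 ψ‖ :=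
  norm_fieldPhase ρ _ z ψ

theorem norm_l2_backwardOp (ν : Histories N) (ψ : 𝓢(Modes ρ.numModes, ℂ)) :
    ‖l2 (backwardOp ρ ν ψ)‖ = ‖l2 ψ‖ :=
  norm_l2_antiCausalProd (fun z => norm_fieldPhase ρ _ z) _ ψ

theorem norm_vev_le {r : ℕ} (T : Op r) : ‖vev T‖ ≤ ‖l2 (T (vacuum r))‖ := by
  rw [vev_eq_inner]
  simpa [norm_l2_vacuum] using norm_inner_le_norm (𝕜 := ℂ) (l2 (vacuum r)) (l2 (T (vacuum r)))

theorem norm_charFun_le (Q : Fin N → ℝ[X]) (ν : Histories N) : ‖charFun ρ Q ν‖ ≤ 1 := by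
  refine (norm_vev_le _).trans (le_of_eq ?_)
  rw [Module.End.mul_apply, norm_l2_backwardOp,
    norm_l2_causalProd (norm_l2_forwardFactor ρ Q ν), norm_l2_vacuum]

theorem norm_charFunInsert_le (Q : Fin N → ℝ[X]) (x : Fin N) (f : ℝ → ℂ) (ν : Histories N) :
    ‖charFunInsert ρ Q x f ν‖ ≤ ‖l2 ((fieldDiag ρ x).fn f (forwardFactor ρ Q ν x
      (causalProd (Finset.Iio x) (forwardFactor ρ Q ν) (vacuum _))))‖ := by
  refine (norm_vev_le _).trans (le_of_eq ?_)
  rw [causalProd_update, Module.End.mul_apply, norm_l2_backwardOp, Module.End.mul_apply,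
    Module.End.mul_apply, Module.End.mul_apply, norm_l2_causalProd (norm_l2_forwardFactor ρ Q ν)]

theorem norm_l2_fn_le {r : ℕ} {A : Op r} (D : Diagonalization A) {f : ℝ → ℂ} {K : ℝ}
    (hf : f.HasTemperateGrowth) (hK : ∀ t, ‖f t‖ ≤ K) (ψ : 𝓢(Modes r, ℂ)) :
    ‖l2 (D.fn f ψ)‖ ≤ K * ‖l2 ψ‖ := by
  have hK0 : 0 ≤ K := (norm_nonneg _).trans (hK 0)
  have h := D.norm_fn_le hf (Function.HasTemperateGrowth.const (K : ℂ))
    (fun t => by simpa [abs_of_nonneg hK0] using hK t) ψ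
  rwa [D.fn_const, LinearMap.smul_apply, Module.End.one_apply, map_smul, norm_smul,
    Complex.norm_real, Real.norm_of_nonneg hK0] at h

theorem norm_charFunInsert_le_of_bound (Q : Fin N → ℝ[X]) (x : Fin N) {f : ℝ → ℂ} {K : ℝ}
    (hf : f.HasTemperateGrowth) (hK : ∀ t, ‖f t‖ ≤ K) (ν : Histories N) :
    ‖charFunInsert ρ Q x f ν‖ ≤ K := by
  refine (norm_charFunInsert_le ρ Q x f ν).trans ((norm_l2_fn_le _ hf hK _).trans (le_of_eq ?_))
  rw [norm_l2_forwardFactor, norm_l2_causalProd (norm_l2_forwardFactor ρ Q ν), norm_l2_vacuum,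
    mul_one]

theorem continuous_l2_map {X : Type*} [TopologicalSpace X] {r : ℕ} {Y : Op r} {K : ℝ}
    (hY : ∀ ψ, ‖l2 (Y ψ)‖ ≤ K * ‖l2 ψ‖) {u : X → 𝓢(Modes r, ℂ)}
    (hu : Continuous fun ν => l2 (u ν)) : Continuous fun ν => l2 (Y (u ν)) := by
  rw [continuous_iff_continuousAt] at hu ⊢
  intro ν
  have h1 := tendsto_iff_norm_sub_tendsto_zero.mp (hu ν)
  refine tendsto_iff_norm_sub_tendsto_zero.mpr (squeeze_zero (fun _ => norm_nonneg _)
    (fun ν' => ?_) (by simpa using h1.const_mul K))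
  rw [← map_sub, ← map_sub, ← map_sub]
  exact hY _

/-- The increment splits into a change of the vector, controlled by isometry, and a change of the
parameter, controlled by strong continuity of the evolution. -/
theorem continuous_l2_fieldPhase {X : Type*} [TopologicalSpace X] (P : ℝ[X]) (x : Fin N)
    {c : X → ℝ} (hc : Continuous c) {u : X → 𝓢(Modes ρ.numModes, ℂ)}
    (hu : Continuous fun ν => l2 (u ν)) :
    Continuous fun ν =>
      l2 (fieldPhase ρ (P + Polynomial.C (c ν) * Polynomial.X) x (u ν)) := by
  simp only [fieldPhase_add, Module.End.mul_apply]
  refine continuous_l2_map (K := 1) (Y := fieldPhase ρ P x)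
    (u := fun ν => fieldPhase ρ (Polynomial.C (c ν) * Polynomial.X) x (u ν))
    (fun ψ => by rw [norm_fieldPhase, one_mul]) ?_
  rw [continuous_iff_continuousAt]
  intro ν
  have h1 := tendsto_iff_norm_sub_tendsto_zero.mp (hu.continuousAt (x := ν))
  have h2 : Continuous fun s : ℝ =>
      l2 (fieldPhase ρ (Polynomial.C s * Polynomial.X) x (u ν)) :=
    continuous_iff_continuousAt.mpr fun s =>
      (((fieldDiag ρ x).isEvolution Polynomial.X).2 (u ν) s).continuousAt
  have h3 := tendsto_iff_norm_sub_tendsto_zero.mp ((h2.comp hc).continuousAt (x := ν))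
  refine tendsto_iff_norm_sub_tendsto_zero.mpr (squeeze_zero (fun _ => norm_nonneg _)
    (fun ν' => ?_) (by simpa using h1.add h3))
  have h4 : l2 (fieldPhase ρ (Polynomial.C (c ν') * Polynomial.X) x (u ν')) -
      l2 (fieldPhase ρ (Polynomial.C (c ν) * Polynomial.X) x (u ν)) =
      l2 (fieldPhase ρ (Polynomial.C (c ν') * Polynomial.X) x (u ν' - u ν)) +
      (l2 (fieldPhase ρ (Polynomial.C (c ν') * Polynomial.X) x (u ν)) -
        l2 (fieldPhase ρ (Polynomial.C (c ν) * Polynomial.X) x (u ν))) := by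
    simp
  refine (le_of_eq (congrArg norm h4)).trans ((norm_add_le _ _).trans ?_)
  rw [norm_fieldPhase, map_sub]

theorem continuous_l2_causalProd (Q : Fin N → ℝ[X]) (s : Finset (Fin N))
    {u : Histories N → 𝓢(Modes ρ.numModes, ℂ)} (hu : Continuous fun ν => l2 (u ν)) :
    Continuous fun ν => l2 (causalProd s (forwardFactor ρ Q ν) (u ν)) := by
  induction s using Finset.induction_on_max with
  | empty => simpa [causalProd_empty] using hu
  | insert m s hm ih =>
    simp only [causalProd_insert_max hm, Module.End.mul_apply]
    exact continuous_l2_fieldPhase ρ (Q m) m (c := fun ν => -(2 * Real.pi * ν (Sum.inl m)))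
      (by fun_prop) (u := fun ν => causalProd s (forwardFactor ρ Q ν) (u ν)) ih

theorem continuous_l2_backwardOp {u : Histories N → 𝓢(Modes ρ.numModes, ℂ)}
    (hu : Continuous fun ν => l2 (u ν)) : Continuous fun ν => l2 (backwardOp ρ ν (u ν)) := by
  have h : ∀ (s : Finset (Fin N)) (u : Histories N → 𝓢(Modes ρ.numModes, ℂ)),
      Continuous (fun ν => l2 (u ν)) → Continuous fun ν => l2 (antiCausalProd s (fun z =>
        fieldPhase ρ (Polynomial.C (-(2 * Real.pi * ν (Sum.inr z))) * Polynomial.X) z) (u ν)) := by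
    intro s
    induction s using Finset.induction_on_max with
    | empty => intro u hu; simpa [antiCausalProd_empty] using hu
    | insert m s hm ih =>
      intro u hu
      simp only [antiCausalProd_insert_max hm, Module.End.mul_apply]
      refine ih (fun ν => fieldPhase ρ (Polynomial.C (-(2 * Real.pi * ν (Sum.inr m))) *
        Polynomial.X) m (u ν)) ?_
      have := continuous_l2_fieldPhase ρ 0 m (c := fun ν : Histories N =>
        -(2 * Real.pi * ν (Sum.inr m))) (by fun_prop) hu
      simpa only [zero_add] using this
  exact h _ u hu

theorem continuous_charFun (Q : Fin N → ℝ[X]) : Continuous (charFun ρ Q) := by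
  unfold charFun
  simp only [vev_eq_inner, Module.End.mul_apply]
  exact continuous_const.inner (continuous_l2_backwardOp ρ
    (continuous_l2_causalProd ρ Q _ continuous_const))

theorem continuous_charFunInsert (Q : Fin N → ℝ[X]) (x : Fin N) {f : ℝ → ℂ} {K : ℝ}
    (hf : f.HasTemperateGrowth) (hK : ∀ t, ‖f t‖ ≤ K) :
    Continuous (charFunInsert ρ Q x f) := by
  have h1 : Continuous fun ν => l2 (causalProd (Finset.Iio x) (forwardFactor ρ Q ν)
      (vacuum ρ.numModes)) := continuous_l2_causalProd ρ Q _ continuous_const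
  have h2 : Continuous fun ν => l2 (forwardFactor ρ Q ν x
      (causalProd (Finset.Iio x) (forwardFactor ρ Q ν) (vacuum ρ.numModes))) :=
    continuous_l2_fieldPhase ρ (Q x) x (c := fun ν => -(2 * Real.pi * ν (Sum.inl x)))
      (by fun_prop) (u := fun ν => causalProd (Finset.Iio x) (forwardFactor ρ Q ν)
        (vacuum ρ.numModes)) h1
  have h3 : Continuous fun ν => l2 ((fieldDiag ρ x).fn f (forwardFactor ρ Q ν x
      (causalProd (Finset.Iio x) (forwardFactor ρ Q ν) (vacuum ρ.numModes)))) :=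
    continuous_l2_map (norm_l2_fn_le (fieldDiag ρ x) hf hK) h2
  have h4 := continuous_l2_backwardOp ρ
    (continuous_l2_causalProd ρ Q (Finset.univ \ Finset.Iic x) h3)
  refine (continuous_const.inner h4 : Continuous fun ν => inner ℂ (l2 (vacuum ρ.numModes)) _).congr
    fun ν => ?_
  rw [charFunInsert, causalProd_update, vev_eq_inner]
  rfl

end Decoherence

end CausalSetQFT
end
noncomputable section
namespace CausalSetQFT
open MeasureTheory

/-! ### Cut-offs and convergence of the oscillatory integrals -/

theorem exists_schwartz_eq_one (E : Type*) [NormedAddCommGroup E] [InnerProductSpace ℝ E]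
    [FiniteDimensional ℝ E] : ∃ g : 𝓢(E, ℂ), g 0 = 1 := by
  let b : ContDiffBump (0 : E) := ⟨1, 2, one_pos, one_lt_two⟩
  have h1 : HasCompactSupport fun t => ((b t : ℝ) : ℂ) :=
    b.hasCompactSupport.comp_left Complex.ofReal_zero
  have h2 : ContDiff ℝ (⊤ : ℕ∞) fun t => ((b t : ℝ) : ℂ) :=
    Complex.ofRealCLM.contDiff.comp b.contDiff
  refine ⟨h1.toSchwartzMap h2, ?_⟩
  have h3 : b 0 = 1 := b.one_of_mem_closedBall (Metric.mem_closedBall_self zero_le_one)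
  change ((b 0 : ℝ) : ℂ) = 1
  rw [h3, Complex.ofReal_one]

/-- These are dilations of one bump. The uniform bound serves dominated convergence; the error,
linear in `|t|`, serves strong convergence, since `|φ_x|` is finite on Schwartz vectors. -/
theorem exists_schwartz_cutoff : ∃ (χ : ℕ → 𝓢(ℝ, ℂ)) (K C : ℝ), (∀ n t, ‖χ n t‖ ≤ K) ∧
    ∀ n t, ‖χ n t - 1‖ ≤ C / (n + 1) * |t| := by
  obtain ⟨χ, hχ⟩ := exists_schwartz_eq_one ℝ
  let S : ℕ → ℝ ≃L[ℝ] ℝ := fun n =>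
    ContinuousLinearEquiv.unitsEquivAut ℝ (Units.mk0 ((n + 1 : ℝ)⁻¹) (by positivity))
  have hS : ∀ n t, S n t = t * (n + 1 : ℝ)⁻¹ := fun n t => rfl
  refine ⟨fun n => SchwartzMap.compCLMOfContinuousLinearEquiv ℂ (S n) χ,
    SchwartzMap.seminorm ℝ 0 0 χ, SchwartzMap.seminorm ℝ 0 1 χ,
    fun n t => SchwartzMap.norm_le_seminorm ℝ χ _, fun n t => ?_⟩
  have h1 : ∀ s, ‖χ s - 1‖ ≤ SchwartzMap.seminorm ℝ 0 1 χ * |s| := fun s => by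
    have h2 := convex_univ.norm_image_sub_le_of_norm_deriv_le (f := χ) (𝕜 := ℝ)
      (C := SchwartzMap.seminorm ℝ 0 1 χ) (x := 0) (y := s)
      (fun t _ => χ.differentiableAt) (fun t _ => ?_) (Set.mem_univ _) (Set.mem_univ _)
    · simpa [hχ] using h2
    · simpa using χ.le_seminorm' ℝ 0 1 t
  have h2 := h1 (S n t)
  rw [hS, abs_mul, abs_of_nonneg (by positivity : (0 : ℝ) ≤ (n + 1 : ℝ)⁻¹)] at h2
  refine h2.trans (le_of_eq ?_)
  field_simp

section Decoherence

variable {N : ℕ} {Δ : Matrix (Fin N) (Fin N) ℝ} (ρ : GaussianState Δ)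

theorem inner_historyDir (x : Fin N) (p : Histories N) :
    inner ℝ p (historyDir x) = p (Sum.inl x) := by
  simp [historyDir, EuclideanSpace.inner_single_right]

theorem hasTemperateGrowth_comp_coord {f : ℝ → ℂ} (hf : f.HasTemperateGrowth) (x : Fin N) :
    (fun p : Histories N => f (p (Sum.inl x))).HasTemperateGrowth :=
  hf.comp (EuclideanSpace.proj (Sum.inl x) : Histories N →L[ℝ] ℝ).hasTemperateGrowth

/-- A product with a function of one coordinate is a convolution in the corresponding frequency. -/
theorem fourier_coord_mul (f : 𝓢(ℝ, ℂ)) (g : 𝓢(Histories N, ℂ)) (x : Fin N) (ν : Histories N) :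
    𝓕 (fun p : Histories N => f (p (Sum.inl x)) * g p) ν =
      ∫ τ : ℝ, 𝓕 f τ * 𝓕 g (ν - τ • historyDir x) := by
  have h1 : ∀ τ : ℝ, 𝓕 f τ * 𝓕 g (ν - τ • historyDir x) =
      ∫ p : Histories N, 𝓕 f τ * Complex.exp ((2 * Real.pi * (τ * p (Sum.inl x)) : ℝ) *
        Complex.I) * (Complex.exp ((-2 * Real.pi * inner ℝ p ν : ℝ) * Complex.I) * g p) := by
    intro τ
    rw [SchwartzMap.fourier_coe g, Real.fourier_eq', ← integral_const_mul]
    refine integral_congr_ae (Filter.Eventually.of_forall fun p => ?_)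
    simp only [inner_sub_right, inner_smul_right, inner_historyDir, smul_eq_mul]
    rw [mul_assoc (𝓕 f τ), ← mul_assoc (Complex.exp _) (Complex.exp _), ← Complex.exp_add]
    congr 3
    push_cast
    ring
  simp_rw [h1]
  rw [Real.fourier_eq', integral_integral_swap]
  · refine integral_congr_ae (Filter.Eventually.of_forall fun p => ?_)
    simp only
    rw [integral_mul_const, ← schwartz_eq_integral_fourier, smul_eq_mul]
    ring
  · have h2 : Integrable (fun z : ℝ × Histories N => 𝓕 f z.1 * g z.2) (volume.prod volume) :=
      ((𝓕 f).integrable (μ := volume)).mul_prod (g.integrable (μ := volume))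
    have h3 : AEStronglyMeasurable (fun z : ℝ × Histories N =>
        Complex.exp ((2 * Real.pi * (z.1 * z.2 (Sum.inl x)) + -2 * Real.pi * inner ℝ z.2 ν : ℝ) *
          Complex.I)) (volume.prod volume) := by
      refine Continuous.aestronglyMeasurable ?_
      fun_prop
    refine (h2.bdd_mul (c := 1) h3 (Filter.Eventually.of_forall fun z => ?_)).congr
      (Filter.Eventually.of_forall fun z => ?_)
    · rw [Complex.norm_exp_ofReal_mul_I]
    · simp only [Function.uncurry, Complex.ofReal_add, add_mul, Complex.exp_add]
      ring

/-- Translation invariance of the frequency integral moves the shift from `𝓕 g` to the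
characteristic function, where it becomes an operator insertion. Both uses of Fubini rest on
`‖charFun‖ ≤ 1` and integrability of `𝓕 f` and `𝓕 g`. -/
theorem integral_charFun_coord_mul (Q : Fin N → ℝ[X]) (x : Fin N) (f : 𝓢(ℝ, ℂ))
    (g : 𝓢(Histories N, ℂ)) :
    ∫ ν, charFun ρ Q ν * 𝓕 (fun p : Histories N => f (p (Sum.inl x)) * g p) ν =
      ∫ ν, charFunInsert ρ Q x f ν * 𝓕 g ν := by
  have hc := continuous_charFun ρ Q
  have hcf := (𝓕 f).continuous
  have hcg := (𝓕 g).continuous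
  have hi := ((𝓕 f).integrable (μ := volume)).mul_prod ((𝓕 g).integrable (μ := volume))
  have e1 : ∀ ν, charFun ρ Q ν * 𝓕 (fun p : Histories N => f (p (Sum.inl x)) * g p) ν =
      ∫ τ : ℝ, charFun ρ Q ν * (𝓕 f τ * 𝓕 g (ν - τ • historyDir x)) := fun ν => by
    rw [fourier_coord_mul, integral_const_mul]
  have e2 : ∀ ν, charFunInsert ρ Q x f ν * 𝓕 g ν =
      ∫ τ : ℝ, charFun ρ Q (ν + τ • historyDir x) * (𝓕 f τ * 𝓕 g ν) := fun ν => by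
    rw [charFunInsert_schwartz, ← integral_mul_const]
    refine integral_congr_ae (Filter.Eventually.of_forall fun τ => ?_)
    simp only
    ring
  simp_rw [e1, e2]
  rw [integral_integral_swap (f := fun (ν : Histories N) (τ : ℝ) =>
      charFun ρ Q ν * (𝓕 f τ * 𝓕 g (ν - τ • historyDir x))) ?_,
    integral_integral_swap (f := fun (ν : Histories N) (τ : ℝ) =>
      charFun ρ Q (ν + τ • historyDir x) * (𝓕 f τ * 𝓕 g ν)) ?_]
  · refine integral_congr_ae (Filter.Eventually.of_forall fun τ => ?_)
    simp only
    rw [← integral_add_right_eq_self (fun ν : Histories N =>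
      charFun ρ Q ν * (𝓕 f τ * 𝓕 g (ν - τ • historyDir x))) (τ • historyDir x)]
    simp only [add_sub_cancel_right]
  · have h3 : AEStronglyMeasurable (fun z : Histories N × ℝ =>
        charFun ρ Q (z.1 + z.2 • historyDir x)) (volume.prod volume) := by
      refine Continuous.aestronglyMeasurable (hc.comp ?_)
      fun_prop
    exact Integrable.bdd_mul (c := 1) (g := fun z : Histories N × ℝ => 𝓕 f z.2 * 𝓕 g z.1)
      hi.swap h3 (Filter.Eventually.of_forall fun z => norm_charFun_le ρ Q _)
  · have h3 : Continuous (fun z : Histories N × ℝ => charFun ρ Q z.1 *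
        (𝓕 f z.2 * 𝓕 g (z.1 - z.2 • historyDir x))) := by
      refine (hc.comp continuous_fst).mul ((hcf.comp continuous_snd).mul (hcg.comp ?_))
      fun_prop
    have h4 : Integrable (fun z : Histories N × ℝ => 𝓕 f z.2 * 𝓕 g (z.1 - z.2 • historyDir x))
        (volume.prod volume) := by
      refine (integrable_prod_iff' (Continuous.aestronglyMeasurable ?_)).mpr
        ⟨Filter.Eventually.of_forall fun τ => ?_, ?_⟩
      · refine (hcf.comp continuous_snd).mul (hcg.comp ?_)
        fun_prop
      · exact (((𝓕 g).integrable (μ := volume)).comp_sub_right (τ • historyDir x)).const_mul (𝓕 f τ)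
      · have h5 : ∀ τ : ℝ, ∫ ν : Histories N, ‖𝓕 f τ * 𝓕 g (ν - τ • historyDir x)‖ =
            ‖𝓕 f τ‖ * ∫ ν : Histories N, ‖𝓕 g ν‖ := fun τ => by
          simp_rw [norm_mul]
          rw [integral_const_mul, integral_sub_right_eq_self (fun ν => ‖𝓕 g ν‖)]
        simp only [h5]
        exact ((𝓕 f).integrable (μ := volume)).norm.mul_const _
    exact h4.bdd_mul (c := 1) (hc.comp continuous_fst).aestronglyMeasurable
      (Filter.Eventually.of_forall fun z => norm_charFun_le ρ Q _)

/-- For each frequency the insertions differ by at most `C/(n+1)` times the norm of `φ_x` on a fixed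
Schwartz vector; the uniform bound `K` gives domination. -/
theorem tendsto_integral_charFunInsert (Q : Fin N → ℝ[X]) (x : Fin N) {F : ℕ → ℝ → ℂ}
    {f : ℝ → ℂ} {K C : ℝ} (hF : ∀ n, (F n).HasTemperateGrowth) (hf : f.HasTemperateGrowth)
    (hK : ∀ n t, ‖F n t‖ ≤ K) (hC : ∀ n t, ‖F n t - f t‖ ≤ C / (n + 1) * |t|)
    (g : 𝓢(Histories N, ℂ)) :
    Filter.Tendsto (fun n => ∫ ν, charFunInsert ρ Q x (F n) ν * g ν) Filter.atTop
      (nhds (∫ ν, charFunInsert ρ Q x f ν * g ν)) := by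
  have hC0 : 0 ≤ C := by
    have := (norm_nonneg _).trans (hC 0 1)
    simpa using this
  refine tendsto_integral_of_dominated_convergence (fun ν => K * ‖g ν‖) (fun n => ?_)
    ((g.integrable (μ := volume)).norm.const_mul K) (fun n => ?_) ?_
  · exact ((continuous_charFunInsert ρ Q x (hF n) (hK n)).mul g.continuous).aestronglyMeasurable
  · refine Filter.Eventually.of_forall fun ν => ?_
    rw [norm_mul]
    gcongr
    exact norm_charFunInsert_le_of_bound ρ Q x (hF n) (hK n) ν
  · refine Filter.Eventually.of_forall fun ν => Filter.Tendsto.mul_const _ ?_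
    set χ := forwardFactor ρ Q ν x
      (causalProd (Finset.Iio x) (forwardFactor ρ Q ν) (vacuum _)) with hχ
    have h1 : ∀ n, ‖charFunInsert ρ Q x (F n) ν - charFunInsert ρ Q x f ν‖ ≤
        C / (n + 1) * ‖l2 (field ρ x χ)‖ := fun n => by
      have h2 : charFunInsert ρ Q x (F n) ν - charFunInsert ρ Q x f ν =
          charFunInsert ρ Q x (fun t => F n t - f t) ν := by
        simp only [charFunInsert, causalProd_update, ← vevₗ_apply]
        rw [← map_sub, Diagonalization.fn_sub _ (hF n) hf]
        simp only [sub_mul, mul_sub]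
      rw [h2]
      refine (norm_charFunInsert_le ρ Q x _ ν).trans ?_
      have h3 := (fieldDiag ρ x).norm_fn_le ((hF n).fun_sub hf)
        ((Function.HasTemperateGrowth.const ((C / (n + 1) : ℝ) : ℂ) (E := ℝ)).fun_mul
          (by fun_prop : Function.HasTemperateGrowth (fun t : ℝ => (t : ℂ)))) (fun t => ?_) χ
      · refine h3.trans (le_of_eq ?_)
        rw [Diagonalization.fn_const_mul _ _ (by fun_prop), Diagonalization.fn_id,
          LinearMap.smul_apply, map_smul, norm_smul, Complex.norm_real,
          Real.norm_of_nonneg (by positivity)]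
      · rw [norm_mul, Complex.norm_real, Complex.norm_real, Real.norm_of_nonneg (by positivity),
          Real.norm_eq_abs]
        exact hC n t
    refine tendsto_iff_norm_sub_tendsto_zero.mpr (squeeze_zero (fun _ => norm_nonneg _) h1 ?_)
    have h4 := (tendsto_const_div_atTop_nhds_zero_nat C).comp (Filter.tendsto_add_atTop_nat 1)
    simpa using h4.mul_const ‖l2 (field ρ x χ)‖

/-- The phase is not a Schwartz function, so the case already treated is applied to `χ_n` with test
function `phase R · g` and to `χ_n · phase R` with test function `g`. Both describe the same
integrals; the limits `n → ∞` are the two sides. -/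
theorem integral_charFun_phase_mul (Q : Fin N → ℝ[X]) (x : Fin N) (R : ℝ[X])
    (g : 𝓢(Histories N, ℂ)) :
    ∫ ν, charFun ρ Q ν * 𝓕 (fun p : Histories N => phase R (p (Sum.inl x)) * g p) ν =
      ∫ ν, charFun ρ (Function.update Q x (R + Q x)) ν * 𝓕 g ν := by
  obtain ⟨χ, K, C, hK, hC⟩ := exists_schwartz_cutoff
  have hph := phase_hasTemperateGrowth R
  have hph' := hasTemperateGrowth_comp_coord hph x
  let h : 𝓢(Histories N, ℂ) :=
    SchwartzMap.smulLeftCLM ℂ (fun p : Histories N => phase R (p (Sum.inl x))) g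
  let F : ℕ → 𝓢(ℝ, ℂ) := fun n => SchwartzMap.smulLeftCLM ℂ (phase R) (χ n)
  have hh : ∀ p, h p = phase R (p (Sum.inl x)) * g p := fun p =>
    SchwartzMap.smulLeftCLM_apply_apply hph' g p
  have hF : ∀ n t, F n t = phase R t * χ n t := fun n t =>
    SchwartzMap.smulLeftCLM_apply_apply hph (χ n) t
  have e1 : ∀ n, ∫ ν, charFunInsert ρ Q x (χ n) ν * 𝓕 h ν =
      ∫ ν, charFunInsert ρ Q x (F n) ν * 𝓕 g ν := fun n => by
    rw [← integral_charFun_coord_mul, ← integral_charFun_coord_mul]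
    congr 3
    funext ν
    congr 1
    refine congrArg (fun G : Histories N → ℂ => 𝓕 G ν) (funext fun p => ?_)
    rw [hh, hF]
    ring
  have t1 := tendsto_integral_charFunInsert ρ Q x (fun n => (χ n).hasTemperateGrowth)
    (phase_hasTemperateGrowth 0) hK (fun n t => by simpa [phase_zero] using hC n t) (𝓕 h)
  have t2 := tendsto_integral_charFunInsert ρ Q x (fun n => (F n).hasTemperateGrowth)
    hph (K := K) (fun n t => by rw [hF, norm_mul, norm_phase, one_mul]; exact hK n t)
    (fun n t => by
      rw [hF, ← mul_sub_one, norm_mul, norm_phase, one_mul]; exact hC n t) (𝓕 g)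
  simp only [e1] at t1
  have h2 := tendsto_nhds_unique t1 t2
  simp only [charFunInsert_phase, zero_add, Function.update_eq_self] at h2
  rw [← h2, SchwartzMap.fourier_coe h, show (h : Histories N → ℂ) = _ from funext hh]

theorem inOutWeight_eq (P : Fin N → ℝ[X]) (p : Histories N) :
    inOutWeight P p = ∏ x, phase (P x) (p (Sum.inl x)) := by
  simp only [inOutWeight, interactionPotential, phase, ← Complex.exp_sum]
  congr 1
  push_cast
  rw [← Finset.sum_mul, Finset.sum_neg_distrib]
  ring

/-- The phases are transferred one element at a time, each absorbed meanwhile into the test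
function, which is why `g` varies in the induction. -/
theorem freeDecoherence_weight_mul (P : Fin N → ℝ[X]) (g : 𝓢(Histories N, ℂ)) :
    freeDecoherence ρ (fun p => inOutWeight P p * g p) = ∫ ν, charFun ρ P ν * 𝓕 g ν := by
  have h : ∀ (s : Finset (Fin N)) (g : 𝓢(Histories N, ℂ)),
      ∫ ν, charFun ρ 0 ν * 𝓕 (fun p : Histories N =>
        (∏ x ∈ s, phase (P x) (p (Sum.inl x))) * g p) ν =
      ∫ ν, charFun ρ (fun x => if x ∈ s then P x else 0) ν * 𝓕 g ν := by
    intro s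
    induction s using Finset.induction_on with
    | empty =>
      intro g
      simp only [Finset.prod_empty, one_mul, Finset.notMem_empty, if_false]
      rfl
    | insert a s ha ih =>
      intro g
      have hph := hasTemperateGrowth_comp_coord (phase_hasTemperateGrowth (P a)) a
      have h1 := ih (SchwartzMap.smulLeftCLM ℂ (fun p : Histories N =>
        phase (P a) (p (Sum.inl a))) g)
      rw [SchwartzMap.fourier_coe, show (SchwartzMap.smulLeftCLM ℂ (fun p : Histories N =>
        phase (P a) (p (Sum.inl a))) g : Histories N → ℂ) = _ from
        funext (SchwartzMap.smulLeftCLM_apply_apply hph g)] at h1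
      simp only [smul_eq_mul] at h1
      rw [integral_charFun_phase_mul] at h1
      have e : Function.update (fun x => if x ∈ s then P x else 0) a
          (P a + if a ∈ s then P a else 0) = fun x => if x ∈ insert a s then P x else 0 := by
        funext z
        by_cases hz : z = a
        · subst hz; simp [ha]
        · simp [hz]
      rw [e] at h1
      rw [← h1]
      congr 3
      funext ν
      congr 1
      refine congrArg (fun G : Histories N → ℂ => 𝓕 G ν) (funext fun p => ?_)
      rw [Finset.prod_insert ha]
      ring
  rw [freeDecoherence_eq]
  simp only [inOutWeight_eq]
  simpa using h Finset.univ g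

theorem integral_charFun_fourier_scale (P : Fin N → ℝ[X]) (g : 𝓢(Histories N, ℂ)) {ε : ℝ}
    (hε : 0 < ε) :
    ∫ ν, charFun ρ P ν * 𝓕 (fun p : Histories N => g (ε • p)) ν =
      ∫ ν, charFun ρ P (ε • ν) * 𝓕 g ν := by
  have h1 : ∀ ν, 𝓕 (fun p : Histories N => g (ε • p)) ν =
      |(ε ^ Module.finrank ℝ (Histories N))⁻¹| • 𝓕 g (ε⁻¹ • ν) := fun ν => by
    rw [SchwartzMap.fourier_coe, Real.fourier_eq', Real.fourier_eq', ← Measure.integral_comp_smul]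
    refine integral_congr_ae (Filter.Eventually.of_forall fun p => ?_)
    simp only [inner_smul_left, inner_smul_right, conj_trivial]
    rw [inv_mul_cancel_left₀ hε.ne']
  have h2 := Measure.integral_comp_smul (volume : Measure (Histories N))
    (fun ν => charFun ρ P ν * 𝓕 g (ε⁻¹ • ν)) ε
  simp only [smul_smul, inv_mul_cancel₀ hε.ne', one_smul] at h2
  rw [h2, ← integral_smul]
  refine integral_congr_ae (Filter.Eventually.of_forall fun ν => ?_)
  simp only [h1, mul_smul_comm]

theorem integral_fourier_eq (g : 𝓢(Histories N, ℂ)) : ∫ ν, 𝓕 g ν = g 0 := by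
  have h : (𝓕⁻ (𝓕 g) : 𝓢(Histories N, ℂ)) 0 = g 0 := by
    rw [FourierTransform.fourierInv_fourier_eq]
  rw [← h, SchwartzMap.fourierInv_coe, Real.fourierInv_eq']
  simp

/-- The oscillatory integral of `exp (-i V_int)` converges to `⟨Ŝ⟩`. -/
theorem hasDecoherenceIntegral_inOutWeight (P : Fin N → ℝ[X]) :
    HasDecoherenceIntegral ρ (inOutWeight P) (vev (sOperator ρ P)) := by
  intro g hg
  have h1 : ∀ ε : ℝ, 0 < ε → freeDecoherence ρ (fun p => inOutWeight P p * g (ε • p)) =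
      ∫ ν, charFun ρ P (ε • ν) * 𝓕 g ν := fun ε hε => by
    let S : Histories N ≃L[ℝ] Histories N :=
      ContinuousLinearEquiv.smulLeft (Units.mk0 ε hε.ne')
    rw [← integral_charFun_fourier_scale ρ P g hε]
    exact freeDecoherence_weight_mul ρ P (SchwartzMap.compCLMOfContinuousLinearEquiv ℂ S g)
  -- The scaling has moved from the cut-off to the characteristic function. This is bounded by 1 and
  -- continuous at `0`, and `∫ 𝓕 g = g 0 = 1`, so the limit does not depend on `g`.
  have h2 : Filter.Tendsto (fun ε : ℝ => ∫ ν, charFun ρ P (ε • ν) * 𝓕 g ν) (nhds 0)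
      (nhds (∫ ν, charFun ρ P 0 * 𝓕 g ν)) := by
    refine tendsto_integral_filter_of_dominated_convergence (fun ν => ‖𝓕 g ν‖)
      (Filter.Eventually.of_forall fun ε => ?_) (Filter.Eventually.of_forall fun ε =>
        Filter.Eventually.of_forall fun ν => ?_) ((𝓕 g).integrable (μ := volume)).norm
      (Filter.Eventually.of_forall fun ν => ?_)
    · exact (((continuous_charFun ρ P).comp (continuous_const_smul ε)).mul
        (𝓕 g).continuous).aestronglyMeasurable
    · rw [norm_mul]
      exact mul_le_of_le_one_left (norm_nonneg _) (norm_charFun_le ρ P _)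
    · refine Filter.Tendsto.mul_const _ ?_
      have h3 : Continuous fun ε : ℝ => charFun ρ P (ε • ν) :=
        (continuous_charFun ρ P).comp (by fun_prop)
      simpa using h3.tendsto 0
  rw [integral_const_mul, integral_fourier_eq, hg, mul_one, charFun_zero] at h2
  refine (h2.mono_left nhdsWithin_le_nhds).congr' ?_
  filter_upwards [self_mem_nhdsWithin] with ε hε
  exact (h1 ε hε).symm

theorem HasDecoherenceIntegral.unique {F : Histories N → ℂ} {v w : ℂ}
    (hv : HasDecoherenceIntegral ρ F v) (hw : HasDecoherenceIntegral ρ F w) : v = w := by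
  obtain ⟨g, hg⟩ := exists_schwartz_eq_one (Histories N)
  exact tendsto_nhds_unique (hv g hg) (hw g hg)

theorem HasDecoherenceIntegral.decoherenceIntegral_eq {F : Histories N → ℂ} {v : ℂ}
    (hv : HasDecoherenceIntegral ρ F v) : decoherenceIntegral ρ F = v := by
  have hex : ∃ v, HasDecoherenceIntegral ρ F v := ⟨v, hv⟩
  rw [decoherenceIntegral, dif_pos hex]
  exact HasDecoherenceIntegral.unique ρ hex.choose_spec hv

/-- A source is a linear term in the interaction, so convergence for every `J` needs no separate
argument. -/
theorem inOutWeight_mul_sourceFactor (P : Fin N → ℝ[X]) (J : Fin N → ℝ) :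
    (fun p => inOutWeight P p * sourceFactor J p) = inOutWeight (withSource P J) := by
  funext p
  simp only [inOutWeight, sourceFactor, ← Complex.exp_add, interactionPotential, withSource]
  congr 1
  simp [Finset.sum_add_distrib]
  ring

theorem inOutZ_eq (P : Fin N → ℝ[X]) (J : Fin N → ℝ) :
    inOutZ ρ P J = vev (sOperator ρ (withSource P J)) / vev (sOperator ρ P) := by
  rw [inOutZ, inOutWeight_mul_sourceFactor,
    (hasDecoherenceIntegral_inOutWeight ρ _).decoherenceIntegral_eq,
    (hasDecoherenceIntegral_inOutWeight ρ P).decoherenceIntegral_eq]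

/-! ### Derivatives of the generating functional -/

theorem hasLineDerivAt_inOutZ (P : Fin N → ℝ[X]) (J : Fin N → ℝ) (y : Fin N) :
    HasLineDerivAt ℝ (inOutZ ρ P) (-Complex.I * vev (causalProd Finset.univ (Function.update
        (fun z => fieldPhase ρ (withSource P J z) z) y
        (fieldPhase ρ (withSource P J y) y * field ρ y))) / vev (sOperator ρ P)) J
      (Pi.single y 1) := by
  have h := hasLineDerivAt_vev_sOperator ρ P J y
  rw [show inOutZ ρ P = _ from funext (inOutZ_eq ρ P)]
  exact HasDerivAt.div_const h _

theorem iPartial_inOutZ (P : Fin N → ℝ[X]) (y : Fin N) :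
    iPartial y (inOutZ ρ P) = fun J => vev (causalProd Finset.univ (Function.update
        (fun z => fieldPhase ρ (withSource P J z) z) y
        (fieldPhase ρ (withSource P J y) y * field ρ y))) / vev (sOperator ρ P) := by
  funext J
  rw [iPartial, (hasLineDerivAt_inOutZ ρ P J y).lineDeriv, mul_div_assoc, ← mul_assoc]
  simp

end Decoherence

theorem hasLineDerivAt_iPartial_inOutZ {N : ℕ} {C : Causet N} {ΔR : Matrix (Fin N) (Fin N) ℝ}
    (hR : IsRetarded C ΔR) (ρ : GaussianState (pauliJordan ΔR)) (P : Fin N → ℝ[X])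
    (x y : Fin N) :
    HasLineDerivAt ℝ (iPartial y (inOutZ ρ P)) (-Complex.I *
      vev (sOperator ρ P * causalHeisenberg ρ C P x y) / vev (sOperator ρ P)) 0
      (Pi.single x 1) := by
  have h := hasLineDerivAt_vev_insertion ρ P x y
  rw [iPartial_inOutZ]
  have e : sOperator ρ P * causalHeisenberg ρ C P x y = if x = y then
        causalProd Finset.univ (Function.update (fun z => fieldPhase ρ (P z) z) x
          (fieldPhase ρ (P x) x * (field ρ x * field ρ x)))
        else causalProd Finset.univ (Function.update (Function.update
          (fun z => fieldPhase ρ (P z) z) y (fieldPhase ρ (P y) y * field ρ y)) x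
          (fieldPhase ρ (P x) x * field ρ x)) := by
    split_ifs with hxy
    · subst hxy; exact sOperator_mul_causalHeisenberg_self ρ P hR x
    · exact sOperator_mul_causalHeisenberg_of_ne ρ P hR hxy
  rw [e]
  exact HasDerivAt.div_const h _

end CausalSetQFT
end
noncomputable section
namespace CausalSetQFT
open MeasureTheory

/-! ### Asymptotic expansions -/

section Expansion

open Asymptotics Filter Topology

/-- A polynomial of one variable that is `O(t ^ n)` at zero has no coefficients below `n`. -/
theorem coeff_eq_zero_of_isBigO {n : ℕ} {p : ℂ[X]}
    (h : (fun t : ℝ => p.eval (t : ℂ)) =O[𝓝[≠] 0] fun t : ℝ => t ^ n) {k : ℕ} (hk : k < n) :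
    p.coeff k = 0 := by
  induction n generalizing p k with
  | zero => omega
  | succ n ih =>
    have h0 : p.coeff 0 = 0 := by
      have hc : Tendsto (fun t : ℝ => p.eval (t : ℂ)) (𝓝[≠] 0) (𝓝 (p.eval ((0 : ℝ) : ℂ))) :=
        ((p.continuous.comp Complex.continuous_ofReal).tendsto 0).mono_left nhdsWithin_le_nhds
      have hz : Tendsto (fun t : ℝ => t ^ (n + 1)) (𝓝[≠] 0) (𝓝 0) := by
        have := ((continuous_pow (n + 1) (M := ℝ)).tendsto 0).mono_left
          (nhdsWithin_le_nhds (s := {0}ᶜ))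
        simpa using this
      rw [Polynomial.coeff_zero_eq_eval_zero]
      simpa using tendsto_nhds_unique hc (h.trans_tendsto hz)
    cases k with
    | zero => exact h0
    | succ k =>
      have hX := Polynomial.divX_mul_X_add p
      rw [h0, map_zero, add_zero] at hX
      rw [← Polynomial.coeff_divX]
      refine ih ?_ (by omega)
      have h1 : (fun t : ℝ => p.divX.eval (t : ℂ)) =ᶠ[𝓝[≠] 0]
          fun t : ℝ => p.eval (t : ℂ) * ((t : ℂ))⁻¹ := by
        filter_upwards [self_mem_nhdsWithin] with t ht
        have ht : (t : ℂ) ≠ 0 := by simpa using ht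
        conv_rhs => rw [← hX]
        simp [ht]
      have h2 : (fun t : ℝ => t ^ n) =ᶠ[𝓝[≠] 0] fun t : ℝ => t ^ (n + 1) * t⁻¹ := by
        filter_upwards [self_mem_nhdsWithin] with t ht
        have ht : t ≠ 0 := by simpa using ht
        rw [pow_succ, mul_assoc, mul_inv_cancel₀ ht, mul_one]
      exact (h.mul (isBigO_of_le _ fun t => by simp)).congr' h1.symm h2.symm

variable {N : ℕ}

theorem isBigO_eval_one (p : MvPolynomial (Fin N) ℂ) :
    (fun g : Fin N → ℝ => MvPolynomial.eval (fun x => (g x : ℂ)) p) =O[𝓝 0] fun _ => (1 : ℝ) := by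
  have h : Continuous fun g : Fin N → ℝ => MvPolynomial.eval (fun x => (g x : ℂ)) p :=
    p.continuous_eval.comp (by fun_prop)
  exact (h.tendsto 0).isBigO_one ℝ

theorem isBigO_coord (x : Fin N) :
    (fun g : Fin N → ℝ => (g x : ℂ)) =O[𝓝 0] fun g => ‖g‖ :=
  isBigO_of_le _ fun g => by simpa using norm_le_pi_norm g x

theorem isBigO_norm_pow_of_le {m n : ℕ} (h : n ≤ m) :
    (fun g : Fin N → ℝ => ‖g‖ ^ m) =O[𝓝 0] fun g => ‖g‖ ^ n := by
  refine IsBigO.of_bound 1 ?_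
  filter_upwards [Metric.ball_mem_nhds (0 : Fin N → ℝ) one_pos] with g hg
  rw [mem_ball_zero_iff] at hg
  simpa using pow_le_pow_of_le_one (norm_nonneg g) hg.le h

theorem isBigO_eval_of_coeff_eq_zero {n : ℕ} {p : MvPolynomial (Fin N) ℂ}
    (h : ∀ d : Fin N →₀ ℕ, d.degree < n → p.coeff d = 0) :
    (fun g : Fin N → ℝ => MvPolynomial.eval (fun x => (g x : ℂ)) p) =O[𝓝 0]
      fun g => ‖g‖ ^ n := by
  simp only [MvPolynomial.eval_eq]
  refine IsBigO.fun_sum fun d hd => ?_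
  have hdn : n ≤ d.degree := by
    by_contra! hlt
    exact MvPolynomial.mem_support_iff.mp hd (h d hlt)
  refine IsBigO.trans ?_ (isBigO_norm_pow_of_le hdn)
  refine IsBigO.const_mul_left (isBigO_of_le _ fun g => ?_) _
  rw [norm_prod, norm_pow, norm_norm, Finsupp.degree_apply, ← Finset.prod_pow_eq_pow_sum]
  refine Finset.prod_le_prod (fun _ _ => norm_nonneg _) fun i _ => ?_
  rw [norm_pow]
  exact pow_le_pow_left₀ (norm_nonneg _) (by simpa using norm_le_pi_norm g i) _

/-- The restriction of a polynomial to the line through `v`. -/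
def onLine (v : Fin N → ℝ) : MvPolynomial (Fin N) ℂ →ₐ[ℂ] ℂ[X] :=
  MvPolynomial.aeval fun x => Polynomial.C (v x : ℂ) * Polynomial.X

theorem eval_onLine (v : Fin N → ℝ) (p : MvPolynomial (Fin N) ℂ) (t : ℝ) :
    (onLine v p).eval (t : ℂ) = MvPolynomial.eval (fun x => (((t • v) x : ℝ) : ℂ)) p := by
  induction p using MvPolynomial.induction_on with
  | C a => simp [onLine]
  | add p q hp hq => simp [hp, hq]
  | mul_X p i hp =>
    rw [map_mul, map_mul, Polynomial.eval_mul, hp]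
    simp [onLine, Complex.ofReal_mul, mul_comm (t : ℂ)]

theorem coeff_onLine (v : Fin N → ℝ) (p : MvPolynomial (Fin N) ℂ) (k : ℕ) :
    (onLine v p).coeff k =
      MvPolynomial.eval (fun x => (v x : ℂ)) (MvPolynomial.homogeneousComponent k p) := by
  induction p using MvPolynomial.induction_on' with
  | monomial d a =>
    have h1 : onLine v (MvPolynomial.monomial d a) =
        Polynomial.C (a * d.prod fun x m => (v x : ℂ) ^ m) * Polynomial.X ^ d.degree := by
      rw [onLine, MvPolynomial.aeval_monomial, Finsupp.degree_apply, map_mul]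
      simp only [Finsupp.prod, mul_pow, Finset.prod_mul_distrib, Finset.prod_pow_eq_pow_sum,
        map_prod, map_pow, Polynomial.algebraMap_eq, mul_assoc]
    rw [h1, Polynomial.coeff_C_mul_X_pow]
    by_cases hk : k = d.degree
    · rw [if_pos hk, MvPolynomial.homogeneousComponent_of_mem
        (MvPolynomial.isHomogeneous_monomial a hk.symm), if_pos rfl, MvPolynomial.eval_monomial]
    · rw [if_neg hk, MvPolynomial.homogeneousComponent_of_mem
        (MvPolynomial.isHomogeneous_monomial a rfl), if_neg hk, map_zero]
  | add p q hp hq => simp [hp, hq]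

/-- On a line through the origin, the homogeneous component of degree `k` is the coefficient of
`t^k`. The estimate makes it vanish on all real lines, hence identically. -/
theorem mvCoeff_eq_zero_of_isBigO {n : ℕ} {p : MvPolynomial (Fin N) ℂ}
    (h : (fun g : Fin N → ℝ => MvPolynomial.eval (fun x => (g x : ℂ)) p) =O[𝓝 0]
      fun g => ‖g‖ ^ n) {d : Fin N →₀ ℕ} (hd : d.degree < n) : p.coeff d = 0 := by
  have h1 : MvPolynomial.homogeneousComponent d.degree p = 0 := by
    refine MvPolynomial.funext_set (fun _ => Set.range fun t : ℝ => (t : ℂ))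
      (fun _ => Set.infinite_range_of_injective Complex.ofReal_injective) fun w hw => ?_
    choose v hv using fun x => hw x trivial
    obtain rfl : (fun x => (v x : ℂ)) = w := funext hv
    rw [map_zero, ← coeff_onLine]
    refine coeff_eq_zero_of_isBigO (n := n) ?_ hd
    have h2 : Tendsto (fun t : ℝ => t • v) (𝓝[≠] 0) (𝓝 0) := by
      have : Continuous fun t : ℝ => t • v := by fun_prop
      simpa using (this.tendsto 0).mono_left (nhdsWithin_le_nhds (s := {0}ᶜ))
    refine ((h.comp_tendsto h2).congr_left fun t => (eval_onLine v p t).symm).trans ?_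
    refine IsBigO.of_bound (‖v‖ ^ n) (Eventually.of_forall fun t => ?_)
    simp [norm_smul, mul_pow, mul_comm]
  have h2 := congrArg (MvPolynomial.coeff d) h1
  simpa [MvPolynomial.coeff_homogeneousComponent] using h2

/-- Functions of the couplings with polynomial approximations to all orders at zero. -/
def HasExpansion (f : (Fin N → ℝ) → ℂ) : Prop :=
  ∀ n : ℕ, ∃ p : MvPolynomial (Fin N) ℂ,
    (fun g => f g - MvPolynomial.eval (fun x => (g x : ℂ)) p) =O[𝓝 0] fun g => ‖g‖ ^ n

/-- Approximants of different orders agree in low degrees by uniqueness, so the coefficient at `d`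
can be taken from the approximant of order `|d| + 1`, the first that determines it. -/
theorem HasExpansion.exists_isExpansion {f : (Fin N → ℝ) → ℂ} (h : HasExpansion f) :
    ∃ S, IsExpansion f S := by
  choose p hp using h
  obtain ⟨S, hS⟩ : ∃ S : MvPowerSeries (Fin N) ℂ, ∀ d : Fin N →₀ ℕ,
      MvPowerSeries.coeff d S = (p (d.degree + 1)).coeff d :=
    ⟨fun d => (p (d.degree + 1)).coeff d, fun _ => rfl⟩
  refine ⟨S, fun n => ?_⟩
  refine ((hp n).add (isBigO_eval_of_coeff_eq_zero
    (p := p n - MvPowerSeries.truncTotal n S) fun d hd => ?_)).congr_left fun g => ?_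
  · rw [MvPolynomial.coeff_sub, MvPowerSeries.coeff_truncTotal _ hd, hS,
      ← MvPolynomial.coeff_sub]
    refine mvCoeff_eq_zero_of_isBigO (n := d.degree + 1) ?_ (Nat.lt_succ_self _)
    refine ((hp (d.degree + 1)).sub ((hp n).trans (isBigO_norm_pow_of_le hd))).congr_left
      fun g => ?_
    simp
  · simp

theorem hasExpansion_eval (p : MvPolynomial (Fin N) ℂ) :
    HasExpansion fun g : Fin N → ℝ => MvPolynomial.eval (fun x => (g x : ℂ)) p :=
  fun n => ⟨p, by simpa using isBigO_zero _ _⟩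

theorem hasExpansion_const (c : ℂ) : HasExpansion fun _ : Fin N → ℝ => c := by
  simpa using hasExpansion_eval (MvPolynomial.C c : MvPolynomial (Fin N) ℂ)

theorem HasExpansion.isBigO_one {f : (Fin N → ℝ) → ℂ} (h : HasExpansion f) :
    f =O[𝓝 0] fun _ => (1 : ℝ) := by
  obtain ⟨p, hp⟩ := h 0
  simp only [pow_zero] at hp
  simpa using hp.add (isBigO_eval_one p)

theorem HasExpansion.add {f h : (Fin N → ℝ) → ℂ} (hf : HasExpansion f) (hh : HasExpansion h) :
    HasExpansion fun g => f g + h g := fun n => by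
  obtain ⟨p, hp⟩ := hf n
  obtain ⟨q, hq⟩ := hh n
  refine ⟨p + q, (hp.add hq).congr_left fun g => ?_⟩
  simp only [map_add]
  ring

theorem HasExpansion.mul {f h : (Fin N → ℝ) → ℂ} (hf : HasExpansion f) (hh : HasExpansion h) :
    HasExpansion fun g => f g * h g := fun n => by
  obtain ⟨p, hp⟩ := hf n
  obtain ⟨q, hq⟩ := hh n
  refine ⟨p * q, ?_⟩
  have h1 := hp.mul hh.isBigO_one
  have h2 := (isBigO_eval_one p).mul hq
  simp only [mul_one, one_mul] at h1 h2
  refine (h1.add h2).congr_left fun g => ?_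
  simp only [map_mul]
  ring

theorem HasExpansion.sum {ι : Type*} (s : Finset ι) {f : ι → (Fin N → ℝ) → ℂ}
    (hf : ∀ i ∈ s, HasExpansion (f i)) : HasExpansion fun g => ∑ i ∈ s, f i g := by
  classical
  induction s using Finset.induction_on with
  | empty => simpa using hasExpansion_const (N := N) 0
  | insert i s hi ih =>
    simp only [Finset.sum_insert hi]
    exact (hf i (by simp)).add (ih fun j hj => hf j (by simp [hj]))

theorem HasExpansion.pow {f : (Fin N → ℝ) → ℂ} (hf : HasExpansion f) (k : ℕ) :
    HasExpansion fun g => f g ^ k := by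
  induction k with
  | zero => simpa using hasExpansion_const (N := N) 1
  | succ k ih => simpa only [pow_succ] using ih.mul hf

theorem HasExpansion.of_approx {f : (Fin N → ℝ) → ℂ}
    (h : ∀ n : ℕ, ∃ u, HasExpansion u ∧ (fun g => f g - u g) =O[𝓝 0] fun g => ‖g‖ ^ n) :
    HasExpansion f := fun n => by
  obtain ⟨u, hu, h1⟩ := h n
  obtain ⟨p, hp⟩ := hu n
  exact ⟨p, (h1.add hp).congr_left fun g => by ring⟩

theorem HasExpansion.sub_isBigO {f : (Fin N → ℝ) → ℂ} (h : HasExpansion f) :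
    (fun g => f g - f 0) =O[𝓝 0] fun g => ‖g‖ := by
  obtain ⟨p, hp⟩ := h 1
  simp only [pow_one] at hp
  -- The neighbourhood filter contains the point `0` itself, where the estimate forces equality.
  have h0 : f 0 = MvPolynomial.eval (fun _ => (0 : ℂ)) p := by
    have h1 : Tendsto (fun g : Fin N → ℝ => ‖g‖) (pure 0) (𝓝 0) := by
      simpa using tendsto_pure_nhds (fun g : Fin N → ℝ => ‖g‖) 0
    have h2 := tendsto_nhds_unique ((hp.mono (pure_le_nhds 0)).trans_tendsto h1)
      (tendsto_pure_nhds _ _)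
    simpa using (sub_eq_zero.mp h2.symm)
  have h1 : ∀ p : MvPolynomial (Fin N) ℂ, (fun g : Fin N → ℝ =>
      MvPolynomial.eval (fun x => (g x : ℂ)) p - MvPolynomial.eval (fun _ => (0 : ℂ)) p)
        =O[𝓝 0] fun g => ‖g‖ := fun p => by
    induction p using MvPolynomial.induction_on with
    | C a => simpa using isBigO_zero _ _
    | add p q hp hq => exact (hp.add hq).congr_left fun g => by simp only [map_add]; ring
    | mul_X p i _ =>
      have := (isBigO_eval_one p).mul (isBigO_coord i)
      simp only [one_mul] at this
      exact this.congr_left fun g => by simp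
  exact (hp.add (h1 p)).congr_left fun g => by rw [h0]; ring

/-- Geometric series in `1 - f`, which is `O(‖g‖)`; the remainder after `n` terms is exactly `(1 -
f)^n / f`. -/
theorem HasExpansion.inv {f : (Fin N → ℝ) → ℂ} (hf : HasExpansion f) (h1 : f 0 = 1) :
    HasExpansion fun g => (f g)⁻¹ := by
  have hu : HasExpansion fun g => 1 + (-1) * f g :=
    (hasExpansion_const 1).add ((hasExpansion_const (-1)).mul hf)
  have hu1 : (fun g => 1 + (-1) * f g) =O[𝓝 0] fun g => ‖g‖ :=
    hf.sub_isBigO.neg_left.congr_left fun g => by rw [h1]; ring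
  have hn : Tendsto (fun g : Fin N → ℝ => ‖g‖) (𝓝 0) (𝓝 0) := by
    simpa using (continuous_norm (E := Fin N → ℝ)).tendsto 0
  have hf1 : Tendsto f (𝓝 0) (𝓝 1) := by
    have := (hf.sub_isBigO.trans_tendsto hn).add_const (f 0)
    simpa [h1] using this
  have hne : ∀ᶠ g in 𝓝 0, f g ≠ 0 := hf1.eventually_ne one_ne_zero
  refine HasExpansion.of_approx fun n =>
    ⟨fun g => ∑ k ∈ Finset.range n, (1 + (-1) * f g) ^ k, .sum _ fun k _ => hu.pow k, ?_⟩
  have h2 : (fun g => (f g)⁻¹) =O[𝓝 0] fun _ => (1 : ℝ) :=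
    (hf1.inv₀ one_ne_zero).isBigO_one ℝ
  have h3 := (hu1.pow n).mul h2
  simp only [mul_one] at h3
  refine h3.congr' ?_ EventuallyEq.rfl
  filter_upwards [hne] with g hg
  have h4 := geom_sum_mul (1 + (-1) * f g) n
  rw [← div_eq_mul_inv, div_eq_iff hg, sub_mul, inv_mul_cancel₀ hg]
  linear_combination -h4

end Expansion

/-! ### Expansion of the in-out correlator -/

section InOut

open Asymptotics Filter Topology

variable {N : ℕ} {Δ : Matrix (Fin N) (Fin N) ℝ} (ρ : GaussianState Δ)

/-- The leftmost exponential is moved to the bra, where it acts on a vector independent of `g` and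
is Taylor expanded. The remaining product is isometric, so the remainder is uniform in `g`; the
Taylor terms are matrix elements of a shorter product with other bras, hence the induction over all
`ψ`. -/
theorem hasExpansion_inner_causalProd (P : Fin N → ℝ[X]) (s : Finset (Fin N))
    (ψ χ : 𝓢(Modes ρ.numModes, ℂ)) :
    HasExpansion fun g => inner ℂ (l2 ψ)
      (l2 (causalProd s (fun z => fieldPhase ρ (couple g P z) z) χ)) := by
  induction s using Finset.induction_on_max generalizing ψ with
  | empty => simpa [causalProd_empty] using hasExpansion_const (N := N) _
  | insert m s hm ih =>
    refine HasExpansion.of_approx fun n => ?_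
    obtain ⟨K, hK⟩ := (fieldDiag ρ m).exists_norm_fn_phase_sub_taylor_le n (-P m) ψ
    set T : Op ρ.numModes := Polynomial.aeval (field ρ m) ((-P m).map (algebraMap ℝ ℂ)) with hT
    refine ⟨fun g => ∑ k ∈ Finset.range n, MvPolynomial.eval (fun x => (g x : ℂ))
      (MvPolynomial.X m ^ k * MvPolynomial.C (conj ((-Complex.I) ^ k / (k.factorial : ℂ)))) *
        inner ℂ (l2 ((T ^ k) ψ))
          (l2 (causalProd s (fun z => fieldPhase ρ (couple g P z) z) χ)),
      .sum _ fun k _ => (hasExpansion_eval _).mul (ih _), ?_⟩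
    refine IsBigO.of_bound (K * ‖l2 χ‖) (Eventually.of_forall fun g => ?_)
    have h1 : inner ℂ (l2 ψ) (l2 (causalProd (insert m s)
        (fun z => fieldPhase ρ (couple g P z) z) χ)) =
        inner ℂ (l2 ((fieldDiag ρ m).fn (phase (Polynomial.C (g m) * -P m)) ψ))
          (l2 (causalProd s (fun z => fieldPhase ρ (couple g P z) z) χ)) := by
      rw [causalProd_insert_max hm, Module.End.mul_apply, mul_neg,
        (fieldDiag ρ m).inner_fn_phase_left, neg_neg]
      rfl
    have h2 : ∀ k, MvPolynomial.eval (fun x => (g x : ℂ))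
      (MvPolynomial.X m ^ k * MvPolynomial.C (conj ((-Complex.I) ^ k / (k.factorial : ℂ)))) *
        inner ℂ (l2 ((T ^ k) ψ))
          (l2 (causalProd s (fun z => fieldPhase ρ (couple g P z) z) χ)) =
        inner ℂ (((g m : ℂ) ^ k * ((-Complex.I) ^ k / (k.factorial : ℂ))) • l2 ((T ^ k) ψ))
          (l2 (causalProd s (fun z => fieldPhase ρ (couple g P z) z) χ)) := fun k => by
      rw [inner_smul_left]
      simp
    simp only [h2]
    rw [h1, ← sum_inner, ← inner_sub_left]
    refine (norm_inner_le_norm _ _).trans ?_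
    rw [norm_l2_causalProd fun z ψ => norm_fieldPhase ρ _ z ψ, norm_pow, norm_norm,
      mul_right_comm]
    gcongr
    refine (hK (g m)).trans ?_
    have hK0 : 0 ≤ K := by simpa using (norm_nonneg _).trans (hK 1)
    gcongr
    exact norm_le_pi_norm g m

theorem hasExpansion_vev_sOperator_mul (P : Fin N → ℝ[X])
    {F : (Fin N → ℝ) → Op ρ.numModes} (hF : F ∈ polynomialOps N ρ.numModes) :
    HasExpansion fun g => vev (sOperator ρ (couple g P) * F g) := by
  simp only [sOperator_eq]
  induction hF using Submodule.span_induction with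
  | mem F hF =>
    obtain ⟨⟨p, T⟩, rfl⟩ := hF
    have h1 := (hasExpansion_eval p).mul (hasExpansion_inner_causalProd ρ P Finset.univ
      (vacuum ρ.numModes) (T (vacuum ρ.numModes)))
    refine (congrArg HasExpansion (funext fun g => ?_)).mp h1
    simp only [mul_smul_comm, ← vevₗ_apply, map_smul, smul_eq_mul]
    rw [vevₗ_apply, vev_eq_inner]
    rfl
  | zero => simpa [← vevₗ_apply] using hasExpansion_const (N := N) 0
  | add F G _ _ hF hG =>
    refine (congrArg HasExpansion (funext fun g => ?_)).mp (hF.add hG)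
    simp [← vevₗ_apply, mul_add]
  | smul c F _ hF =>
    refine (congrArg HasExpansion (funext fun g => ?_)).mp ((hasExpansion_const c).mul hF)
    simp [← vevₗ_apply]

theorem hasExpansion_vev_sOperator (P : Fin N → ℝ[X]) :
    HasExpansion fun g => vev (sOperator ρ (couple g P)) := by
  simpa using hasExpansion_vev_sOperator_mul ρ P (const_mem_polynomialOps (N := N) 1)

theorem vev_sOperator_couple_zero (P : Fin N → ℝ[X]) : vev (sOperator ρ (couple 0 P)) = 1 := by
  have h : ∀ s : Finset (Fin N), causalProd s (fun z => fieldPhase ρ (couple 0 P z) z) = 1 :=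
    fun s => by
      induction s using Finset.induction_on_max with
      | empty => exact causalProd_empty _
      | insert m s hm ih =>
        rw [causalProd_insert_max hm, ih]
        simp [couple, fieldPhase_zero]
  rw [sOperator_eq, h, vev_one]

theorem exists_isExpansion_inOut (C : Causet N) (P : Fin N → ℝ[X]) (x y : Fin N) :
    ∃ S, IsExpansion (fun g => inOut ρ C (couple g P) x y) S := by
  refine HasExpansion.exists_isExpansion ?_
  simp only [inOut, div_eq_mul_inv]
  exact (hasExpansion_vev_sOperator_mul ρ P
    (fieldAlgebra_le ρ (causalHeisenberg_mem_fieldAlgebra ρ C P x y))).mul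
      ((hasExpansion_vev_sOperator ρ P).inv (vev_sOperator_couple_zero ρ P))

end InOut

end CausalSetQFT
end
noncomputable section
namespace CausalSetQFT
open MeasureTheory

/-! ### Wick's theorem for one field -/

section Ladder

variable {r : ℕ}

theorem position_mem_affineOps (k : Fin r) : position k ∈ affineOps r := by
  have h : position k = mulInner (EuclideanSpace.single k (1 : ℝ)) := by
    ext ψ q
    simp [position_apply, mulInner_apply, EuclideanSpace.inner_single_right]
  exact h ▸ mulInner_mem_affineOps _

theorem partialDeriv_mem_affineOps (k : Fin r) : partialDeriv k ∈ affineOps r :=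
  dirDeriv_mem_affineOps (EuclideanSpace.single k (1 : ℝ))

theorem annihilation_mem_affineOps (k : Fin r) : annihilation k ∈ affineOps r :=
  Submodule.smul_mem _ _ (add_mem (position_mem_affineOps k) (partialDeriv_mem_affineOps k))

theorem creation_mem_affineOps (k : Fin r) : creation k ∈ affineOps r :=
  Submodule.smul_mem _ _ (sub_mem (position_mem_affineOps k) (partialDeriv_mem_affineOps k))

theorem conj_vacuum (q : Modes r) : conj (vacuum r q) = vacuum r q := by
  have h : vacuum r q = ((Real.pi ^ (-(r : ℝ) / 4) * Real.exp (-‖q‖ ^ 2 / 2) : ℝ) : ℂ) := by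
    change ((Real.pi ^ (-(r : ℝ) / 4) : ℝ) : ℂ) * Complex.exp (-((‖q‖ ^ 2 : ℝ) : ℂ) / 2) = _
    push_cast; rfl
  rw [h, Complex.conj_ofReal]

theorem vev_mul_annihilation (T : Op r) (k : Fin r) : vev (T * annihilation k) = 0 := by
  simp [vev, annihilation_vacuum]

/-- Integration by parts turns `a_k†` into `a_k` acting on the real function `Ω`, which it
annihilates. -/
theorem vev_creation_mul (T : Op r) (k : Fin r) : vev (creation k * T) = 0 := by
  have hi : ∀ f g : 𝓢(Modes r, ℂ), Integrable fun q => f q * g q := fun f g => by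
    have := (SchwartzMap.memLp f 2 volume).integrable_mul (SchwartzMap.memLp g 2 volume)
    exact this
  have h1 : ∫ q, vacuum r q * partialDeriv k (T (vacuum r)) q =
      -∫ q, partialDeriv k (vacuum r) q * T (vacuum r) q :=
    SchwartzMap.integral_mul_lineDerivOp_right_eq_neg_left _ _ _
  have h2 : ∀ q, position k (vacuum r) q + partialDeriv k (vacuum r) q = 0 := fun q => by
    have := congrArg (fun ψ : 𝓢(Modes r, ℂ) => ψ q) (annihilation_vacuum k)
    simp only [annihilation, LinearMap.smul_apply, smul_apply, LinearMap.add_apply, add_apply,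
      zero_apply, smul_eq_mul, mul_eq_zero] at this
    refine this.resolve_left ?_
    simp
  have h3 : vev ((position k - partialDeriv k) * T) = 0 := by
    simp only [vev, conj_vacuum, Module.End.mul_apply, LinearMap.sub_apply, sub_apply, mul_sub]
    rw [integral_sub (hi _ _) (hi _ _), h1, sub_neg_eq_add, ← integral_add]
    · refine (integral_congr_ae (Filter.Eventually.of_forall fun q => ?_)).trans (integral_zero _ _)
      have := h2 q
      rw [position_apply] at this
      simp only [position_apply]
      linear_combination (T (vacuum r) q) * this
    · exact hi (vacuum r) (position k (T (vacuum r)))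
    · exact hi (partialDeriv k (vacuum r)) (T (vacuum r))
  rw [creation, smul_mul_assoc, ← vevₗ_apply, map_smul, vevₗ_apply, h3, smul_zero]

theorem inv_sqrt_two_mul_self : ((1 / √2 : ℝ) : ℂ) * ((1 / √2 : ℝ) : ℂ) = 1 / 2 := by
  rw [← Complex.ofReal_mul, div_mul_div_comm, Real.mul_self_sqrt (by norm_num)]; simp

theorem annihilation_creation (j k : Fin r) :
    (annihilation j : Op r) * creation k - creation k * annihilation j =
      (if j = k then (1 : ℂ) else 0) • (1 : Op r) := by
  have h : (position j + partialDeriv j : Op r) * (position k - partialDeriv k) -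
      (position k - partialDeriv k) * (position j + partialDeriv j) =
      (2 : ℂ) • (if j = k then (1 : ℂ) else 0) • (1 : Op r) := by
    have e1 := position_comm j k
    have e2 := partialDeriv_comm j k
    have e3 := partialDeriv_position j k
    have e4 := partialDeriv_position k j
    rw [two_smul]
    nth_rewrite 2 [show (if j = k then (1 : ℂ) else 0) = if k = j then (1 : ℂ) else 0 by
      simp only [eq_comm]]
    rw [← e3, ← e4, ← sub_eq_zero]
    refine Eq.trans ?_ ((congrArg₂ (· - ·) e1 e2).trans (sub_zero 0))
    noncomm_ring
  rw [annihilation, creation, smul_mul_smul_comm, smul_mul_smul_comm, inv_sqrt_two_mul_self,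
    ← smul_sub, h, smul_smul]
  norm_num

theorem annihilation_comm (j k : Fin r) :
    (annihilation j : Op r) * annihilation k - annihilation k * annihilation j = 0 := by
  have h : (position j + partialDeriv j : Op r) * (position k + partialDeriv k) -
      (position k + partialDeriv k) * (position j + partialDeriv j) = 0 := by
    have e1 := position_comm j k
    have e2 := partialDeriv_comm j k
    have e3 := partialDeriv_position j k
    have e4 := partialDeriv_position k j
    simp only [eq_comm (a := k)] at e4
    have e5 := e3.trans e4.symm
    rw [← sub_eq_zero] at e5
    refine Eq.trans ?_ ((congrArg₂ (· + ·) (congrArg₂ (· + ·) e1 e2) e5).trans (by simp))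
    noncomm_ring
  rw [annihilation, annihilation, smul_mul_smul_comm, smul_mul_smul_comm, ← smul_sub, h, smul_zero]

theorem creation_comm (j k : Fin r) :
    (creation j : Op r) * creation k - creation k * creation j = 0 := by
  have h : (position j - partialDeriv j : Op r) * (position k - partialDeriv k) -
      (position k - partialDeriv k) * (position j - partialDeriv j) = 0 := by
    have e1 := position_comm j k
    have e2 := partialDeriv_comm j k
    have e3 := partialDeriv_position j k
    have e4 := partialDeriv_position k j
    simp only [eq_comm (a := k)] at e4
    have e5 := e4.trans e3.symm
    rw [← sub_eq_zero] at e5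
    refine Eq.trans ?_ ((congrArg₂ (· + ·) (congrArg₂ (· + ·) e1 e2) e5).trans (by simp))
    noncomm_ring
  rw [creation, creation, smul_mul_smul_comm, smul_mul_smul_comm, ← smul_sub, h, smul_zero]

end Ladder

section Wick

variable {N : ℕ} {Δ : Matrix (Fin N) (Fin N) ℝ} (ρ : GaussianState Δ)

theorem cov_apply (x y : Fin N) : ρ.cov x y = ∑ k, ρ.amp x k * conj (ρ.amp y k) := by
  rw [← ρ.amp_mul]
  simp [Matrix.mul_apply]

theorem field_def (x : Fin N) : field ρ x = (ρ.mean x : ℂ) • (1 : Op ρ.numModes) +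
    ∑ k, (ρ.amp x k • annihilation k + conj (ρ.amp x k) • creation k) := rfl

theorem annihilation_field (k : Fin ρ.numModes) (x : Fin N) :
    annihilation k * field ρ x - field ρ x * annihilation k =
      conj (ρ.amp x k) • (1 : Op ρ.numModes) := by
  have h1 : ∀ j, annihilation k * (ρ.amp x j • annihilation j + conj (ρ.amp x j) • creation j) -
      (ρ.amp x j • annihilation j + conj (ρ.amp x j) • creation j) * annihilation k =
      if k = j then conj (ρ.amp x j) • (1 : Op ρ.numModes) else 0 := fun j => by
    rw [mul_add, add_mul, mul_smul_comm, mul_smul_comm, smul_mul_assoc, smul_mul_assoc,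
      add_sub_add_comm, ← smul_sub, ← smul_sub, annihilation_comm, annihilation_creation, smul_zero,
      zero_add]
    split_ifs <;> simp
  rw [field, mul_add, add_mul, mul_smul_comm, smul_mul_assoc, mul_one, one_mul, Finset.mul_sum,
    Finset.sum_mul, add_sub_add_left_eq_sub, ← Finset.sum_sub_distrib]
  simp [h1]

theorem creation_field (k : Fin ρ.numModes) (x : Fin N) :
    creation k * field ρ x - field ρ x * creation k =
      -ρ.amp x k • (1 : Op ρ.numModes) := by
  have h1 : ∀ j, creation k * (ρ.amp x j • annihilation j + conj (ρ.amp x j) • creation j) -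
      (ρ.amp x j • annihilation j + conj (ρ.amp x j) • creation j) * creation k =
      if j = k then -ρ.amp x j • (1 : Op ρ.numModes) else 0 := fun j => by
    rw [mul_add, add_mul, mul_smul_comm, mul_smul_comm, smul_mul_assoc, smul_mul_assoc,
      add_sub_add_comm, ← smul_sub, ← smul_sub, creation_comm, ← neg_sub (annihilation j * _),
      annihilation_creation, smul_zero, add_zero]
    split_ifs <;> simp
  rw [field, mul_add, add_mul, mul_smul_comm, smul_mul_assoc, mul_one, one_mul, Finset.mul_sum,
    Finset.sum_mul, add_sub_add_left_eq_sub, ← Finset.sum_sub_distrib]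
  simp [h1]

variable {f f' : ℝ → ℂ}

theorem commutator_affine_fn {X : Op ρ.numModes} (hX : X ∈ affineOps ρ.numModes) {x : Fin N} {c : ℂ}
    (hc : X * field ρ x - field ρ x * X = c • 1) (hf : f.HasTemperateGrowth)
    (hf' : f'.HasTemperateGrowth) (hd : ∀ t, HasDerivAt f (f' t) t) :
    X * (fieldDiag ρ x).fn f - (fieldDiag ρ x).fn f * X = c • (fieldDiag ρ x).fn f' := by
  obtain ⟨d, hd'⟩ := (fieldDiag ρ x).commutator_fn hX
  have h1 := hd' (fun t => (t : ℂ)) (fun _ => 1) (by fun_prop) (by fun_prop)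
    (fun t => (hasDerivAt_id t).ofReal_comp)
  rw [(fieldDiag ρ x).fn_id, (fieldDiag ρ x).fn_one, hc] at h1
  rw [hd' f f' hf hf' hd, ← mul_one ((fieldDiag ρ x).fn f'), ← mul_smul_comm, ← mul_smul_comm, h1]

/-- Wick's theorem for a function of one field followed by another field. -/
theorem vev_fn_mul_field (x y : Fin N) (hf : f.HasTemperateGrowth) (hf' : f'.HasTemperateGrowth)
    (hd : ∀ t, HasDerivAt f (f' t) t) :
    vev ((fieldDiag ρ x).fn f * field ρ y) = ρ.mean y * vev ((fieldDiag ρ x).fn f) +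
      ρ.cov x y * vev ((fieldDiag ρ x).fn f') := by
  -- Annihilators vanish on the vacuum to the right; a creation operator is commuted to the left,
  -- where it vanishes, and leaves the commutator with `f(φ_x)`.
  have h1 : ∀ k, vev ((fieldDiag ρ x).fn f * creation k) =
      ρ.amp x k * vev ((fieldDiag ρ x).fn f') := fun k => by
    have h2 := commutator_affine_fn ρ (creation_mem_affineOps k) (creation_field ρ k x) hf hf' hd
    have h3 : (fieldDiag ρ x).fn f * creation k =
        creation k * (fieldDiag ρ x).fn f + ρ.amp x k • (fieldDiag ρ x).fn f' := by
      rw [sub_eq_iff_eq_add.mp h2, neg_smul]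
      abel
    rw [h3, ← vevₗ_apply, map_add, vevₗ_apply, vev_creation_mul, map_smul, vevₗ_apply, zero_add,
      smul_eq_mul]
  rw [cov_apply]
  rw [field_def ρ y, mul_add, mul_smul_comm, mul_one, Finset.mul_sum]
  simp only [mul_add, mul_smul_comm]
  simp only [← vevₗ_apply, map_add, map_smul, map_sum]
  simp only [vevₗ_apply, vev_mul_annihilation, h1, smul_eq_mul, mul_zero, zero_add, Finset.sum_mul]
  congr 1
  exact Finset.sum_congr rfl fun k _ => by ring

/-- Wick's theorem for a function of one field preceded by another field. -/
theorem vev_field_mul_fn (x y : Fin N) (hf : f.HasTemperateGrowth) (hf' : f'.HasTemperateGrowth)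
    (hd : ∀ t, HasDerivAt f (f' t) t) :
    vev (field ρ y * (fieldDiag ρ x).fn f) = ρ.mean y * vev ((fieldDiag ρ x).fn f) +
      ρ.cov y x * vev ((fieldDiag ρ x).fn f') := by
  have h1 : ∀ k, vev (annihilation k * (fieldDiag ρ x).fn f) =
      conj (ρ.amp x k) * vev ((fieldDiag ρ x).fn f') := fun k => by
    have h2 := commutator_affine_fn ρ (annihilation_mem_affineOps k) (annihilation_field ρ k x)
      hf hf' hd
    rw [sub_eq_iff_eq_add] at h2
    rw [h2, ← vevₗ_apply, map_add, vevₗ_apply, vevₗ_apply, vev_mul_annihilation, ← vevₗ_apply,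
      map_smul, vevₗ_apply]
    simp
  rw [cov_apply]
  rw [field_def ρ y, add_mul, smul_mul_assoc, one_mul, Finset.sum_mul]
  simp only [add_mul, smul_mul_assoc]
  simp only [← vevₗ_apply, map_add, map_smul, map_sum]
  simp only [vevₗ_apply, vev_creation_mul, h1, smul_eq_mul, mul_zero, add_zero, Finset.sum_mul]
  congr 1
  exact Finset.sum_congr rfl fun k _ => by ring

end Wick

/-! ### The distribution of a field -/

namespace Diagonalization

variable {r : ℕ} {A : Op r} (D : Diagonalization A)

/-- The distribution of the observable `A` in the vacuum. -/
def law : Measure ℝ :=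
  (volume.withDensity fun q => ((‖D.equiv (vacuum r) q‖₊ ^ 2 : NNReal) : ENNReal)).map D.spec

theorem continuous_spec : Continuous D.spec :=
  D.spec_hasTemperateGrowth.1.continuous

theorem measurable_density : Measurable fun q => ‖D.equiv (vacuum r) q‖₊ ^ 2 :=
  ((D.equiv (vacuum r)).continuous.nnnorm.pow 2).measurable

variable {f : ℝ → ℂ}

theorem density_smul (q : Modes r) : (‖D.equiv (vacuum r) q‖₊ ^ 2 : NNReal) • f (D.spec q) =
    f (D.spec q) * (conj (D.equiv (vacuum r) q) * D.equiv (vacuum r) q) := by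
  rw [Complex.conj_mul', NNReal.smul_def, Complex.real_smul, mul_comm]
  simp

theorem integrable_law (hf : f.HasTemperateGrowth) : Integrable f D.law := by
  have hc : Continuous f := hf.1.continuous
  rw [law, integrable_map_measure hc.aestronglyMeasurable D.continuous_spec.aemeasurable,
    integrable_withDensity_iff_integrable_smul D.measurable_density]
  have h := (SchwartzMap.memLp (D.equiv (D.fn f (vacuum r))) 2 volume).integrable_mul
    ((SchwartzMap.memLp (D.equiv (vacuum r)) 2 volume).star)
  refine h.congr (Filter.Eventually.of_forall fun q => ?_)
  simp only [Function.comp_apply, D.density_smul, Pi.mul_apply, D.equiv_fn_apply hf, Pi.star_apply,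
    RCLike.star_def]
  ring

theorem vev_fn (hf : f.HasTemperateGrowth) : vev (D.fn f) = ∫ t, f t ∂D.law := by
  have hc : Continuous f := hf.1.continuous
  rw [vev_eq_inner, D.inner_fn hf, law, integral_map D.continuous_spec.aemeasurable
    hc.aestronglyMeasurable, integral_withDensity_eq_integral_smul D.measurable_density]
  simp only [D.density_smul]

instance : IsProbabilityMeasure D.law := by
  have h1 := D.integrable_law (Function.HasTemperateGrowth.const 1)
  have hfin : IsFiniteMeasure D.law := by
    rwa [integrable_const_iff_isFiniteMeasure one_ne_zero] at h1
  have h2 := D.vev_fn (Function.HasTemperateGrowth.const 1)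
  rw [D.fn_one, vev_one, integral_const, Complex.real_smul, mul_one] at h2
  have h3 : D.law.real Set.univ = 1 := by exact_mod_cast h2.symm
  exact ⟨by simpa [Measure.real, ENNReal.toReal_eq_one_iff] using h3⟩

end Diagonalization

end CausalSetQFT
end
noncomputable section
namespace CausalSetQFT
open MeasureTheory

/-! ### Growth of the moments of a polynomial in a Gaussian variable -/

section Moments

open Filter Topology

/-- A log-convex sequence that grows factorially has ratios of at least linear growth. -/
theorem exists_succ_mul_le {M : ℕ → ℝ} (h0 : M 0 = 1) (hM : ∀ k, 0 ≤ M k)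
    (hconv : ∀ k, M (k + 1) ^ 2 ≤ M k * M (k + 2)) {c : ℝ} (hc : 0 < c)
    (hg : ∀ᶠ k : ℕ in atTop, c ^ k * k.factorial ≤ M k) :
    ∃ C : ℝ, 0 ≤ C ∧ ∀ k : ℕ, (k + 1 : ℝ) * M k ≤ C * M (k + 1) := by
  obtain ⟨K, hK⟩ := eventually_atTop.mp hg
  -- By log-convexity a zero would propagate to all later terms, against the growth assumption.
  have hpos : ∀ k, 0 < M k := by
    by_contra! hcon
    obtain ⟨k, hk⟩ := hcon
    have hk0 : M k = 0 := le_antisymm hk (hM k)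
    have hall : ∀ j, M (k + j) = 0 := fun j => by
      induction j with
      | zero => exact hk0
      | succ j ih =>
        have := hconv (k + j)
        rw [ih, zero_mul] at this
        exact pow_eq_zero_iff two_ne_zero |>.mp (le_antisymm this (sq_nonneg _))
    have h1 := hK (k + K) (by omega)
    rw [hall] at h1
    have : 0 < c ^ (k + K) * ((k + K).factorial : ℝ) := by positivity
    linarith
  have hr : ∀ k, M (k + 1) / M k ≤ M (k + 2) / M (k + 1) := fun k => by
    rw [div_le_div_iff₀ (hpos _) (hpos _), ← sq, mul_comm]
    linarith [hconv k, mul_comm (M k) (M (k + 2))]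
  have hmono : Monotone fun k => M (k + 1) / M k := monotone_nat_of_le_succ hr
  -- `M (k + 1)` is the product of the first `k + 1` ratios, none larger than the last.
  have hpow : ∀ k, M (k + 1) ≤ (M (k + 1) / M k) ^ (k + 1) := fun k => by
    induction k with
    | zero => simp [h0]
    | succ k ih =>
      have h1 : 0 ≤ M (k + 1) / M k := (div_pos (hpos _) (hpos _)).le
      calc M (k + 2) = M (k + 2) / M (k + 1) * M (k + 1) := by
            rw [div_mul_cancel₀ _ (hpos _).ne']
        _ ≤ M (k + 2) / M (k + 1) * (M (k + 2) / M (k + 1)) ^ (k + 1) := by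
            refine mul_le_mul_of_nonneg_left (ih.trans ?_) (div_pos (hpos _) (hpos _)).le
            exact pow_le_pow_left₀ h1 (hr k) _
        _ = _ := by ring
  -- Combine `c^n n! ≤ M n` with `n! ≥ (n/e)^n` for `n = k + 1` and take `n`-th roots.
  have hlin : ∀ k, K ≤ k + 1 → (k + 1 : ℝ) ≤ Real.exp 1 / c * (M (k + 1) / M k) := fun k hk => by
    have h1 := (hK (k + 1) hk).trans (hpow k)
    have h2 := Real.pow_div_factorial_le_exp ((k + 1 : ℕ) : ℝ) (by positivity) (k + 1)
    rw [div_le_iff₀ (by positivity), ← mul_one ((k + 1 : ℕ) : ℝ), Real.exp_nat_mul, mul_one] at h2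
    have h3 : (c * ((k + 1 : ℕ) : ℝ)) ^ (k + 1) ≤
        (Real.exp 1 * (M (k + 1) / M k)) ^ (k + 1) := by
      rw [mul_pow, mul_pow]
      calc _ ≤ c ^ (k + 1) * (Real.exp 1 ^ (k + 1) * (k + 1).factorial) := by gcongr
        _ = Real.exp 1 ^ (k + 1) * (c ^ (k + 1) * (k + 1).factorial) := by ring
        _ ≤ _ := by gcongr
    have h4 := le_of_pow_le_pow_left₀ (Nat.succ_ne_zero k)
      (mul_nonneg (Real.exp_pos 1).le (div_pos (hpos (k + 1)) (hpos k)).le) h3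
    rw [div_mul_eq_mul_div, le_div_iff₀ hc]
    push_cast at h4
    linarith
  -- The second constant covers the finitely many `k` below the threshold, where the ratio is at
  -- least the first one, `M 1`.
  refine ⟨max (Real.exp 1 / c) ((K + 1) / M 1), le_max_of_le_left (by positivity), fun k => ?_⟩
  have h5 : (k + 1 : ℝ) ≤ max (Real.exp 1 / c) ((K + 1) / M 1) * (M (k + 1) / M k) := by
    have hrk : 0 < M (k + 1) / M k := div_pos (hpos _) (hpos _)
    rcases le_or_gt K (k + 1) with h | h
    · exact (hlin k h).trans (by gcongr; exact le_max_left _ _)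
    · have h6 : M 1 ≤ M (k + 1) / M k := by simpa [h0] using hmono (Nat.zero_le k)
      have h7 : (k + 1 : ℝ) ≤ K := by exact_mod_cast h.le
      calc (k + 1 : ℝ) ≤ K + 1 := by linarith
        _ = (K + 1) / M 1 * M 1 := by rw [div_mul_cancel₀ _ (hpos 1).ne']
        _ ≤ (K + 1) / M 1 * (M (k + 1) / M k) := by
          have := hpos 1
          gcongr
        _ ≤ _ := by gcongr; exact le_max_right _ _
  rwa [← mul_div_assoc, le_div_iff₀ (hpos k)] at h5

/-- A polynomial of degree at least two grows at least quadratically. -/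
theorem exists_quadratic_le {P : ℝ[X]} (hP : 2 ≤ P.natDegree) (m : ℝ) :
    ∃ c R : ℝ, 0 < c ∧ 0 < R ∧ ∀ z : ℝ, (z - m) ^ 2 ≤ R ∨ c * (z - m) ^ 2 ≤ |P.eval z| := by
  have hP0 : P ≠ 0 := fun h => by simp [h] at hP
  have h1 := Polynomial.isBigO_cobounded_of_degree_le
      (P := (Polynomial.X - Polynomial.C m) ^ 2) (Q := P) (by
    rw [Polynomial.degree_pow, Polynomial.degree_X_sub_C, nsmul_one,
      Polynomial.degree_eq_natDegree hP0]
    exact_mod_cast hP)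
  obtain ⟨C, hC, h2⟩ := h1.exists_pos
  obtain ⟨R, -, hR⟩ := (Metric.hasBasis_cobounded_compl_closedBall m).eventually_iff.mp h2.bound
  refine ⟨C⁻¹, R ^ 2 + 1, by positivity, by positivity, fun z => ?_⟩
  by_cases hz : z ∈ Metric.closedBall m R
  · left
    rw [Metric.mem_closedBall, Real.dist_eq] at hz
    have := pow_le_pow_left₀ (abs_nonneg _) hz 2
    rw [sq_abs] at this
    linarith
  · right
    have := hR hz
    rw [inv_mul_le_iff₀ hC]
    simpa using this

variable {μ : Measure ℝ} [IsProbabilityMeasure μ] {m v : ℝ}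

theorem integrable_abs_eval_pow {μ : Measure ℝ}
    (hint : ∀ Q : ℝ[X], Integrable (fun z => Q.eval z) μ) (P : ℝ[X]) (n : ℕ) :
    Integrable (fun z => |P.eval z| ^ n) μ := by
  simpa using (hint (P ^ n)).abs

/-- Integration by parts with `Q = (z - m)^(2n+1)` gives a recursion with factor `v(2n+1) ≥ v(n+1)`.
-/
theorem factorial_le_moment (hv : 0 < v)
    (hstein : ∀ Q : ℝ[X], ∫ z, Q.eval z * (z - m) ∂μ = v * ∫ z, Q.derivative.eval z ∂μ) (n : ℕ) :
    v ^ n * n.factorial ≤ ∫ z, (z - m) ^ (2 * n) ∂μ := by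
  induction n with
  | zero => simp
  | succ n ih =>
    have h := hstein ((Polynomial.X - Polynomial.C m) ^ (2 * n + 1))
    have h1 : ∫ z, (z - m) ^ (2 * (n + 1)) ∂μ =
        v * ((2 * n + 1) * ∫ z, (z - m) ^ (2 * n) ∂μ) := by
      rw [← integral_const_mul]
      have e1 : ∀ z, (z - m) ^ (2 * (n + 1)) =
          ((Polynomial.X - Polynomial.C m) ^ (2 * n + 1)).eval z * (z - m) := fun z => by
        simp only [Polynomial.eval_pow, Polynomial.eval_sub, Polynomial.eval_X, Polynomial.eval_C]
        ring
      have e2 : ∀ z, (2 * n + 1) * (z - m) ^ (2 * n) =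
          (((Polynomial.X - Polynomial.C m) ^ (2 * n + 1)).derivative).eval z := fun z => by
        simp [Polynomial.derivative_pow]
      simp only [e1, e2, h]
    have h2 : 0 ≤ ∫ z, (z - m) ^ (2 * n) ∂μ :=
      integral_nonneg fun z => by rw [pow_mul]; positivity
    rw [h1, Nat.factorial_succ, pow_succ]
    push_cast
    calc v ^ n * v * ((n + 1) * n.factorial) = v * ((n + 1) * (v ^ n * n.factorial)) := by ring
      _ ≤ v * ((n + 1) * ∫ z, (z - m) ^ (2 * n) ∂μ) := by gcongr
      _ ≤ _ := by
        have : (0 : ℝ) ≤ n := n.cast_nonneg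
        gcongr
        linarith

/-- Integrate `|P|^n ≥ c^n((z - m)^(2n) - R^n)`, valid everywhere. Since `R^n` is eventually at most
half of `v^n n!`, only a factor `1/2` is lost, which the base `cv/2` absorbs for `n ≥ 1`. -/
theorem eventually_factorial_le_moment
    (hint : ∀ Q : ℝ[X], Integrable (fun z => Q.eval z) μ) (hv : 0 < v)
    (hstein : ∀ Q : ℝ[X], ∫ z, Q.eval z * (z - m) ∂μ = v * ∫ z, Q.derivative.eval z ∂μ)
    {P : ℝ[X]} (hP : 2 ≤ P.natDegree) :
    ∃ c : ℝ, 0 < c ∧ ∀ᶠ n : ℕ in atTop, c ^ n * n.factorial ≤ ∫ z, |P.eval z| ^ n ∂μ := by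
  obtain ⟨c, R, hc, hR, h⟩ := exists_quadratic_le hP m
  refine ⟨c * v / 2, by positivity, ?_⟩
  have hlim := FloorSemiring.tendsto_pow_div_factorial_atTop (R / v)
  filter_upwards [hlim.eventually_le_const (show (0 : ℝ) < 1 / 2 by norm_num),
    eventually_ge_atTop 1] with n hn hn1
  rw [div_le_iff₀ (by positivity), div_pow, div_le_iff₀ (by positivity)] at hn
  have hi : Integrable (fun z => (z - m) ^ (2 * n)) μ := by
    refine (hint ((Polynomial.X - Polynomial.C m) ^ (2 * n))).congr (ae_of_all _ fun z => ?_)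
    simp
  have h1 : ∫ z, (c ^ n * (z - m) ^ (2 * n) - c ^ n * R ^ n) ∂μ ≤ ∫ z, |P.eval z| ^ n ∂μ := by
    refine integral_mono ((hi.const_mul _).sub (integrable_const _))
      (integrable_abs_eval_pow hint P n) fun z => ?_
    simp only [pow_mul]
    rcases h z with h | h
    · have h2 := pow_le_pow_left₀ (sq_nonneg _) h n
      have h3 : c ^ n * ((z - m) ^ 2) ^ n ≤ c ^ n * R ^ n := by gcongr
      have h4 : 0 ≤ |P.eval z| ^ n := by positivity
      linarith
    · have h2 := pow_le_pow_left₀ (by positivity) h n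
      rw [mul_pow] at h2
      have : 0 ≤ c ^ n * R ^ n := by positivity
      linarith
  rw [integral_sub (hi.const_mul _) (integrable_const _), integral_const_mul, integral_const] at h1
  have h2 := factorial_le_moment hv hstein n
  have h3 : c ^ n * (v ^ n * n.factorial) ≤ c ^ n * ∫ z, (z - m) ^ (2 * n) ∂μ := by gcongr
  have h4 : c ^ n * R ^ n ≤ c ^ n * (1 / 2 * n.factorial * v ^ n) := by gcongr
  refine le_trans ?_ h1
  have h5 : (1 / 2 : ℝ) ^ n ≤ 1 / 2 := pow_le_of_le_one (by norm_num) (by norm_num) (by omega)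
  calc (c * v / 2) ^ n * n.factorial = (1 / 2) ^ n * (c ^ n * v ^ n * n.factorial) := by
        rw [show c * v / 2 = 1 / 2 * (c * v) by ring, mul_pow, mul_pow]; ring
    _ ≤ 1 / 2 * (c ^ n * v ^ n * n.factorial) := by gcongr
    _ ≤ _ := by
      simp only [probReal_univ, one_smul]
      linarith

/-- Cauchy–Schwarz, as the discriminant condition for `s ↦ E[|P|^k (s - |P|)²] ≥ 0`. -/
theorem moment_logConvex {μ : Measure ℝ}
    (hint : ∀ Q : ℝ[X], Integrable (fun z => Q.eval z) μ) (P : ℝ[X]) (k : ℕ) :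
    (∫ z, |P.eval z| ^ (k + 1) ∂μ) ^ 2 ≤
      (∫ z, |P.eval z| ^ k ∂μ) * ∫ z, |P.eval z| ^ (k + 2) ∂μ := by
  have hi := integrable_abs_eval_pow hint P
  have hq : ∀ s : ℝ, 0 ≤ (∫ z, |P.eval z| ^ k ∂μ) * (s * s) +
      (-2 * ∫ z, |P.eval z| ^ (k + 1) ∂μ) * s + ∫ z, |P.eval z| ^ (k + 2) ∂μ := fun s => by
    have h1 : 0 ≤ ∫ z, (|P.eval z| ^ k * (s * s) + -2 * |P.eval z| ^ (k + 1) * s +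
        |P.eval z| ^ (k + 2)) ∂μ := integral_nonneg fun z => by
      have : |P.eval z| ^ k * (s * s) + -2 * |P.eval z| ^ (k + 1) * s + |P.eval z| ^ (k + 2) =
          |P.eval z| ^ k * (s - |P.eval z|) ^ 2 := by ring
      simp only [Pi.zero_apply]
      rw [this]
      positivity
    have i1 := (hi k).mul_const (s * s)
    have i2 := ((hi (k + 1)).const_mul (-2)).mul_const s
    have i3 : Integrable (fun z => |P.eval z| ^ k * (s * s) + -2 * |P.eval z| ^ (k + 1) * s) μ :=
      i1.add i2
    rw [integral_add i3 (hi (k + 2)), integral_add i1 i2] at h1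
    rwa [integral_mul_const, integral_mul_const, integral_const_mul] at h1
  have := discrim_le_zero hq
  rw [discrim] at this
  linarith

theorem exists_two_mul_pow_lt {c S : ℝ} (hc : 0 < c) :
    ∀ᶠ k : ℕ in atTop, 2 * S ^ k < c ^ k * k.factorial := by
  have hlim := FloorSemiring.tendsto_pow_div_factorial_atTop (S / c)
  filter_upwards [hlim.eventually_lt_const (show (0 : ℝ) < 1 / 2 by norm_num)] with k hk
  rw [div_lt_iff₀ (by positivity), div_pow, div_lt_iff₀ (by positivity)] at hk
  linarith

/-- The moments `E[P ^ k z ^ 2]` are not bounded by the moments `E[P ^ k]`. -/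
theorem not_forall_moment_le (hint : ∀ Q : ℝ[X], Integrable (fun z => Q.eval z) μ) (hv : 0 < v)
    (hstein : ∀ Q : ℝ[X], ∫ z, Q.eval z * (z - m) ∂μ = v * ∫ z, Q.derivative.eval z ∂μ)
    {P : ℝ[X]} (hP : 2 ≤ P.natDegree) (K : ℝ) :
    ¬ ∀ k : ℕ, Even k → ∫ z, |P.eval z| ^ k * z ^ 2 ∂μ ≤ K * ∫ z, |P.eval z| ^ k ∂μ := by
  intro H
  obtain ⟨c, hc, hg⟩ := eventually_factorial_le_moment hint hv hstein hP
  have hi := integrable_abs_eval_pow hint P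
  -- Where `z² ≤ 2L` the weight is at most `S^(2k)`; elsewhere `1 ≤ z²/(2L)`. The assumed bound then
  -- gives `E|P|^(2k) ≤ S^(2k) + E|P|^(2k)/2`, against factorial growth.
  set L := |K| + 1 with hL
  have hLpos : 0 < L := by positivity
  obtain ⟨S, hS⟩ := (isCompact_Icc (a := -√(2 * L)) (b := √(2 * L))).exists_bound_of_continuousOn
    (f := fun z => P.eval z) P.continuous.continuousOn
  obtain ⟨k, h1, h2⟩ := ((tendsto_id.const_mul_atTop' (show 0 < 2 by norm_num)).eventually
    (hg.and (exists_two_mul_pow_lt (S := S) hc))).exists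
  simp only [id] at h1 h2
  have hM : 0 ≤ ∫ z, |P.eval z| ^ (2 * k) ∂μ := integral_nonneg fun z => by positivity
  have h3 : ∫ z, |P.eval z| ^ (2 * k) * z ^ 2 ∂μ ≤ L * ∫ z, |P.eval z| ^ (2 * k) ∂μ :=
    (H (2 * k) (even_two_mul k)).trans (by gcongr; linarith [le_abs_self K])
  have hi2 : Integrable (fun z => |P.eval z| ^ (2 * k) * z ^ 2) μ := by
    refine (hint (P ^ (2 * k) * Polynomial.X ^ 2)).congr (ae_of_all _ fun z => ?_)
    simp [pow_mul]
  have h4 : ∫ z, |P.eval z| ^ (2 * k) ∂μ ≤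
      ∫ z, (S ^ (2 * k) + |P.eval z| ^ (2 * k) * z ^ 2 * (2 * L)⁻¹) ∂μ := by
    refine integral_mono (hi _) ((integrable_const _).add (hi2.mul_const _)) fun z => ?_
    have hz0 : 0 ≤ |P.eval z| ^ (2 * k) := by positivity
    rcases le_or_gt (z ^ 2) (2 * L) with hz | hz
    · have h5 := pow_le_pow_left₀ (norm_nonneg _)
        (hS z (abs_le.mp (Real.abs_le_sqrt hz))) (2 * k)
      rw [Real.norm_eq_abs] at h5
      have : 0 ≤ |P.eval z| ^ (2 * k) * z ^ 2 * (2 * L)⁻¹ := by positivity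
      linarith
    · have h5 : 1 ≤ z ^ 2 * (2 * L)⁻¹ := by
        rw [← div_eq_mul_inv, le_div_iff₀ (by positivity)]
        linarith
      have h6 : 0 ≤ S ^ (2 * k) := by rw [pow_mul]; positivity
      rw [mul_assoc]
      nlinarith
  rw [integral_add (integrable_const _) (hi2.mul_const _), integral_const, integral_mul_const,
    probReal_univ, one_smul] at h4
  have h5 : (∫ z, |P.eval z| ^ (2 * k) * z ^ 2 ∂μ) * (2 * L)⁻¹ ≤
      (∫ z, |P.eval z| ^ (2 * k) ∂μ) / 2 := by
    rw [← div_eq_mul_inv, div_le_iff₀ (by positivity)]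
    linarith
  linarith

/-- Iterating the ratio bound: raising the index by `i` costs only `C^i`, so a convolution with
finitely many coefficients is controlled by its highest moment. -/
theorem moment_div_factorial_le {M : ℕ → ℝ} {C : ℝ} (hC : 0 ≤ C)
    (h : ∀ k : ℕ, (k + 1 : ℝ) * M k ≤ C * M (k + 1)) (i j : ℕ) :
    M j / j.factorial ≤ C ^ i * (M (i + j) / (i + j).factorial) := by
  induction i with
  | zero => simp
  | succ i ih =>
    refine ih.trans ?_
    rw [pow_succ, mul_assoc]
    refine mul_le_mul_of_nonneg_left ?_ (by positivity)
    rw [show i + 1 + j = i + j + 1 by ring, Nat.factorial_succ, ← mul_div_assoc,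
      div_le_div_iff₀ (by positivity) (by positivity)]
    push_cast
    have := h (i + j)
    push_cast at this
    calc _ = ((i + j + 1 : ℝ) * M (i + j)) * (i + j).factorial := by ring
      _ ≤ _ := by gcongr

/-- The asymptotic series of `E[exp (-i t P) h] / E[exp (-i t P)]`, with `h` quadratic and `P` at
least quadratic, does not terminate. -/
theorem not_forall_coeff_eq (hint : ∀ Q : ℝ[X], Integrable (fun z => Q.eval z) μ) (hv : 0 < v)
    (hstein : ∀ Q : ℝ[X], ∫ z, Q.eval z * (z - m) ∂μ = v * ∫ z, Q.derivative.eval z ∂μ)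
    {P : ℝ[X]} (hP : 2 ≤ P.natDegree) {a b κ : ℂ} (hκ : κ ≠ 0) (s : ℂ[X]) :
    ¬ ∀ k : ℕ, (-Complex.I) ^ k / k.factorial *
        ∫ z : ℝ, ((P.eval z : ℝ) : ℂ) ^ k * (a + b * z + κ * z ^ 2) ∂μ =
      ∑ p ∈ Finset.HasAntidiagonal.antidiagonal k, s.coeff p.1 *
        ((-Complex.I) ^ p.2 / p.2.factorial * ∫ z : ℝ, ((P.eval z : ℝ) : ℂ) ^ p.2 ∂μ) := by
  intro H
  have hi := integrable_abs_eval_pow hint P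
  set M : ℕ → ℝ := fun k => ∫ z, |P.eval z| ^ k ∂μ with hMdef
  have hM : ∀ k, 0 ≤ M k := fun k => integral_nonneg fun z => by positivity
  obtain ⟨c, hc, hg⟩ := eventually_factorial_le_moment hint hv hstein hP
  obtain ⟨C, hC, hCM⟩ := exists_succ_mul_le (M := M) (by simp [hMdef]) hM
    (moment_logConvex hint P) hc hg
  set K : ℝ := ∑ i ∈ Finset.range (s.natDegree + 1), ‖s.coeff i‖ * C ^ i with hK
  -- Only `i ≤ deg s` contributes to the convolution, so the constant `K` does not depend on `k`.
  have hbound : ∀ k, ‖∫ z : ℝ, ((P.eval z : ℝ) : ℂ) ^ k * (a + b * z + κ * z ^ 2) ∂μ‖ ≤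
      K * M k := fun k => by
    have h1 := congrArg norm (H k)
    have hI : ∀ k : ℕ, ‖(-Complex.I) ^ k / (k.factorial : ℂ)‖ = (k.factorial : ℝ)⁻¹ := fun k => by
      simp
    rw [norm_mul, hI] at h1
    have h2 : ∀ p ∈ Finset.HasAntidiagonal.antidiagonal k, ‖s.coeff p.1 * ((-Complex.I) ^ p.2 / p.2.factorial *
        ∫ z : ℝ, ((P.eval z : ℝ) : ℂ) ^ p.2 ∂μ)‖ ≤
        ‖s.coeff p.1‖ * C ^ p.1 * (M k / k.factorial) := fun p hp => by
      rw [norm_mul, norm_mul, hI, mul_assoc]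
      refine mul_le_mul_of_nonneg_left ?_ (norm_nonneg _)
      have h3 := moment_div_factorial_le hC hCM p.1 p.2
      rw [Finset.HasAntidiagonal.mem_antidiagonal.mp hp] at h3
      refine le_trans ?_ h3
      rw [div_eq_inv_mul]
      refine mul_le_mul_of_nonneg_left ((norm_integral_le_integral_norm _).trans (le_of_eq ?_))
        (by positivity)
      simp [hMdef]
    have h3 := h1.le.trans ((norm_sum_le _ _).trans (Finset.sum_le_sum h2))
    rw [← Finset.sum_mul] at h3
    have h4 : ∑ p ∈ Finset.HasAntidiagonal.antidiagonal k, ‖s.coeff p.1‖ * C ^ p.1 ≤ K := by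
      rw [Finset.Nat.sum_antidiagonal_eq_sum_range_succ (fun i _ => ‖s.coeff i‖ * C ^ i), hK]
      refine (Finset.sum_le_sum_of_subset_of_nonneg (Finset.range_subset_range.mpr
        (show k.succ ≤ k + 1 + (s.natDegree + 1) by omega))
        fun _ _ _ => by positivity).trans (le_of_eq ?_)
      symm
      refine Finset.sum_subset (Finset.range_subset_range.mpr (by omega)) fun i _ hi => ?_
      rw [Polynomial.coeff_eq_zero_of_natDegree_lt (by simpa using hi),
        norm_zero, zero_mul]
    have h5 : (k.factorial : ℝ)⁻¹ *
        ‖∫ z : ℝ, ((P.eval z : ℝ) : ℂ) ^ k * (a + b * z + κ * z ^ 2) ∂μ‖ ≤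
        K * (M k / k.factorial) :=
      h3.trans (mul_le_mul_of_nonneg_right h4 (div_nonneg (hM k) (by positivity)))
    rw [inv_mul_le_iff₀ (by positivity)] at h5
    refine h5.trans (le_of_eq ?_)
    field_simp
  have hic : ∀ Q : ℝ[X], Integrable (fun z => ((Q.eval z : ℝ) : ℂ)) μ := fun Q => (hint Q).ofReal
  -- For even `k` the weight `P^k` is nonnegative, so the real part of the integral divided by `κ`
  -- has integrand `|P|^k(z² + βz + α)`, with `β = Re(b/κ)` and `α = Re(a/κ)`. Completing the
  -- square, `z² ≤ 2(z² + βz + α) + |β² - 2α|`, which explains the constant.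
  refine not_forall_moment_le hint hv hstein hP
    (2 * (K / ‖κ‖) + |(b / κ).re ^ 2 - 2 * (a / κ).re|) fun k hk => ?_
  set E : ℝ := (b / κ).re ^ 2 - 2 * (a / κ).re with hE
  have hiA : Integrable (fun z : ℝ => ((P.eval z : ℝ) : ℂ) ^ k * (a + b * z + κ * z ^ 2)) μ := by
    refine (((hic (P ^ k)).mul_const a).add (((hic (P ^ k * Polynomial.X)).mul_const b).add
      ((hic (P ^ k * Polynomial.X ^ 2)).mul_const κ))).congr (ae_of_all _ fun z => ?_)
    simp
    ring
  have hiB := hiA.div_const κ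
  have hre : ∀ z : ℝ, (((P.eval z : ℝ) : ℂ) ^ k * (a + b * z + κ * z ^ 2) / κ).re =
      |P.eval z| ^ k * (z ^ 2 + (b / κ).re * z + (a / κ).re) := fun z => by
    have h1 : ((P.eval z : ℝ) : ℂ) ^ k * (a + b * z + κ * z ^ 2) / κ =
        ((|P.eval z| ^ k : ℝ) : ℂ) * (((z ^ 2 : ℝ) : ℂ) + b / κ * (z : ℂ) + a / κ) := by
      rw [hk.pow_abs]
      push_cast
      field_simp
      ring
    rw [h1, Complex.re_ofReal_mul]
    simp only [Complex.add_re, Complex.ofReal_re, Complex.re_mul_ofReal]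
  have hi2 : Integrable (fun z => |P.eval z| ^ k * z ^ 2) μ := by
    refine (hint (P ^ k * Polynomial.X ^ 2)).congr (ae_of_all _ fun z => ?_)
    simp [hk.pow_abs]
  have h1 : ∫ z, |P.eval z| ^ k * z ^ 2 ∂μ ≤
      ∫ z, (2 * (((P.eval z : ℝ) : ℂ) ^ k * (a + b * z + κ * z ^ 2) / κ).re +
        |P.eval z| ^ k * |E|) ∂μ := by
    refine integral_mono hi2 ((hiB.re.const_mul 2).add ((hi k).mul_const _)) fun z => ?_
    simp only [hre]
    have h2 : z ^ 2 ≤ 2 * (z ^ 2 + (b / κ).re * z + (a / κ).re) + |E| := by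
      nlinarith [sq_nonneg (z + (b / κ).re), le_abs_self E]
    have h3 : 0 ≤ |P.eval z| ^ k := by positivity
    calc _ ≤ |P.eval z| ^ k * (2 * (z ^ 2 + (b / κ).re * z + (a / κ).re) + |E|) := by gcongr
      _ = _ := by ring
  refine h1.trans ?_
  have i1 : Integrable (fun z : ℝ =>
    2 * (((P.eval z : ℝ) : ℂ) ^ k * (a + b * z + κ * z ^ 2) / κ).re) μ := hiB.re.const_mul 2
  rw [integral_add i1 ((hi k).mul_const _), integral_const_mul, integral_mul_const, add_mul]
  have h4 : ∫ z : ℝ, (((P.eval z : ℝ) : ℂ) ^ k * (a + b * z + κ * z ^ 2) / κ).re ∂μ =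
      ((∫ z : ℝ, ((P.eval z : ℝ) : ℂ) ^ k * (a + b * z + κ * z ^ 2) ∂μ) / κ).re := by
    rw [← integral_div]
    exact integral_re hiB
  have h5 : (∫ z : ℝ, (((P.eval z : ℝ) : ℂ) ^ k * (a + b * z + κ * z ^ 2) / κ).re ∂μ) ≤
      K / ‖κ‖ * M k := by
    rw [h4]
    refine (Complex.re_le_norm _).trans ?_
    rw [norm_div, div_mul_eq_mul_div]
    gcongr
    exact hbound k
  have h6 : (∫ z, |P.eval z| ^ k ∂μ) = M k := rfl
  rw [h6]
  nlinarith

/-- Taylor expansion of `E[exp (-i t P) h]`. -/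
theorem isBigO_integral_phase_sub {μ : Measure ℝ} (P : ℝ[X]) {h : ℝ → ℂ}
    (hh : ∀ n : ℕ, Integrable (fun z => ((P.eval z : ℝ) : ℂ) ^ n * h z) μ) (n : ℕ) :
    (fun t : ℝ => ∫ z, phase (Polynomial.C t * P) z * h z ∂μ -
      (∑ k ∈ Finset.range n, Polynomial.monomial k ((-Complex.I) ^ k / k.factorial *
        ∫ z, ((P.eval z : ℝ) : ℂ) ^ k * h z ∂μ)).eval (t : ℂ)) =O[𝓝 0] fun t : ℝ => t ^ n := by
  obtain ⟨K, hK⟩ := exists_norm_exp_sub_taylor_le n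
  refine Asymptotics.IsBigO.of_bound (K * ∫ z, ‖((P.eval z : ℝ) : ℂ) ^ n * h z‖ ∂μ)
    (Eventually.of_forall fun t => ?_)
  have h0 : Integrable h μ := by simpa using hh 0
  have hph : Continuous (phase (Polynomial.C t * P)) :=
    (phase_hasTemperateGrowth _).1.continuous
  have h1 : Integrable (fun z => phase (Polynomial.C t * P) z * h z) μ :=
    h0.bdd_mul hph.aestronglyMeasurable (ae_of_all _ fun z => (norm_phase _ z).le)
  have h2 : ∀ k ∈ Finset.range n, Integrable (fun z => ((t : ℂ) ^ k * ((-Complex.I) ^ k /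
      k.factorial)) * (((P.eval z : ℝ) : ℂ) ^ k * h z)) μ := fun k _ => (hh k).const_mul _
  have h3 : (∑ k ∈ Finset.range n, Polynomial.monomial k ((-Complex.I) ^ k / k.factorial *
      ∫ z, ((P.eval z : ℝ) : ℂ) ^ k * h z ∂μ)).eval (t : ℂ) =
      ∫ z, ∑ k ∈ Finset.range n, ((t : ℂ) ^ k * ((-Complex.I) ^ k /
        k.factorial)) * (((P.eval z : ℝ) : ℂ) ^ k * h z) ∂μ := by
    rw [integral_finsetSum _ h2, Polynomial.eval_finsetSum]
    refine Finset.sum_congr rfl fun k _ => ?_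
    rw [Polynomial.eval_monomial, integral_const_mul]
    ring
  rw [h3, ← integral_sub h1 (integrable_finsetSum _ h2), mul_right_comm, ← integral_const_mul]
  refine norm_integral_le_of_norm_le ((hh n).norm.const_mul _) (ae_of_all _ fun z => ?_)
  have h4 := hK (-(t * P.eval z))
  have h5 : phase (Polynomial.C t * P) z * h z - ∑ k ∈ Finset.range n, ((t : ℂ) ^ k *
      ((-Complex.I) ^ k / k.factorial)) * (((P.eval z : ℝ) : ℂ) ^ k * h z) =
      (Complex.exp (((-(t * P.eval z) : ℝ) : ℂ) * Complex.I) - ∑ k ∈ Finset.range n,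
        (((-(t * P.eval z) : ℝ) : ℂ) * Complex.I) ^ k / (k.factorial : ℂ)) * h z := by
    rw [sub_mul, Finset.sum_mul]
    congr 1
    · simp [phase]
    · refine Finset.sum_congr rfl fun k _ => ?_
      push_cast
      rw [show -((t : ℂ) * (P.eval z : ℝ)) * Complex.I = (t : ℂ) * (-Complex.I) * (P.eval z : ℝ)
        by ring, mul_pow, mul_pow]
      ring
  rw [h5, norm_mul, norm_mul, norm_pow, norm_pow, Complex.norm_real, Real.norm_eq_abs,
    Real.norm_eq_abs]
  calc _ ≤ K * |-(t * P.eval z)| ^ n * ‖h z‖ := by gcongr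
    _ = _ := by rw [abs_neg, abs_mul, mul_pow]; ring

end Moments

end CausalSetQFT
end
noncomputable section
namespace CausalSetQFT
open MeasureTheory

/-! ### The expansion in one coupling does not terminate -/

section Quotient

open Filter Topology Asymptotics

theorem coeff_truncation (c : ℕ → ℂ) {k n : ℕ} (hk : k < n) :
    (∑ j ∈ Finset.range n, Polynomial.monomial j (c j)).coeff k = c k := by
  simp [Polynomial.finsetSum_coeff, Polynomial.coeff_monomial, hk]

/-- If the asymptotic series of a quotient terminates, then the series of the numerator is a
polynomial multiple of that of the denominator. -/
theorem coeff_eq_of_quotient {f h : ℝ → ℂ} {c d : ℕ → ℂ}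
    (hf : ∀ n : ℕ, (fun t : ℝ => f t - (∑ k ∈ Finset.range n,
      Polynomial.monomial k (c k)).eval (t : ℂ)) =O[𝓝 0] fun t : ℝ => t ^ n)
    (hh : ∀ n : ℕ, (fun t : ℝ => h t - (∑ k ∈ Finset.range n,
      Polynomial.monomial k (d k)).eval (t : ℂ)) =O[𝓝 0] fun t : ℝ => t ^ n)
    (hd : d 0 = 1) {s : ℂ[X]} {J : ℕ}
    (hs : ∀ n : ℕ, J ≤ n → (fun t : ℝ => f t / h t - s.eval (t : ℂ)) =O[𝓝 0] fun t : ℝ => t ^ n)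
    (k : ℕ) : c k = ∑ p ∈ Finset.HasAntidiagonal.antidiagonal k, s.coeff p.1 * d p.2 := by
  have h1 : Tendsto h (𝓝 0) (𝓝 1) := by
    have hz : Tendsto (fun t : ℝ => t ^ 1) (𝓝 0) (𝓝 0) := by
      simp only [pow_one]
      exact tendsto_id
    have := ((hh 1).trans_tendsto hz).add_const 1
    simpa [hd] using this
  -- At one order `n` beyond `J` and `k`, `f - s h = (f/h - s) h` is `O(t^n)`; replacing `f` and `h`
  -- by their truncations leaves a polynomial `F - s H` of order `t^n`, whose coefficient at `k` is
  -- therefore zero.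
  obtain ⟨n, hJ, hk⟩ : ∃ n, J ≤ n ∧ k < n := ⟨J + k + 1, by omega, by omega⟩
  set F := ∑ k ∈ Finset.range n, Polynomial.monomial k (c k)
  set H := ∑ k ∈ Finset.range n, Polynomial.monomial k (d k)
  have e1 : (fun t : ℝ => f t - s.eval (t : ℂ) * h t) =O[𝓝 0] fun t : ℝ => t ^ n := by
    have := (hs n hJ).mul (h1.isBigO_one ℝ)
    simp only [mul_one] at this
    refine this.congr' ?_ EventuallyEq.rfl
    filter_upwards [h1.eventually_ne one_ne_zero] with t ht
    field_simp
  have e2 : (fun t : ℝ => s.eval (t : ℂ) * (h t - H.eval (t : ℂ))) =O[𝓝 0]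
      fun t : ℝ => t ^ n := by
    have hsc : Continuous fun t : ℝ => s.eval (t : ℂ) :=
      s.continuous.comp Complex.continuous_ofReal
    have := ((hsc.tendsto 0).isBigO_one ℝ).mul (hh n)
    simpa only [one_mul] using this
  have e3 := coeff_eq_zero_of_isBigO (p := F - s * H) (n := n)
    ((((e1.sub (hf n)).add e2).congr_left fun t => by
      rw [Polynomial.eval_sub, Polynomial.eval_mul]; ring).mono nhdsWithin_le_nhds) hk
  rw [Polynomial.coeff_sub, coeff_truncation c hk, sub_eq_zero, Polynomial.coeff_mul] at e3
  rw [e3]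
  refine Finset.sum_congr rfl fun p hp => ?_
  have := Finset.HasAntidiagonal.mem_antidiagonal.mp hp
  rw [coeff_truncation d (by omega)]

theorem coeff_onLine_single {N : ℕ} (x : Fin N) (p : MvPolynomial (Fin N) ℂ) (k : ℕ) :
    (onLine (Pi.single x 1) p).coeff k = p.coeff (Finsupp.single x k) := by
  rw [coeff_onLine]
  induction p using MvPolynomial.induction_on' with
  | monomial d a =>
    have hx : ∀ d : Fin N →₀ ℕ, (d.prod fun z n => (((Pi.single x 1 : Fin N → ℝ) z : ℝ) : ℂ) ^ n) =
        if d = Finsupp.single x d.degree then 1 else 0 := fun d => by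
      split_ifs with h
      · rw [h, Finsupp.prod_single_index] <;> simp
      · obtain ⟨z, hz, hzx⟩ : ∃ z ∈ d.support, z ≠ x := by
          by_contra! hcon
          refine h ?_
          have h2 : d = Finsupp.single x (d x) :=
            Finsupp.support_subset_singleton.mp fun z hz => by simpa using hcon z hz
          rw [h2]
          simp
        refine Finset.prod_eq_zero hz ?_
        change (((Pi.single x 1 : Fin N → ℝ) z : ℝ) : ℂ) ^ d z = 0
        rw [Pi.single_eq_of_ne hzx, Complex.ofReal_zero, zero_pow (Finsupp.mem_support_iff.mp hz)]
    rw [MvPolynomial.coeff_monomial]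
    by_cases hk : k = d.degree
    · rw [MvPolynomial.homogeneousComponent_of_mem
        (MvPolynomial.isHomogeneous_monomial a hk.symm), if_pos rfl, MvPolynomial.eval_monomial, hx,
        hk]
      simp
    · rw [MvPolynomial.homogeneousComponent_of_mem
        (MvPolynomial.isHomogeneous_monomial a rfl), if_neg hk, map_zero, if_neg]
      rintro rfl
      simp at hk
  | add p q hp hq => simp [hp, hq]

end Quotient

/-! ### The law of one field when a single coupling is switched on -/

section OneCoupling

variable {N : ℕ} {Δ : Matrix (Fin N) (Fin N) ℝ} (ρ : GaussianState Δ)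

theorem causalProd_eq_one {r : ℕ} {s : Finset (Fin N)} {T : Fin N → Op r}
    (h : ∀ z ∈ s, T z = 1) : causalProd s T = 1 := by
  induction s using Finset.induction_on_max with
  | empty => exact causalProd_empty _
  | insert m s hm ih =>
    rw [causalProd_insert_max hm, ih fun z hz => h z (by simp [hz]), h m (by simp), mul_one]

theorem causalProd_eq_single {r : ℕ} {s : Finset (Fin N)} {T : Fin N → Op r} {a : Fin N}
    (hs : Finset.Iic a ⊆ s) (h : ∀ z ∈ s, z ≠ a → T z = 1) : causalProd s T = T a := by
  rw [causalProd_split hs, causalProd_eq_one (s := s \ Finset.Iic a),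
    causalProd_eq_one (s := Finset.Iio a), one_mul, mul_one]
  · exact fun z hz => h z (hs (Finset.mem_Iic.mpr (Finset.mem_Iio.mp hz).le))
      (Finset.mem_Iio.mp hz).ne
  · intro z hz
    rw [Finset.mem_sdiff, Finset.mem_Iic] at hz
    exact h z hz.1 fun hza => hz.2 hza.le

theorem causalProd_eq_pair {r : ℕ} {T : Fin N → Op r} {a b : Fin N} (hba : b < a)
    (h : ∀ z, z ≠ a → z ≠ b → T z = 1) : causalProd Finset.univ T = T a * T b := by
  rw [causalProd_split (Finset.subset_univ (Finset.Iic a)),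
    causalProd_eq_one (s := Finset.univ \ Finset.Iic a), one_mul,
    causalProd_eq_single (s := Finset.Iio a) (a := b)]
  · exact fun z hz => Finset.mem_Iio.mpr ((Finset.mem_Iic.mp hz).trans_lt hba)
  · exact fun z hz => h z (Finset.mem_Iio.mp hz).ne
  · intro z hz
    rw [Finset.mem_sdiff, Finset.mem_Iic, not_le] at hz
    exact h z hz.2.ne' (hba.trans hz.2).ne'

theorem cov_self (x : Fin N) : ρ.cov x x = (((ρ.cov x x).re : ℝ) : ℂ) ∧ 0 ≤ (ρ.cov x x).re := by
  have h : ρ.cov x x = ((∑ k, ‖ρ.amp x k‖ ^ 2 : ℝ) : ℂ) := by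
    rw [cov_apply]
    push_cast
    exact Finset.sum_congr rfl fun k _ => by rw [Complex.mul_conj']
  rw [h, Complex.ofReal_re]
  exact ⟨rfl, by positivity⟩

/-- The variance is `∑ |A_{xk}|²`; if it vanished, so would the row `A_x` and every covariance with
`φ_x`. -/
theorem cov_self_pos {x y : Fin N} (h : ρ.cov x y ≠ 0 ∨ ρ.cov y x ≠ 0) : 0 < (ρ.cov x x).re := by
  refine (cov_self ρ x).2.lt_of_ne' fun h0 => ?_
  have h1 : ∑ k, ‖ρ.amp x k‖ ^ 2 = 0 := by
    have h2 : ρ.cov x x = ((∑ k, ‖ρ.amp x k‖ ^ 2 : ℝ) : ℂ) := by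
      rw [cov_apply]
      push_cast
      exact Finset.sum_congr rfl fun k _ => by rw [Complex.mul_conj']
    rw [(cov_self ρ x).1, h0] at h2
    exact_mod_cast h2.symm
  have h2 : ∀ k, ρ.amp x k = 0 := fun k => by
    have := (Finset.sum_eq_zero_iff_of_nonneg fun k _ => by positivity).mp h1 k (Finset.mem_univ k)
    simpa using this
  rcases h with h | h
  · exact h (by simp [cov_apply, h2])
  · exact h (by simp [cov_apply, h2])

theorem vev_field_mul_field (x y : Fin N) :
    vev (field ρ x * field ρ y) = ρ.mean x * ρ.mean y + ρ.cov x y := by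
  have hid : (fun t : ℝ => (t : ℂ)).HasTemperateGrowth := by fun_prop
  have h1 := vev_fn_mul_field ρ x y (f := fun t => (t : ℂ)) (f' := fun _ => 1) hid (by fun_prop)
    (fun t => (hasDerivAt_id t).ofReal_comp)
  have h2 := vev_fn_mul_field ρ x x (f := fun _ => 1) (f' := fun _ => 0) (by fun_prop) (by fun_prop)
    (fun t => hasDerivAt_const _ _)
  have h3 : (fieldDiag ρ x).fn (fun _ => 0) = 0 := by simpa using (fieldDiag ρ x).fn_const 0
  rw [(fieldDiag ρ x).fn_one, vev_one, h3, one_mul, ← vevₗ_apply (0 : Op _), map_zero] at h2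
  rw [(fieldDiag ρ x).fn_id, (fieldDiag ρ x).fn_one, vev_one, h2] at h1
  rw [h1]
  ring

/-- Integration by parts for the distribution of a field. -/
theorem integral_law_mul_sub (x : Fin N) {f f' : ℝ → ℂ} (hf : f.HasTemperateGrowth)
    (hf' : f'.HasTemperateGrowth) (hd : ∀ t, HasDerivAt f (f' t) t) :
    ∫ z, f z * ((z : ℂ) - ρ.mean x) ∂(fieldDiag ρ x).law =
      ρ.cov x x * ∫ z, f' z ∂(fieldDiag ρ x).law := by
  have hid : (fun t : ℝ => (t : ℂ)).HasTemperateGrowth := by fun_prop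
  have h1 := vev_fn_mul_field ρ x x hf hf' hd
  have h2 : (fieldDiag ρ x).fn f * field ρ x = (fieldDiag ρ x).fn fun t => f t * (t : ℂ) := by
    rw [(fieldDiag ρ x).fn_mul hf hid, (fieldDiag ρ x).fn_id]
  rw [h2, (fieldDiag ρ x).vev_fn (hf.fun_mul hid), (fieldDiag ρ x).vev_fn hf,
    (fieldDiag ρ x).vev_fn hf'] at h1
  simp only [mul_sub]
  rw [integral_sub ((fieldDiag ρ x).integrable_law (hf.fun_mul hid))
    (((fieldDiag ρ x).integrable_law hf).mul_const _), h1, integral_mul_const]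
  ring

theorem integral_law_eval (x : Fin N) (Q : ℝ[X]) :
    ∫ z, Q.eval z * (z - ρ.mean x) ∂(fieldDiag ρ x).law =
      (ρ.cov x x).re * ∫ z, Q.derivative.eval z ∂(fieldDiag ρ x).law := by
  have h := integral_law_mul_sub ρ x (hasTemperateGrowth_ofReal (hasTemperateGrowth_eval Q))
    (hasTemperateGrowth_ofReal (hasTemperateGrowth_eval Q.derivative))
    (fun t => (Q.hasDerivAt t).ofReal_comp)
  rw [(cov_self ρ x).1] at h
  simp only [← Complex.ofReal_sub, ← Complex.ofReal_mul, integral_complex_ofReal] at h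
  exact_mod_cast h

theorem integrable_law_eval (x : Fin N) (Q : ℝ[X]) :
    Integrable (fun z => Q.eval z) (fieldDiag ρ x).law := by
  have h := (fieldDiag ρ x).integrable_law
    (hasTemperateGrowth_ofReal (hasTemperateGrowth_eval Q))
  simpa using h.re

end OneCoupling

/-! ### Non-termination of the in-out expansion -/

section NonTermination

open Filter Topology Asymptotics

variable {N : ℕ} {C : Causet N} {ΔR : Matrix (Fin N) (Fin N) ℝ}
  (ρ : GaussianState (pauliJordan ΔR)) (P : Fin N → ℝ[X])

/-- Causal order may be replaced by label order, since the two differ only for unrelated elements,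
whose fields commute. -/
theorem feynman_sub (hR : IsRetarded C ΔR) (x y : Fin N) :
    feynman ρ C x y - ρ.mean x * ρ.mean y = if x < y then ρ.cov y x else ρ.cov x y := by
  rw [feynman]
  by_cases h : C.prec y x
  · rw [if_pos h, vev_field_mul_field, if_neg (C.natural _ _ h).asymm]
    ring
  · rw [if_neg h]
    split_ifs with hxy
    · rw [vev_field_mul_field]
      ring
    · rcases eq_or_ne x y with rfl | hne
      · rw [vev_field_mul_field]
        ring
      · rw [(commute_field ρ (pauliJordan_eq_zero hR
          (fun h' => hxy (C.natural _ _ h')) h)).eq.symm, vev_field_mul_field]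
        ring

theorem fieldPhase_couple_smul_single (x : Fin N) (t : ℝ) :
    (fun z => fieldPhase ρ (couple (t • Pi.single x 1) P z) z) =
      Function.update (fun _ => 1) x (fieldPhase ρ (Polynomial.C t * P x) x) := by
  funext z
  by_cases h : z = x
  · subst h
    simp [couple]
  · simp [couple, h, fieldPhase_zero]

theorem vev_sOperator_single (x : Fin N) (t : ℝ) :
    vev (sOperator ρ (couple (t • Pi.single x 1) P)) =
      ∫ z, phase (Polynomial.C t * P x) z ∂(fieldDiag ρ x).law := by
  rw [sOperator_eq, fieldPhase_couple_smul_single, causalProd_eq_single (Finset.subset_univ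
    (Finset.Iic x)) fun z _ hz => Function.update_of_ne hz _ _, Function.update_self]
  exact (fieldDiag ρ x).vev_fn (phase_hasTemperateGrowth _)

theorem vev_sOperator_mul_causalHeisenberg_single (hR : IsRetarded C ΔR) (x y : Fin N) (t : ℝ) :
    vev (sOperator ρ (couple (t • Pi.single x 1) P) *
        causalHeisenberg ρ C (couple (t • Pi.single x 1) P) x y) =
      if x < y then vev (field ρ y * (fieldPhase ρ (Polynomial.C t * P x) x * field ρ x))
      else vev (fieldPhase ρ (Polynomial.C t * P x) x * field ρ x * field ρ y) := by
  have hx : fieldPhase ρ (couple (t • Pi.single x 1) P x) x =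
      fieldPhase ρ (Polynomial.C t * P x) x := by simp [couple]
  rcases eq_or_ne x y with rfl | hne
  · rw [sOperator_mul_causalHeisenberg_self ρ _ hR, fieldPhase_couple_smul_single,
      Function.update_idem, causalProd_eq_single (Finset.subset_univ (Finset.Iic x))
        fun z _ hz => Function.update_of_ne hz _ _, Function.update_self, hx, if_neg (lt_irrefl x),
      mul_assoc]
  · have hy : fieldPhase ρ (couple (t • Pi.single x 1) P y) y = 1 := by
      simp [couple, hne.symm, fieldPhase_zero]
    have h1 : ∀ z, z ≠ x → z ≠ y → (Function.update (Function.update (Function.update (fun _ => 1) x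
        (fieldPhase ρ (Polynomial.C t * P x) x)) y (field ρ y)) x
        (fieldPhase ρ (Polynomial.C t * P x) x * field ρ x) : Fin N → Op ρ.numModes) z = 1 :=
        fun z hzx hzy => by
      rw [Function.update_of_ne hzx, Function.update_of_ne hzy, Function.update_of_ne hzx]
    rw [sOperator_mul_causalHeisenberg_of_ne ρ _ hR hne, fieldPhase_couple_smul_single, hx, hy,
      one_mul]
    split_ifs with hxy
    · rw [causalProd_eq_pair hxy fun z hzy hzx => h1 z hzx hzy, Function.update_self,
        Function.update_of_ne hne.symm, Function.update_self]
    · rw [causalProd_eq_pair (lt_of_le_of_ne (not_lt.mp hxy) hne.symm) h1, Function.update_self,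
        Function.update_of_ne hne.symm, Function.update_self]

/-- The numerator of the in-out correlator is the vacuum expectation value of a function of one
field. -/
theorem vev_causalHeisenberg_single_eq_integral (hR : IsRetarded C ΔR) (x y : Fin N)
    (hv : (ρ.cov x x).re ≠ 0) (t : ℝ) :
    vev (sOperator ρ (couple (t • Pi.single x 1) P) *
        causalHeisenberg ρ C (couple (t • Pi.single x 1) P) x y) =
      ∫ z : ℝ, phase (Polynomial.C t * P x) z * (0 + (ρ.mean y -
        (feynman ρ C x y - ρ.mean x * ρ.mean y) / ρ.cov x x * ρ.mean x) * z +
        (feynman ρ C x y - ρ.mean x * ρ.mean y) / ρ.cov x x * z ^ 2) ∂(fieldDiag ρ x).law := by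
  have hv' : ρ.cov x x ≠ 0 := by
    rw [(cov_self ρ x).1]
    exact_mod_cast hv
  have hid : (fun t : ℝ => (t : ℂ)).HasTemperateGrowth := by fun_prop
  have hph := phase_hasTemperateGrowth (Polynomial.C t * P x)
  have hph' := ((Function.HasTemperateGrowth.const (-Complex.I)).fun_mul (hasTemperateGrowth_ofReal
    (hasTemperateGrowth_eval (Polynomial.C t * P x).derivative))).fun_mul hph
  have hf := hph.fun_mul hid
  have hf' := (hph'.fun_mul hid).fun_add (hph.fun_mul (Function.HasTemperateGrowth.const 1))
  set f' : ℝ → ℂ := fun z => -Complex.I * (((Polynomial.C t * P x).derivative.eval z : ℝ) : ℂ) *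
    phase (Polynomial.C t * P x) z * (z : ℂ) + phase (Polynomial.C t * P x) z * 1
  have hd : ∀ z : ℝ, HasDerivAt (fun z : ℝ => phase (Polynomial.C t * P x) z * (z : ℂ)) (f' z) z :=
    fun z => ((phase_hasDerivAt (Polynomial.C t * P x) z).mul
      (hasDerivAt_id z).ofReal_comp).congr_deriv (by simp [f'])
  have hop : fieldPhase ρ (Polynomial.C t * P x) x * field ρ x =
      (fieldDiag ρ x).fn fun z => phase (Polynomial.C t * P x) z * (z : ℂ) := by
    rw [(fieldDiag ρ x).fn_mul hph hid, (fieldDiag ρ x).fn_id]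
    rfl
  have key : vev (sOperator ρ (couple (t • Pi.single x 1) P) *
        causalHeisenberg ρ C (couple (t • Pi.single x 1) P) x y) =
      ρ.mean y * vev (fieldPhase ρ (Polynomial.C t * P x) x * field ρ x) +
        (feynman ρ C x y - ρ.mean x * ρ.mean y) * vev ((fieldDiag ρ x).fn f') := by
    rw [vev_sOperator_mul_causalHeisenberg_single ρ P hR, feynman_sub ρ hR, hop]
    split_ifs with hxy
    · exact vev_field_mul_fn ρ x y hf hf' hd
    · exact vev_fn_mul_field ρ x y hf hf' hd
  rw [key, hop, (fieldDiag ρ x).vev_fn hf, (fieldDiag ρ x).vev_fn hf']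
  set τ := feynman ρ C x y - ρ.mean x * ρ.mean y
  -- Integration by parts in reverse: `E f'` becomes `E[f (z - m_x)]` over the variance. As `f` is
  -- the phase times `z`, the integrand is the phase times a quadratic.
  have hst := integral_law_mul_sub ρ x hf hf' hd
  rw [← div_mul_cancel₀ τ hv', mul_assoc, ← hst, ← integral_const_mul, ← integral_const_mul,
    ← integral_add (((fieldDiag ρ x).integrable_law hf).const_mul _)
      (((fieldDiag ρ x).integrable_law (hf.fun_mul (hid.fun_sub
        (Function.HasTemperateGrowth.const _)))).const_mul _)]
  refine integral_congr_ae (ae_of_all _ fun z => ?_)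
  simp only [div_mul_cancel₀ τ hv']
  ring

/-- The expansion of the in-out correlator in the coupling at `x` does not terminate. -/
theorem infinite_coeff_inOut (hR : IsRetarded C ΔR) (x y : Fin N) {S : MvPowerSeries (Fin N) ℂ}
    (hS : IsExpansion (fun g => inOut ρ C (couple g P) x y) S) (hP : 2 ≤ (P x).natDegree)
    (hF : feynman ρ C x y ≠ ρ.mean x * ρ.mean y) :
    {n : ℕ | MvPowerSeries.coeff (Finsupp.single x n) S ≠ 0}.Infinite := by
  intro hfin
  have hτ := sub_ne_zero.mpr hF
  have hv : 0 < (ρ.cov x x).re := by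
    refine cov_self_pos ρ (y := y) ?_
    rw [feynman_sub ρ hR] at hτ
    split_ifs at hτ
    · exact Or.inr hτ
    · exact Or.inl hτ
  have hcov : ρ.cov x x ≠ 0 := by
    rw [(cov_self ρ x).1]
    exact_mod_cast hv.ne'
  have hmom : ∀ (k : ℕ) (a b c : ℂ), Integrable (fun z : ℝ => (((P x).eval z : ℝ) : ℂ) ^ k *
      (a + b * z + c * z ^ 2)) (fieldDiag ρ x).law := fun k a b c =>
    (fieldDiag ρ x).integrable_law (((hasTemperateGrowth_ofReal
      (hasTemperateGrowth_eval (P x))).fun_pow k).fun_mul (by fun_prop))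
  obtain ⟨J, hJ⟩ := hfin.bddAbove
  have hline : ∀ n k, (onLine (Pi.single x 1) (MvPowerSeries.truncTotal n S)).coeff k =
      if k < n then MvPowerSeries.coeff (Finsupp.single x k) S else 0 := fun n k => by
    rw [coeff_onLine_single, MvPowerSeries.coeff_truncTotal_eq_ite]
    simp
  refine not_forall_coeff_eq (integrable_law_eval ρ x) hv (integral_law_eval ρ x) hP (a := 0)
    (b := ρ.mean y - (feynman ρ C x y - ρ.mean x * ρ.mean y) / ρ.cov x x * ρ.mean x)
    (div_ne_zero hτ hcov) (onLine (Pi.single x 1) (MvPowerSeries.truncTotal (J + 1) S))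
    (coeff_eq_of_quotient (isBigO_integral_phase_sub (P x) fun k => hmom k _ _ _)
      (h := fun t => ∫ z, phase (Polynomial.C t * P x) z ∂(fieldDiag ρ x).law)
      (d := fun k => (-Complex.I) ^ k / k.factorial *
        ∫ z : ℝ, (((P x).eval z : ℝ) : ℂ) ^ k ∂(fieldDiag ρ x).law) (fun n => ?_) ?_
      (J := J + 1) fun n hn => ?_)
  · simpa using isBigO_integral_phase_sub (h := fun _ => 1) (P x)
      (fun k => by simpa using hmom k 1 0 0) n
  · simp
  -- No pure power of `g_x` beyond `J` occurs, so along the `x` axis every truncation of order at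
  -- least `J + 1` restricts to the same polynomial.
  · have h1 : onLine (Pi.single x 1) (MvPowerSeries.truncTotal (J + 1) S) =
        onLine (Pi.single x 1) (MvPowerSeries.truncTotal n S) := by
      ext k
      rw [hline, hline]
      by_cases hk : k < J + 1
      · rw [if_pos hk, if_pos (by omega)]
      · have : MvPowerSeries.coeff (Finsupp.single x k) S = 0 := by
          by_contra hne
          exact hk (Nat.lt_succ_of_le (hJ hne))
        simp [this]
    have h2 : Tendsto (fun t : ℝ => t • (Pi.single x 1 : Fin N → ℝ)) (𝓝 0) (𝓝 0) := by
      have : Continuous fun t : ℝ => t • (Pi.single x 1 : Fin N → ℝ) := by fun_prop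
      simpa using this.tendsto 0
    refine ((hS n).comp_tendsto h2).congr' (Eventually.of_forall fun t => ?_) ?_ |>.trans
      (isBigO_refl (fun t : ℝ => ‖t‖ ^ n) _) |>.trans (isBigO_of_le _ fun t => by simp)
    · simp only [Function.comp_apply]
      rw [h1, eval_onLine, inOut, vev_causalHeisenberg_single_eq_integral ρ P hR x y hv.ne',
        vev_sOperator_single]
    · refine Eventually.of_forall fun t => ?_
      simp [norm_smul, Pi.norm_single]

end NonTermination

end CausalSetQFT
end

theorem mainTheorem7 {N : ℕ} (C : CausalSetQFT.Causet N) (ΔR : Matrix (Fin N) (Fin N) ℝ)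
    (hR : CausalSetQFT.IsRetarded C ΔR)
    (ρ : CausalSetQFT.GaussianState (CausalSetQFT.pauliJordan ΔR))
    (P : Fin N → Polynomial ℝ) (x y : Fin N) :
    -- the integrals that define the generating functional converge
    (∃ v, CausalSetQFT.HasDecoherenceIntegral ρ (CausalSetQFT.inOutWeight P) v) ∧
    (∀ J : Fin N → ℝ, ∃ v, CausalSetQFT.HasDecoherenceIntegral ρ
      (fun p => CausalSetQFT.inOutWeight P p * CausalSetQFT.sourceFactor J p) v) ∧
    -- the denominator
    CausalSetQFT.decoherenceIntegral ρ (CausalSetQFT.inOutWeight P) =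
      CausalSetQFT.vev (CausalSetQFT.sOperator ρ P) ∧
    -- the second derivatives
    (CausalSetQFT.vev (CausalSetQFT.sOperator ρ P) ≠ 0 →
      (∀ J : Fin N → ℝ,
        LineDifferentiableAt ℝ (CausalSetQFT.inOutZ ρ P) J (Pi.single y 1)) ∧
      LineDifferentiableAt ℝ (CausalSetQFT.iPartial y (CausalSetQFT.inOutZ ρ P)) 0
        (Pi.single x 1) ∧
      CausalSetQFT.iPartial x (CausalSetQFT.iPartial y (CausalSetQFT.inOutZ ρ P)) 0 =
        CausalSetQFT.vev (CausalSetQFT.sOperator ρ P *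
          CausalSetQFT.causalHeisenberg ρ C P x y) /
          CausalSetQFT.vev (CausalSetQFT.sOperator ρ P)) ∧
    -- the in-in expansion terminates
    (∃ S : MvPolynomial (Fin N) ℂ, ∀ g : Fin N → ℝ,
      CausalSetQFT.inIn ρ C (CausalSetQFT.couple g P) x y =
        MvPolynomial.eval (fun z => (g z : ℂ)) S) ∧
    -- the in-out expansion does not
    (∃ S : MvPowerSeries (Fin N) ℂ,
      CausalSetQFT.IsExpansion
        (fun g => CausalSetQFT.inOut ρ C (CausalSetQFT.couple g P) x y) S ∧
      (2 ≤ (P x).natDegree →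
        CausalSetQFT.feynman ρ C x y ≠ (ρ.mean x : ℂ) * (ρ.mean y : ℂ) →
        {n : ℕ | MvPowerSeries.coeff (Finsupp.single x n) S ≠ 0}.Infinite)) := by
  obtain ⟨S, hS⟩ := CausalSetQFT.exists_isExpansion_inOut ρ C P x y
  have hint := CausalSetQFT.hasDecoherenceIntegral_inOutWeight ρ
  refine ⟨⟨_, hint P⟩, fun J => ?_, (hint P).decoherenceIntegral_eq, fun _ => ⟨fun J => ?_, ?_, ?_⟩,
    CausalSetQFT.exists_polynomial_inIn ρ C P x y, S, hS,
    CausalSetQFT.infinite_coeff_inOut ρ P hR x y hS⟩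
  · rw [CausalSetQFT.inOutWeight_mul_sourceFactor]
    exact ⟨_, hint _⟩
  · exact (CausalSetQFT.hasLineDerivAt_inOutZ ρ P J y).lineDifferentiableAt
  · exact (CausalSetQFT.hasLineDerivAt_iPartial_inOutZ hR ρ P x y).lineDifferentiableAt
  · rw [CausalSetQFT.iPartial, (CausalSetQFT.hasLineDerivAt_iPartial_inOutZ hR ρ P x y).lineDeriv,
      mul_div_assoc, ← mul_assoc]
    simp
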